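/- **Setting.** Let $(\psi_{kl})_{k,l\in\mathbb Z}$ be non-negative numbers with $\max_{k,l}\psi_{kl}=1$ and $\sum_{k,l}\psi_{kl}<\infty$, and let $(\eta_{it})_{i,t\in\mathbb Z}$ be an iid field of real random variables with generic element $\eta$. Assume that $\mathbb P(e^{\eta}>x)=x^{-\alpha}L(x)$, $x>0$, for some $\alpha>0$ and a slowly varying function $L$, and that for all $i,t\in\mathbb Z$ the series $\sum_{k,l}\psi_{kl}\,\eta_{i-k,t-l}$ converges absolutely almost surely. Define the log-linear volatility field $$\sigma_{it}=\exp\Big(\sum_{k,l=-\infty}^{\infty}\psi_{kl}\,\eta_{i-k,t-l}\Big),\qquad i,t\in\mathbb Z .$$ Assume moreover that either $\mathbb E[e^{\alpha\eta}]=\infty$, or $$\lim_{x\to\infty}\frac{\mathbb P(\eta_1+\eta_2>x)}{\mathbb P(\eta_1>x)}=c\quad\text{for some } c\in(0,\infty),$$ where $\eta_1,\eta_2$ are independent copies of $\eta$ (convolution equivalence). For $i,j\in\mathbb Z$ put $\psi^{ij}=\max_{k,l}(\psi_{kl}+\psi_{k+i-j,l})$, and for $d\ge1$ and $\mathbf i=(i_1,\dots,i_d),\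 \mathbf j=(j_1,\dots,j_d)\in\mathbb Z^d$ put $\psi^{\mathbf i,\mathbf j}=\max_{1\le l\le d}\psi^{i_l,j_l}$. **Definition.** A strictly stationary $\mathbb R^d$-valued sequence $(\mathbf Y_t)_{t\in\mathbb Z}$ is *regularly varying with index $\gamma>0$* if for every norm $\|\cdot\|$ on $\mathbb R^d$ and every $h\ge0$ there is a non-null Radon measure $\mu_h$ on $[-\infty,\infty]^{d(h+1)}\setminus\{\mathbf 0\}$ with $\mu_h(cB)=c^{-\gamma}\mu_h(B)$ for all $c>0$ and Borel sets $B$, such that, as $x\to\infty$, $$\frac{\mathbb P\big(x^{-1}(\mathbf Y_0,\dots,\mathbf Y_h)\in\cdot\,\big)}{\mathbb P(\|\mathbf Y_0\|>x)}\ \xrightarrow{\ v\ }\ \mu_h(\cdot)$$ vaguely on $[-\infty,\infty]^{d(h+1)}\setminus\{\mathbf 0\}$. **Proposition.** In this setting the following sequences are strictly stationary and regularly varying: 1. for every $i\in\mathbb Z$, the sequence $(\sigma_{it})_{t\in\mathbb Z}$, with index $\alpha$; 2. for all $i,j\in\mathbb Z$, the sequence $(\sigma_{it}\sigma_{jt})_{t\in\mathbb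 Z}$, with index $\alpha/\psi^{ij}$; 3. for every $d\ge1$ and all $\mathbf i,\mathbf j\in\mathbb Z^d$, the $d$-variate sequence $\big((\sigma_{i_k t}\sigma_{j_k t})_{1\le k\le d}\big)_{t\in\mathbb Z}$, with index $\alpha/\psi^{\mathbf i,\mathbf j}$. -/

import Mathlib

open MeasureTheory ProbabilityTheory Filter Topology
open scoped CompactlySupported

namespace SVField

noncomputable section

/-- `L` is slowly varying (at infinity). -/
structure SlowlyVarying (L : ℝ → ℝ) : Prop where
  measurable : Measurable L
  eventually_pos : ∀ᶠ x in atTop, 0 < L x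
  tendsto_ratio : ∀ c : ℝ, 0 < c → Tendsto (fun x => L (c * x) / L x) atTop (𝓝 1)

/-- For a random variable `η` with law `ν`: the random variable `exp η` is regularly varying
with index `α`, that is `ℙ(exp η > x) = x ^ (-α) * L x` for `x > 0`, with `L` slowly varying. -/
def ExpTail (ν : Measure ℝ) (α : ℝ) : Prop :=
  ∃ L : ℝ → ℝ, SlowlyVarying L ∧
    ∀ x : ℝ, 0 < x → ν.real {y | x < Real.exp y} = x ^ (-α) * L x

/-- `E[exp (α η)] = ∞`, where `ν` is the law of `η`. -/
def InfiniteExpMoment (ν : Measure ℝ) (α : ℝ) : Prop :=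
  ∫⁻ y, ENNReal.ofReal (Real.exp (α * y)) ∂ν = ⊤

/-- `ℙ(η₁ + η₂ > x) / ℙ(η₁ > x)` has a limit in `(0, ∞)` as `x → ∞`, where `η₁`, `η₂` are
independent with law `ν`. -/
def ConvolutionTailLimit (ν : Measure ℝ) : Prop :=
  ∃ c : ℝ, 0 < c ∧
    Tendsto (fun x : ℝ => (ν.prod ν).real {p | x < p.1 + p.2} / ν.real (Set.Ioi x)) atTop (𝓝 c)

/-- The log-linear volatility field
`σ_{it} = exp (∑_{k,l} ψ_{kl} η_{i-k,t-l})`. -/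
def volatility {Ω : Type*} (ψ : ℤ → ℤ → ℝ) (η : ℤ → ℤ → Ω → ℝ) (i t : ℤ) (ω : Ω) : ℝ :=
  Real.exp (∑' p : ℤ × ℤ, ψ p.1 p.2 * η (i - p.1) (t - p.2) ω)

/-- `ψ^{ij} = max_{k,l} (ψ_{kl} + ψ_{k+i-j,l})`. The supremum is a maximum when the `ψ_{kl}`
are non-negative, summable and not all zero. -/
def psiPair (ψ : ℤ → ℤ → ℝ) (i j : ℤ) : ℝ :=
  ⨆ p : ℤ × ℤ, (ψ p.1 p.2 + ψ (p.1 + i - j) p.2)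

/-- `ψ^{𝐢,𝐣} = max_{1 ≤ l ≤ d} ψ^{i_l,j_l}` (used for `d ≥ 1`). -/
def psiMulti (ψ : ℤ → ℤ → ℝ) {d : ℕ} (i j : Fin d → ℤ) : ℝ :=
  ⨆ l : Fin d, psiPair ψ (i l) (j l)

/-- The punctured compactified space `[-∞, ∞]^ι \ {0}`, with the subspace topology of the product
topology and its Borel `σ`-field. -/
abbrev Punctured (ι : Type*) : Type _ := {x : ι → EReal // x ≠ 0}

/-- The dilated set `c B = {c x : x ∈ B}`. -/
def dilate {ι : Type*} (c : ℝ) (B : Set (Punctured ι)) : Set (Punctured ι) :=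
  {y | ∃ x ∈ B, ∀ a, y.1 a = (c : EReal) * x.1 a}

/-- `μ(c B) = c ^ (-γ) μ(B)` for all `c > 0` and all Borel sets `B`. -/
def HomogeneousMeasure {ι : Type*} (γ : ℝ) (μ : Measure (Punctured ι)) : Prop :=
  ∀ c : ℝ, 0 < c → ∀ B : Set (Punctured ι), MeasurableSet B →
    μ (dilate c B) = ENNReal.ofReal (c ^ (-γ)) * μ B

/-- The measure `ℙ(x⁻¹ V ∈ ·)` on the Borel sets of `[-∞, ∞]^ι \ {0}`. -/
def scaledLaw {Ω : Type*} [MeasurableSpace Ω] (P : Measure Ω) {ι : Type*} (V : Ω → ι → ℝ) (x : ℝ) :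
    Measure (Punctured ι) :=
  (P.map (fun ω a => ((x⁻¹ * V ω a : ℝ) : EReal))).comap Subtype.val

/-- Strict stationarity of a sequence indexed by `ℤ`: its law on the sequence space is invariant
under all time shifts. -/
def StrictlyStationary {Ω : Type*} [MeasurableSpace Ω] (P : Measure Ω) {d : ℕ}
    (Y : ℤ → Ω → Fin d → ℝ) : Prop :=
  ∀ s : ℤ, IdentDistrib (fun ω (t : ℤ) => Y (t + s) ω) (fun ω (t : ℤ) => Y t ω) P P

/-- The strictly stationary `ℝ^d`-valued sequence `(Y_t)` is regularly varying with index `γ > 0`: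
for each `h ≥ 0` there is a non-null Radon measure `μ` on `[-∞, ∞]^{d(h+1)} \ {0}`, homogeneous
of order `-γ`, such that `ℙ(x⁻¹ (Y_0, …, Y_h) ∈ ·) / ℙ(N(Y_0) > x)` converges vaguely to `μ` as
`x → ∞`. Here `N` is any norm on `ℝ^d`, and vague convergence is tested on the continuous
functions with compact support. A Borel measure on this second countable locally compact space
is Radon as soon as it is finite on compact sets. -/
structure RegularlyVaryingSeq {Ω : Type*} [MeasurableSpace Ω] (P : Measure Ω) {d : ℕ}
    (Y : ℤ → Ω → Fin d → ℝ) (γ : ℝ) : Prop where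
  index_pos : 0 < γ
  stationary : StrictlyStationary P Y
  vague_limit : ∀ N : Seminorm ℝ (Fin d → ℝ), (∀ v, N v = 0 → v = 0) → ∀ h : ℕ,
    ∃ μ : Measure (Punctured (Fin (h + 1) × Fin d)),
      μ ≠ 0 ∧ IsFiniteMeasureOnCompacts μ ∧ HomogeneousMeasure γ μ ∧
      ∀ f : C_c(Punctured (Fin (h + 1) × Fin d), ℝ),
        Tendsto
          (fun x : ℝ =>
            (∫ y, f y ∂(scaledLaw P
                (fun ω (a : Fin (h + 1) × Fin d) => Y ((a.1 : ℕ) : ℤ) ω a.2) x)) /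
              P.real {ω | x < N (Y 0 ω)})
          atTop (𝓝 (∫ y, f y ∂μ))

end

end SVField

/-!
On the logarithmic scale the volatilities are linear forms of an iid field. After division by the
largest coefficient `M` that occurs in the vector under consideration, they become forms
`L_a = ∑ w_a(q) ξ_q` with coefficients in `[0, 1]`, in which `ξ_q` has a tail `H` with
`H (u - y) / H u → exp (γ y)`, `γ = α / M` (`ExpVarying`). Terms whose coefficients stay below some
`θ < 1` have an exponential moment of order larger than `γ`, by convexity of the exponential, and
so only the finitely many coefficients equal to one matter. They act through Breiman's lemma: if
`ξ` is independent of a vector `R ≥ 0` with a moment of order larger than `γ`, then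
`E g (exp (ξ - u) R) / H u` converges to the expected integral of `g` along the ray through `R`,
against the measure `γ exp (-γ s) ds` on the logarithmic scale (`tendsto_integral_exp_mul`). The two
alternatives of the hypothesis lead to limits of this kind for different reasons.

* If `E exp (γ ξ) = ∞`, the tail of a convolution power of `ξ` is negligible with respect to the
  tail of any higher power, and all these tails are `ExpVarying`. A form is then as large as the sum
  of the variables with coefficient one, so only the coordinates with the maximal number of such
  coefficients survive. Two coordinates with different sets of such coefficients are not
  simultaneously large: their minimum is at most their mean, in which fewer coefficients equal one
  (`isLimitFamily_of_infinite_moment`).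
* If `E exp (γ ξ) < ∞` and `P(ξ + ξ' > u) ∼ c P(ξ > u)`, the constant satisfies
  `c ≤ 2 E exp (γ ξ)` (`convolution_constant_le`). Hence two independent copies are jointly large
  only with negligible probability (`bothLarge_self_le`), a large value of a form is due to one
  single large variable with coefficient one, and the limit is a sum over these variables
  (`isLimitFamily_of_convolution`).

Both cases produce an `IsLimitFamily`: on test functions, the normalised law of `exp L` converges to
a finite sum of images of the radial measure along random rays. Integrated over the rays, this sum
is a homogeneous measure on `[-∞, ∞]^ι`, finite away from the origin (`rayMeasure`). The tail of a norm
of the vector at time zero is proportional to `H` (`IsLimitFamily.tendsto_norm_tail`), with a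
positive constant because some coordinate at time zero has the largest possible tail: the
coefficients at different times are translates of each other. Compactness of `[-∞, ∞]^ι` turns
continuous functions with compact support in the punctured space into test functions
(`testFn_zeroExtend`), which gives the vague convergence (`IsLimitFamily.exists_limit_measure`).
-/

namespace SVField

set_option linter.unusedSectionVars false

/-! ### Exponentially varying tails -/

/-- A survival function `H` whose logarithmic index is `γ`: `H (u - y) / H u → exp (γ y)` as
`u → ∞`. Equivalently, `x ↦ H (log x)` is regularly varying with index `-γ`. -/
structure ExpVarying (H : ℝ → ℝ) (γ : ℝ) : Prop where
  pos : ∀ u, 0 < H u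
  anti : Antitone H
  le_one : ∀ u, H u ≤ 1
  lim : ∀ y, Tendsto (fun u => H (u - y) / H u) atTop (𝓝 (Real.exp (γ * y)))

/-- Potter's bound, in additive form. -/
lemma ExpVarying.potter {H : ℝ → ℝ} {γ β : ℝ} (hH : ExpVarying H γ) (hγ : 0 < γ) (hβ : γ < β) :
    ∃ C u₀ : ℝ, 0 < C ∧ ∀ u, u₀ ≤ u → ∀ y, H (u - y) ≤ C * (1 + Real.exp (β * y)) * H u := by
  have h1 : ∀ᶠ u in atTop, H (u - 1) / H u < Real.exp β :=
    (hH.lim 1).eventually_lt_const (by simpa using hβ)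
  obtain ⟨u₀, hu₀⟩ := eventually_atTop.1 h1
  have hstep : ∀ u, u₀ ≤ u → H (u - 1) ≤ Real.exp β * H u := fun u hu =>
    ((div_lt_iff₀ (hH.pos u)).1 (hu₀ u hu)).le
  have hβ0 : 0 < β := hγ.trans hβ
  set C₀ := 1 / H (u₀ + 1) with hC₀
  have hC₀pos : 0 < C₀ := one_div_pos.2 (hH.pos _)
  have hind : ∀ n : ℕ, ∀ u, u₀ ≤ u → H (u - n) ≤ C₀ * Real.exp (β * n) * H u := by
    have hone : 1 ≤ C₀ := by rw [hC₀, le_div_iff₀ (hH.pos _)]; simpa using hH.le_one _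
    intro n
    induction n with
    | zero =>
      intro u _
      simpa using le_mul_of_one_le_left (hH.pos u).le hone
    | succ n ih =>
      intro u hu
      by_cases h : u₀ ≤ u - 1
      · have h2 := ih (u - 1) h
        have h3 := hstep u hu
        calc H (u - ((n + 1 : ℕ) : ℝ)) = H (u - 1 - n) := by push_cast; ring_nf
          _ ≤ C₀ * Real.exp (β * n) * H (u - 1) := h2
          _ ≤ C₀ * Real.exp (β * n) * (Real.exp β * H u) := by gcongr
          _ = C₀ * Real.exp (β * (n + 1 : ℕ)) * H u := by
            push_cast; rw [mul_add, Real.exp_add]; ring_nf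
      · have h4 : H (u₀ + 1) ≤ H u := hH.anti (by linarith)
        have h5 : 1 ≤ Real.exp (β * (n + 1 : ℕ)) := Real.one_le_exp (by positivity)
        calc H (u - ((n + 1 : ℕ) : ℝ)) ≤ 1 := hH.le_one _
          _ = C₀ * 1 * H (u₀ + 1) := by rw [hC₀]; field_simp [(hH.pos (u₀ + 1)).ne']
          _ ≤ C₀ * Real.exp (β * (n + 1 : ℕ)) * H u := by
            have := (hH.pos (u₀ + 1)).le
            gcongr
  refine ⟨C₀ * Real.exp β + 1, u₀, by positivity, fun u hu y => ?_⟩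
  have hu0 := (hH.pos u).le
  rcases le_total y 0 with hy | hy
  · calc H (u - y) ≤ H u := hH.anti (by linarith)
      _ = 1 * 1 * H u := by ring
      _ ≤ _ := by
        gcongr
        · have := mul_pos hC₀pos (Real.exp_pos β)
          linarith
        · have := Real.exp_pos (β * y)
          linarith
  · have hn : (⌈y⌉₊ : ℝ) ≤ y + 1 := (Nat.ceil_lt_add_one hy).le
    calc H (u - y) ≤ H (u - ⌈y⌉₊) := hH.anti (by linarith [Nat.le_ceil y])
      _ ≤ C₀ * Real.exp (β * ⌈y⌉₊) * H u := hind _ u hu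
      _ ≤ C₀ * Real.exp (β * (y + 1)) * H u := by gcongr
      _ = (C₀ * Real.exp β) * Real.exp (β * y) * H u := by rw [mul_add, Real.exp_add]; ring_nf
      _ ≤ (C₀ * Real.exp β + 1) * (1 + Real.exp (β * y)) * H u := by
        gcongr <;> linarith

lemma ExpVarying.tendsto_exp_mul_atTop {H : ℝ → ℝ} {γ β : ℝ} (hH : ExpVarying H γ) (hγ : 0 < γ)
    (hβ : γ < β) : Tendsto (fun u => Real.exp (β * u) * H u) atTop atTop := by
  obtain ⟨β', h1, h2⟩ := exists_between hβ
  obtain ⟨C, u₀, hC, h⟩ := hH.potter hγ h1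
  have key : Tendsto (fun u : ℝ => H u₀ / (2 * C) * Real.exp (β' * u₀) *
      Real.exp ((β - β') * u)) atTop atTop := by
    refine Tendsto.const_mul_atTop (by have := hH.pos u₀; positivity) ?_
    exact Real.tendsto_exp_atTop.comp (tendsto_id.const_mul_atTop (by linarith))
  refine tendsto_atTop_mono' _ ?_ key
  filter_upwards [eventually_ge_atTop u₀] with u hu
  have h3 := h u hu (u - u₀)
  have h4 : 1 ≤ Real.exp (β' * (u - u₀)) :=
    Real.one_le_exp (mul_nonneg (by linarith) (by linarith))
  have h5 : H u₀ ≤ C * (2 * Real.exp (β' * (u - u₀))) * H u := by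
    rw [sub_sub_cancel] at h3
    refine h3.trans ?_
    have := (hH.pos u).le
    gcongr; linarith
  have h6 : H u₀ / (2 * C) ≤ Real.exp (β' * (u - u₀)) * H u := by
    rw [div_le_iff₀ (by positivity)]; linarith
  calc H u₀ / (2 * C) * Real.exp (β' * u₀) * Real.exp ((β - β') * u)
      ≤ (Real.exp (β' * (u - u₀)) * H u) * Real.exp (β' * u₀) * Real.exp ((β - β') * u) := by
        gcongr
    _ = Real.exp (β' * (u - u₀) + β' * u₀ + (β - β') * u) * H u := by
        rw [Real.exp_add, Real.exp_add]; ring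
    _ = _ := by ring_nf

lemma ExpVarying.tendsto_add {H : ℝ → ℝ} {γ : ℝ} (hH : ExpVarying H γ) (s : ℝ) :
    Tendsto (fun u => H (u + s) / H u) atTop (𝓝 (Real.exp (-(γ * s)))) := by
  simpa using hH.lim (-s)

lemma ExpVarying.tendsto_div_shift {H T : ℝ → ℝ} {γ c : ℝ} (hH : ExpVarying H γ)
    (hT : Tendsto (fun u => T u / H u) atTop (𝓝 c)) (s : ℝ) :
    Tendsto (fun u => T (u + s) / H u) atTop (𝓝 (c * Real.exp (-(γ * s)))) := by
  have h1 := (hT.comp (tendsto_atTop_add_const_right atTop s tendsto_id)).mul (hH.tendsto_add s)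
  refine h1.congr fun u => ?_
  simp only [Function.comp, id]
  rw [div_mul_div_cancel₀ (hH.pos _).ne']

/-- The exponential moments of order below the index of the tail are finite. -/
lemma lintegral_exp_posPart_lt_top {ν : Measure ℝ} [IsProbabilityMeasure ν] {γ θ : ℝ}
    (hν : ExpVarying (fun u => ν.real (Set.Ioi u)) γ) (hθ0 : 0 ≤ θ) (hθ : θ < γ) :
    ∫⁻ x, ENNReal.ofReal (Real.exp (θ * max x 0)) ∂ν < ⊤ := by
  have hpt : ∀ x : ℝ, ENNReal.ofReal (Real.exp (θ * max x 0)) ≤ 1 +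
      ∑' n : ℕ, ENNReal.ofReal (Real.exp (θ * (n + 1))) *
        (Set.Ioi (n : ℝ)).indicator (fun _ => (1 : ENNReal)) x := by
    intro x
    rcases le_or_gt x 0 with hx | hx
    · rw [max_eq_right hx]; simp
    · rw [max_eq_left hx.le]
      set n := ⌈x⌉₊ - 1 with hn
      have hc : 0 < ⌈x⌉₊ := Nat.ceil_pos.2 hx
      have hn1 : ((n : ℝ)) + 1 = ⌈x⌉₊ := by
        rw [hn, Nat.cast_sub hc]; simp
      have h1 : (n : ℝ) < x := by have := Nat.ceil_lt_add_one hx.le; linarith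
      have h2 : x ≤ n + 1 := by rw [hn1]; exact Nat.le_ceil x
      refine le_trans ?_ (le_trans (ENNReal.le_tsum n) le_add_self)
      rw [Set.indicator_of_mem (by exact h1), mul_one]
      exact ENNReal.ofReal_le_ofReal (Real.exp_le_exp.2 (by gcongr))
  have hsum : Summable fun n : ℕ => Real.exp (θ * (n + 1)) * ν.real (Set.Ioi (n : ℝ)) := by
    have hlim : Tendsto (fun n : ℕ => Real.exp θ *
        (ν.real (Set.Ioi ((n : ℝ) + 1)) / ν.real (Set.Ioi (n : ℝ)))) atTop
        (𝓝 (Real.exp θ * Real.exp (-(γ * 1)))) :=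
      ((hν.tendsto_add 1).comp tendsto_natCast_atTop_atTop).const_mul _
    refine summable_of_ratio_test_tendsto_lt_one (l := Real.exp θ * Real.exp (-(γ * 1))) ?_ ?_ ?_
    · rw [← Real.exp_add]; exact Real.exp_lt_one_iff.2 (by linarith)
    · exact Eventually.of_forall fun n => (mul_pos (Real.exp_pos _) (hν.pos _)).ne'
    · refine hlim.congr fun n => ?_
      have h1 := hν.pos (n : ℝ)
      have h2 := hν.pos ((n : ℝ) + 1)
      rw [Real.norm_of_nonneg (by positivity), Real.norm_of_nonneg (by positivity)]
      push_cast
      rw [mul_div_mul_comm, ← Real.exp_sub]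
      ring_nf
  calc ∫⁻ x, ENNReal.ofReal (Real.exp (θ * max x 0)) ∂ν
      ≤ ∫⁻ x, (1 + ∑' n : ℕ, ENNReal.ofReal (Real.exp (θ * (n + 1))) *
        (Set.Ioi (n : ℝ)).indicator (fun _ => (1 : ENNReal)) x) ∂ν := lintegral_mono hpt
    _ = 1 + ∑' n : ℕ, ENNReal.ofReal (Real.exp (θ * (n + 1)) * ν.real (Set.Ioi (n : ℝ))) := by
      rw [lintegral_add_left measurable_const, lintegral_tsum]
      · simp only [lintegral_const, measure_univ, mul_one]
        congr 2 with n
        rw [lintegral_const_mul _ (measurable_const.indicator measurableSet_Ioi),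
          lintegral_indicator measurableSet_Ioi, ENNReal.ofReal_mul (Real.exp_pos _).le]
        simp [measureReal_def]
      · intro n
        exact ((measurable_const.indicator measurableSet_Ioi).const_mul _).aemeasurable
    _ < ⊤ := by
      rw [← ENNReal.ofReal_tsum_of_nonneg (fun n => by positivity) hsum]
      exact ENNReal.add_lt_top.2 ⟨ENNReal.one_lt_top, ENNReal.ofReal_lt_top⟩

lemma tendsto_of_approx {A : ℝ → ℝ} {l : ℝ}
    (h : ∀ ε > 0, ∃ (A' : ℝ → ℝ) (l' : ℝ), Tendsto A' atTop (𝓝 l') ∧ |l' - l| ≤ ε ∧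
      ∀ᶠ u in atTop, |A u - A' u| ≤ ε) : Tendsto A atTop (𝓝 l) := by
  rw [Metric.tendsto_nhds]
  intro ε hε
  obtain ⟨A', l', h1, h2, h3⟩ := h (ε / 4) (by positivity)
  filter_upwards [h3, Metric.tendsto_nhds.1 h1 (ε / 4) (by positivity)] with u hu hu'
  rw [Real.dist_eq] at *
  rw [abs_le] at *
  rw [abs_lt] at *
  constructor <;> linarith [hu.1, hu.2, h2.1, h2.2, hu'.1, hu'.2]

/-- The measure on the line with density `γ exp (-γ s)`: the logarithmic image of the radial part
`γ r ^ (-γ - 1) dr` of a homogeneous measure. -/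
noncomputable def expDensity (γ : ℝ) : Measure ℝ :=
  volume.withDensity fun s => ENNReal.ofReal (γ * Real.exp (-(γ * s)))

instance (γ : ℝ) : SFinite (expDensity γ) := by unfold expDensity; infer_instance

lemma expDensity_Ioi {γ : ℝ} (hγ : 0 < γ) (s : ℝ) :
    expDensity γ (Set.Ioi s) = ENNReal.ofReal (Real.exp (-(γ * s))) := by
  have hint : IntegrableOn (fun x : ℝ => γ * Real.exp (-(γ * x))) (Set.Ioi s) := by
    have := (integrableOn_exp_mul_Ioi (neg_lt_zero.2 hγ) s).const_mul γ
    simp only [neg_mul] at this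
    exact this
  rw [expDensity, withDensity_apply _ measurableSet_Ioi,
    ← ofReal_integral_eq_lintegral_ofReal hint (ae_of_all _ fun x => by positivity)]
  congr 1
  have h := integral_exp_mul_Ioi (neg_lt_zero.2 hγ) s
  simp only [neg_mul] at h
  rw [integral_const_mul, h]
  field_simp

/-- Vague convergence on the line away from `-∞`, from the convergence of the tails. -/
lemma tendsto_integral_of_tendsto_tail {m : ℝ → Measure ℝ} {lam : Measure ℝ} {h : ℝ → ℝ}
    (hm : ∀ u s, m u (Set.Ioi s) ≠ ⊤) (hm0 : ∀ u s, m u (Set.Ioi s) ≠ 0)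
    (hlam : ∀ s, lam (Set.Ioi s) ≠ ⊤) (hlam0 : ∀ s, lam (Set.Ioi s) ≠ 0)
    (hlim : ∀ s, Tendsto (fun u => (m u).real (Set.Ioi s) / h u) atTop
      (𝓝 (lam.real (Set.Ioi s))))
    {k : ℝ → ℝ} (hk : Continuous k) {C s₀ : ℝ} (hC : ∀ s, |k s| ≤ C) (hs₀ : ∀ s ≤ s₀, k s = 0) :
    Tendsto (fun u => (∫ s, k s ∂(m u)) / h u) atTop (𝓝 (∫ s, k s ∂lam)) := by
  have hcond : ∀ (μ : Measure ℝ), μ (Set.Ioi s₀) ≠ ⊤ → μ (Set.Ioi s₀) ≠ 0 →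
      ∫ s, k s ∂μ = μ.real (Set.Ioi s₀) * ∫ s, k s ∂(ProbabilityTheory.cond μ (Set.Ioi s₀)) := by
    intro μ h1 h2
    have h3 : ∫ s, k s ∂μ = ∫ s in Set.Ioi s₀, k s ∂μ := by
      rw [setIntegral_eq_integral_of_forall_compl_eq_zero]
      intro s hs
      exact hs₀ s (not_lt.1 hs)
    rw [h3, ProbabilityTheory.cond, integral_smul_measure, ENNReal.toReal_inv, smul_eq_mul,
      ← mul_assoc,
      measureReal_def, mul_inv_cancel₀ (ENNReal.toReal_ne_zero.2 ⟨h2, h1⟩), one_mul]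
  have hprob : ∀ u, IsProbabilityMeasure (ProbabilityTheory.cond (m u) (Set.Ioi s₀)) := fun u =>
    cond_isProbabilityMeasure_of_finite (hm0 u s₀) (hm u s₀)
  have hprob' : IsProbabilityMeasure (ProbabilityTheory.cond lam (Set.Ioi s₀)) :=
    cond_isProbabilityMeasure_of_finite (hlam0 s₀) (hlam s₀)
  have hcondIoc : ∀ (μ : Measure ℝ), (∀ s, μ (Set.Ioi s) ≠ ⊤) → ∀ a b, a < b →
      (ProbabilityTheory.cond μ (Set.Ioi s₀)).real (Set.Ioc a b) =
        (μ.real (Set.Ioi s₀))⁻¹ * (μ.real (Set.Ioi (max s₀ a)) - μ.real (Set.Ioi (max s₀ b))) := by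
    intro μ h1 a b hab
    rw [measureReal_def, cond_apply measurableSet_Ioi, ENNReal.toReal_mul, ENNReal.toReal_inv,
      ← measureReal_def, ← measureReal_def]
    congr 1
    have : Set.Ioi s₀ ∩ Set.Ioc a b = Set.Ioi (max s₀ a) \ Set.Ioi (max s₀ b) := by
      ext x
      simp only [Set.mem_inter_iff, Set.mem_Ioi, Set.mem_Ioc, Set.mem_sdiff, max_lt_iff, not_and,
        not_lt]
      constructor
      · rintro ⟨h2, h3, h4⟩; exact ⟨⟨h2, h3⟩, fun _ => h4⟩
      · rintro ⟨⟨h2, h3⟩, h4⟩; exact ⟨h2, h3, h4 h2⟩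
    rw [this, measureReal_sdiff' measurableSet_Ioi (h1 _) (h1 _)]
    · congr 1
      rw [Set.union_eq_left.2]
      exact Set.Ioi_subset_Ioi (max_le_max le_rfl hab.le)
  let M : ℝ → ProbabilityMeasure ℝ := fun u => ⟨ProbabilityTheory.cond (m u) (Set.Ioi s₀), hprob u⟩
  let M' : ProbabilityMeasure ℝ := ⟨ProbabilityTheory.cond lam (Set.Ioi s₀), hprob'⟩
  have hconv : Tendsto M atTop (𝓝 M') := by
    refine IsPiSystem.tendsto_probabilityMeasure_of_tendsto_of_mem
      (S := {S | ∃ l u : ℝ, l < u ∧ Set.Ioc l u = S}) ?_ ?_ ?_ ?_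
    · simpa using isPiSystem_Ioc (id : ℝ → ℝ) (id : ℝ → ℝ)
    · rintro s ⟨l, u, _, rfl⟩; exact measurableSet_Ioc
    · intro U hU x hx
      obtain ⟨ε, hε, hball⟩ := Metric.isOpen_iff.1 hU x hx
      refine ⟨Set.Ioc (x - ε / 2) (x + ε / 2), ⟨_, _, by linarith, rfl⟩,
        Ioc_mem_nhds (by linarith) (by linarith), fun y hy => hball ?_⟩
      rw [Metric.mem_ball, Real.dist_eq, abs_lt]
      constructor <;> linarith [hy.1, hy.2]
    · rintro s ⟨a, b, hab, rfl⟩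
      rw [← NNReal.tendsto_coe]
      change Tendsto (fun u => (ProbabilityTheory.cond (m u) (Set.Ioi s₀)).real (Set.Ioc a b)) atTop
        (𝓝 ((ProbabilityTheory.cond lam (Set.Ioi s₀)).real (Set.Ioc a b)))
      rw [hcondIoc lam hlam a b hab]
      have hne : lam.real (Set.Ioi s₀) ≠ 0 := ENNReal.toReal_ne_zero.2 ⟨hlam0 _, hlam _⟩
      refine (((hlim s₀).inv₀ hne).mul ((hlim _).sub (hlim _))).congr' ?_
      filter_upwards [(hlim s₀).eventually_ne hne] with u hu
      have hu' : h u ≠ 0 := fun h0 => hu (by simp [h0])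
      rw [hcondIoc (m u) (hm u) a b hab]
      field_simp
  have hkb : ∀ x y, dist (k x) (k y) ≤ 2 * C := fun x y => by
    rw [Real.dist_eq]
    have h1 := abs_le.1 (hC x)
    have h2 := abs_le.1 (hC y)
    exact abs_le.2 ⟨by linarith, by linarith⟩
  have h1 := (ProbabilityMeasure.tendsto_iff_forall_integral_tendsto.1 hconv)
    ⟨⟨k, hk⟩, ⟨2 * C, hkb⟩⟩
  rw [hcond lam (hlam _) (hlam0 _)]
  refine ((hlim s₀).mul h1).congr fun u => ?_
  rw [hcond (m u) (hm u _) (hm0 u _)]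
  simp only [M, ProbabilityMeasure.coe_mk, BoundedContinuousFunction.coe_mk]
  ring

/-! ### Breiman's lemma and test functions -/

/-- Dominated convergence for the conditional expectations of a function of an independent pair,
normalised by `H`. -/
lemma tendsto_integral_prod_of_dominated {E : Type*} [MeasurableSpace E] {ρ : Measure E}
    {β : Measure ℝ} [IsProbabilityMeasure ρ] [IsProbabilityMeasure β] {H : ℝ → ℝ}
    (hH : ∀ u, 0 < H u) {k : E × ℝ → ℝ} (hk : Measurable k) {C : ℝ} (hC : ∀ p, |k p| ≤ C)
    {K D : E → ℝ}
    (hlim : ∀ e, Tendsto (fun u => (∫ b, k (e, b - u) ∂β) / H u) atTop (𝓝 (K e)))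
    (hD : Integrable D ρ) (hdom : ∀ᶠ u in atTop, ∀ e, |∫ b, k (e, b - u) ∂β| ≤ D e * H u) :
    Tendsto (fun u => (∫ p : E × ℝ, k (p.1, p.2 - u) ∂(ρ.prod β)) / H u) atTop
      (𝓝 (∫ e, K e ∂ρ)) := by
  have hmeas : ∀ u : ℝ, Measurable fun p : E × ℝ => k (p.1, p.2 - u) := fun u =>
    hk.comp (measurable_fst.prodMk (measurable_snd.sub_const u))
  have hint : ∀ u, Integrable (fun p : E × ℝ => k (p.1, p.2 - u)) (ρ.prod β) := fun u =>
    Integrable.of_bound (hmeas u).aestronglyMeasurable C (ae_of_all _ fun p => hC _)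
  have heq : ∀ u, (∫ p : E × ℝ, k (p.1, p.2 - u) ∂(ρ.prod β)) / H u =
      ∫ e, (∫ b, k (e, b - u) ∂β) / H u ∂ρ := by
    intro u
    rw [integral_prod _ (hint u), integral_div]
  simp_rw [heq]
  refine tendsto_integral_filter_of_dominated_convergence D ?_ ?_ hD (ae_of_all _ hlim)
  · refine Eventually.of_forall fun u => ?_
    exact ((hmeas u).stronglyMeasurable.integral_prod_right.measurable.div_const
      _).aestronglyMeasurable
  · filter_upwards [hdom] with u hu
    refine ae_of_all _ fun e => ?_
    rw [norm_div, Real.norm_of_nonneg (hH u).le, div_le_iff₀ (hH u)]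
    exact hu e

lemma exp_sub_mul_gt_iff {ε r b u : ℝ} (hε : 0 < ε) (hr : 0 < r) :
    ε < Real.exp (b - u) * r ↔ u - Real.log (r / ε) < b := by
  rw [← div_lt_iff₀ hr, ← Real.log_lt_iff_lt_exp (by positivity), Real.log_div hr.ne' hε.ne',
    Real.log_div hε.ne' hr.ne']
  constructor <;> intro h <;> linarith

/-- A multivariate version of Breiman's lemma: if `exp B` is regularly varying and independent of
a vector `R` with a moment of higher order than the index, then `g (exp B * R / exp u)` can be
integrated conditionally on `R`. -/
lemma tendsto_integral_exp_mul {Ω : Type*} [MeasurableSpace Ω] {P : Measure Ω}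
    [IsProbabilityMeasure P] {ι : Type*} [Fintype ι] {B : Ω → ℝ} {R : Ω → ι → ℝ}
    (hB : Measurable B) (hR : Measurable R) (hind : IndepFun R B P) {H : ℝ → ℝ} {γ b : ℝ}
    (hH : ExpVarying H γ) (hHB : ∀ u, P.real {ω | u < B ω} = H u) (hγ : 0 < γ) (hb : γ < b)
    (hmom : ∀ a, Integrable (fun ω => |R ω a| ^ b) P) {g : (ι → ℝ) → ℝ} (hg : Measurable g)
    {C ε : ℝ} (hC : ∀ v, |g v| ≤ C) (hε : 0 < ε) (hg0 : ∀ v, (∀ a, |v a| ≤ ε) → g v = 0)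
    {K : (ι → ℝ) → ℝ}
    (hlim : ∀ r : ι → ℝ, Tendsto (fun u => (∫ y, g (fun a => Real.exp (y - u) * r a) ∂(P.map B)) /
      H u) atTop (𝓝 (K r))) :
    Tendsto (fun u => (∫ ω, g (fun a => Real.exp (B ω - u) * R ω a) ∂P) / H u) atTop
      (𝓝 (∫ ω, K (R ω) ∂P)) := by
  have hC0 : 0 ≤ C := (abs_nonneg _).trans (hC 0)
  have : IsProbabilityMeasure (P.map B) := Measure.isProbabilityMeasure_map hB.aemeasurable
  have : IsProbabilityMeasure (P.map R) := Measure.isProbabilityMeasure_map hR.aemeasurable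
  have hβ : ∀ u, (P.map B).real (Set.Ioi u) = H u := fun u => by
    rw [map_measureReal_apply hB measurableSet_Ioi, ← hHB u]; rfl
  obtain ⟨C', u₀, hC', hpot⟩ := hH.potter hγ hb
  set k : (ι → ℝ) × ℝ → ℝ := fun p => g (fun a => Real.exp p.2 * p.1 a) with hk
  have hkm : Measurable k := hg.comp (by fun_prop)
  have hKm : Measurable K := by
    refine measurable_of_tendsto_metrizable' (u := atTop)
      (f := fun u r => (∫ y, g (fun a => Real.exp (y - u) * r a) ∂(P.map B)) / H u) ?_
      (tendsto_pi_nhds.2 hlim)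
    intro u
    have h1 : Measurable fun p : (ι → ℝ) × ℝ => k (p.1, p.2 - u) :=
      hkm.comp (measurable_fst.prodMk (measurable_snd.sub_const u))
    exact (h1.stronglyMeasurable.integral_prod_right (ν := P.map B)).measurable.div_const _
  have key := tendsto_integral_prod_of_dominated (ρ := P.map R) (β := P.map B) (H := H) hH.pos
    (k := k) hkm (C := C) (fun p => hC _) (K := K)
    (D := fun r => C * ∑ a, C' * (1 + (|r a| / ε) ^ b)) hlim ?_ ?_
  · rw [integral_map hR.aemeasurable hKm.aestronglyMeasurable] at key
    refine key.congr fun u => ?_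
    congr 1
    rw [← (indepFun_iff_map_prod_eq_prod_map_map hR.aemeasurable hB.aemeasurable).1 hind,
      integral_map (hR.prodMk hB).aemeasurable]
    exact (hkm.comp (measurable_fst.prodMk (measurable_snd.sub_const u))).aestronglyMeasurable
  · have h2 : ∀ a, Integrable (fun r : ι → ℝ => |r a| ^ b) (P.map R) := fun a => by
      rw [integrable_map_measure _ hR.aemeasurable]
      · exact hmom a
      · exact Measurable.aestronglyMeasurable (by fun_prop)
    refine Integrable.const_mul (integrable_finsetSum _ fun a _ => Integrable.const_mul ?_ _) _
    refine (integrable_const _).add ?_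
    simp_rw [Real.div_rpow (abs_nonneg _) hε.le]
    exact (h2 a).div_const _
  · filter_upwards [eventually_ge_atTop u₀] with u hu r
    have hset : ∀ a, (P.map B).real {y | ε < Real.exp (y - u) * |r a|} ≤
        C' * (1 + (|r a| / ε) ^ b) * H u := by
      intro a
      rcases (abs_nonneg (r a)).eq_or_lt' with h0 | h0
      · have : {y | ε < Real.exp (y - u) * |r a|} = ∅ := by
          ext y; simp [h0, hε.le]
        rw [this, measureReal_empty]
        have := (hH.pos u).le
        positivity
      · have h3 : {y | ε < Real.exp (y - u) * |r a|} = Set.Ioi (u - Real.log (|r a| / ε)) := by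
          ext y; exact exp_sub_mul_gt_iff hε h0
        rw [h3, hβ]
        refine (hpot u hu _).trans_eq ?_
        rw [Real.rpow_def_of_pos (by positivity), mul_comm b]
    have hmeasS : ∀ a, MeasurableSet {y : ℝ | ε < Real.exp (y - u) * |r a|} := fun a =>
      measurableSet_lt measurable_const (by fun_prop)
    calc |∫ y, k (r, y - u) ∂(P.map B)| ≤ ∫ y, |k (r, y - u)| ∂(P.map B) :=
          abs_integral_le_integral_abs
      _ ≤ ∫ y, C * ∑ a, {y | ε < Real.exp (y - u) * |r a|}.indicator (fun _ => (1 : ℝ)) y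
            ∂(P.map B) := by
          refine integral_mono_of_nonneg (ae_of_all _ fun y => abs_nonneg _) ?_
            (ae_of_all _ fun y => ?_)
          · exact (integrable_finsetSum _ fun a _ =>
              (integrable_const _).indicator (hmeasS a)).const_mul _
          · by_cases hy : ∀ a, |Real.exp (y - u) * r a| ≤ ε
            · simp only [hk, hg0 _ hy, abs_zero]
              refine mul_nonneg hC0 (Finset.sum_nonneg fun a _ => ?_)
              exact Set.indicator_nonneg (fun _ _ => zero_le_one) _
            · push Not at hy
              obtain ⟨a, ha⟩ := hy
              rw [abs_mul, abs_of_pos (Real.exp_pos _)] at ha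
              have h4 : (1 : ℝ) ≤ ∑ a, {y | ε < Real.exp (y - u) * |r a|}.indicator
                  (fun _ => (1 : ℝ)) y := by
                refine le_trans ?_ (Finset.single_le_sum (f := fun a =>
                  {y | ε < Real.exp (y - u) * |r a|}.indicator (fun _ => (1 : ℝ)) y)
                  (fun a _ => Set.indicator_nonneg (fun _ _ => zero_le_one) _)
                  (Finset.mem_univ a))
                rw [Set.indicator_of_mem (by exact ha)]
              exact (hC _).trans (le_mul_of_one_le_right hC0 h4)
      _ = C * ∑ a, (P.map B).real {y | ε < Real.exp (y - u) * |r a|} := by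
          rw [integral_const_mul, integral_finsetSum]
          · congr 2 with a
            rw [integral_indicator (hmeasS a)]; simp
          · exact fun a _ => (integrable_const _).indicator (hmeasS a)
      _ ≤ C * ∑ a, C' * (1 + (|r a| / ε) ^ b) * H u := by
          gcongr with a; exact hset a
      _ = _ := by rw [← Finset.sum_mul, mul_assoc]

/-- Test functions on `ℝ^ι` for vague convergence: bounded continuous functions that vanish near
the origin and, uniformly at infinity, are insensitive to replacing small coordinates by zero.
The last condition holds for the restrictions of continuous functions on `[-∞, ∞]^ι`. -/
structure TestFn {ι : Type*} (g : (ι → ℝ) → ℝ) : Prop where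
  cont : Continuous g
  bdd : ∃ C, ∀ v, |g v| ≤ C
  vanish : ∃ ε > 0, ∀ v, (∀ a, |v a| ≤ ε) → g v = 0
  trunc : ∀ (G : Set ι) (κ : ℝ), 0 < κ → ∃ δ > 0, ∀ v : ι → ℝ, (∀ a ∉ G, |v a| ≤ δ) →
    |g v - g (G.indicator v)| ≤ κ

/-- The integral of `g` along the ray through `r`, with respect to the radial measure. -/
noncomputable def rayIntegral {ι : Type*} (γ : ℝ) (g : (ι → ℝ) → ℝ) (r : ι → ℝ) : ℝ :=
  ∫ s, g (fun a => Real.exp s * r a) ∂(expDensity γ)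

lemma tendsto_ray {ι : Type*} [Fintype ι] {β : Measure ℝ} [IsProbabilityMeasure β] {γ : ℝ}
    (hγ : 0 < γ) (hβ : ExpVarying (fun u => β.real (Set.Ioi u)) γ) {g : (ι → ℝ) → ℝ}
    (hg : TestFn g) (r : ι → ℝ) :
    Tendsto (fun u => (∫ y, g (fun a => Real.exp (y - u) * r a) ∂β) / β.real (Set.Ioi u)) atTop
      (𝓝 (rayIntegral γ g r)) := by
  obtain ⟨C, hC⟩ := hg.bdd
  obtain ⟨ε, hε, hg0⟩ := hg.vanish
  have hcont := hg.cont
  have hmapI : ∀ u s : ℝ, (β.map (· - u)) (Set.Ioi s) = β (Set.Ioi (u + s)) := fun u s => by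
    rw [Measure.map_apply (measurable_sub_const u) measurableSet_Ioi]
    congr 1; ext y; simp only [Set.mem_preimage, Set.mem_Ioi]
    constructor <;> intro h <;> linarith
  have hreal : ∀ s, (expDensity γ).real (Set.Ioi s) = Real.exp (-(γ * s)) := fun s => by
    rw [measureReal_def, expDensity_Ioi hγ, ENNReal.toReal_ofReal (Real.exp_pos _).le]
  have h := tendsto_integral_of_tendsto_tail (m := fun u => β.map (· - u)) (lam := expDensity γ)
    (h := fun u => β.real (Set.Ioi u)) (k := fun s => g (fun a => Real.exp s * r a)) (C := C)
    (s₀ := Real.log (ε / (1 + ∑ a, |r a|)))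
    (fun u s => by rw [hmapI]; exact measure_ne_top _ _)
    (fun u s => by
      rw [hmapI]; intro h0
      have := hβ.pos (u + s)
      simp [measureReal_def, h0] at this)
    (fun s => by rw [expDensity_Ioi hγ]; exact ENNReal.ofReal_ne_top)
    (fun s => by
      rw [expDensity_Ioi hγ]; exact (ENNReal.ofReal_pos.2 (Real.exp_pos _)).ne')
    (fun s => by
      rw [hreal]
      refine (hβ.tendsto_add s).congr fun u => ?_
      simp only [measureReal_def, hmapI])
    (by fun_prop) (fun s => hC _) (fun s hs => hg0 _ fun a => ?_)
  · refine h.congr fun u => ?_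
    rw [integral_map (measurable_sub_const u).aemeasurable
      (Continuous.aestronglyMeasurable (by fun_prop))]
  · have hpos : 0 < 1 + ∑ a, |r a| :=
      add_pos_of_pos_of_nonneg one_pos (Finset.sum_nonneg fun a _ => abs_nonneg _)
    rw [abs_mul, abs_of_pos (Real.exp_pos _)]
    have h1 : Real.exp s ≤ ε / (1 + ∑ a, |r a|) := by
      rw [← Real.log_le_log_iff (Real.exp_pos _) (by positivity), Real.log_exp]; exact hs
    have h2 : |r a| ≤ 1 + ∑ a, |r a| := by
      have := Finset.single_le_sum (f := fun a => |r a|) (fun a _ => abs_nonneg _)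
        (Finset.mem_univ a)
      linarith
    calc Real.exp s * |r a| ≤ ε / (1 + ∑ a, |r a|) * (1 + ∑ a, |r a|) := by gcongr
      _ = ε := by field_simp

lemma tendsto_coord_indicator {ι : Type*} {β : Measure ℝ} [IsProbabilityMeasure β] {γ : ℝ}
    (hγ : 0 < γ) (hβ : ExpVarying (fun u => β.real (Set.Ioi u)) γ) (a : ι) (r : ι → ℝ) :
    Tendsto (fun u => (∫ y, {v : ι → ℝ | 1 < v a}.indicator (fun _ => (1 : ℝ))
      (fun a => Real.exp (y - u) * r a) ∂β) / β.real (Set.Ioi u)) atTop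
      (𝓝 ((max (r a) 0) ^ γ)) := by
  have hI : ∀ u, ∫ y, {v : ι → ℝ | 1 < v a}.indicator (fun _ => (1 : ℝ))
      (fun a => Real.exp (y - u) * r a) ∂β = β.real {y | 1 < Real.exp (y - u) * r a} := by
    intro u
    rw [← integral_indicator_one (measurableSet_lt measurable_const (by fun_prop))]
    rfl
  simp_rw [hI]
  rcases le_or_gt (r a) 0 with h0 | h0
  · have : ∀ u, {y : ℝ | 1 < Real.exp (y - u) * r a} = ∅ := fun u => by
      ext y
      simp only [Set.mem_ofPred_eq, Set.mem_empty_iff_false, iff_false, not_lt]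
      exact (mul_nonpos_of_nonneg_of_nonpos (Real.exp_pos _).le h0).trans zero_le_one
    simp [this, max_eq_right h0, Real.zero_rpow hγ.ne']
  · have : ∀ u, {y : ℝ | 1 < Real.exp (y - u) * r a} = Set.Ioi (u - Real.log (r a)) := fun u => by
      ext y
      simpa using exp_sub_mul_gt_iff (b := y) (u := u) one_pos h0
    simp_rw [this, max_eq_left h0.le, Real.rpow_def_of_pos h0, mul_comm _ γ]
    exact hβ.lim _

/-! ### Sums of two convolution equivalent variables -/

lemma setOf_lt_eq_empty_or_Ioi {f : ℝ → ℝ} (hf : Continuous f) (hmono : Monotone f) {t x₀ : ℝ}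
    (ht : f x₀ ≤ t) : {x | t < f x} = ∅ ∨ ∃ y, x₀ ≤ y ∧ {x | t < f x} = Set.Ioi y := by
  rcases Set.eq_empty_or_nonempty {x | t < f x} with h | h
  · exact Or.inl h
  · right
    have hlb : ∀ x ∈ {x | t < f x}, x₀ ≤ x := fun x hx => by
      by_contra hlt
      exact absurd (ht.trans_lt hx) (not_lt.2 (hmono (not_le.1 hlt).le))
    have hbdd : BddBelow {x | t < f x} := ⟨x₀, hlb⟩
    refine ⟨sInf {x | t < f x}, le_csInf h hlb, ?_⟩
    ext x
    constructor
    · intro hx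
      have hopen : IsOpen {x | t < f x} := isOpen_lt continuous_const hf
      obtain ⟨ε, hε, hball⟩ := Metric.isOpen_iff.1 hopen x hx
      have h1 : x - ε / 2 ∈ {x | t < f x} := hball (by
        rw [Metric.mem_ball, Real.dist_eq, abs_lt]; constructor <;> linarith)
      exact (csInf_le hbdd h1).trans_lt (by linarith)
    · intro hx
      obtain ⟨z, hz, hzx⟩ := exists_lt_of_csInf_lt h hx
      exact lt_of_lt_of_le hz (hmono hzx.le)

/-- A comparison of the tails of two laws beyond `x₀` yields a comparison of the integrals of
increasing functions, up to the contribution of the region below `x₀`. -/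
lemma mul_integral_le_of_tail_le {μ ν : Measure ℝ} [IsProbabilityMeasure μ]
    [IsProbabilityMeasure ν] {f : ℝ → ℝ} (hf : Continuous f) (hmono : Monotone f)
    (hf0 : ∀ x, 0 ≤ f x) (hμ : Integrable f μ) (hν : Integrable f ν) {c x₀ : ℝ} (hc : 0 ≤ c)
    (htail : ∀ x, x₀ ≤ x → c * ν.real (Set.Ioi x) ≤ μ.real (Set.Ioi x)) :
    c * (∫ x, f x ∂ν) ≤ (∫ x, f x ∂μ) + c * f x₀ := by
  set g : ℝ → ℝ := fun x => max (f x - f x₀) 0 with hg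
  have hgm : ∀ (m : Measure ℝ), Integrable f m → IsProbabilityMeasure m → Integrable g m :=
    fun m hm _ => (hm.sub (integrable_const _)).pos_part
  have hg0 : ∀ x, 0 ≤ g x := fun x => le_max_right _ _
  have hgc : Continuous g := by fun_prop
  have hlay : ∀ (m : Measure ℝ), ∫⁻ x, ENNReal.ofReal (g x) ∂m =
      ∫⁻ t in Set.Ioi 0, m {x | t < g x} := fun m =>
    lintegral_eq_lintegral_meas_lt m (ae_of_all _ hg0) hgc.aemeasurable
  have hle : ENNReal.ofReal c * ∫⁻ x, ENNReal.ofReal (g x) ∂ν ≤ ∫⁻ x, ENNReal.ofReal (g x) ∂μ := by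
    rw [hlay, hlay, ← lintegral_const_mul' _ _ ENNReal.ofReal_ne_top]
    refine setLIntegral_mono' measurableSet_Ioi fun t ht => ?_
    have hset : {x | t < g x} = {x | f x₀ + t < f x} := by
      ext x
      simp only [hg, Set.mem_ofPred_eq, lt_max_iff, not_lt.2 (le_of_lt (Set.mem_Ioi.1 ht)),
        or_false]
      constructor <;> intro h <;> linarith
    rw [hset]
    rcases setOf_lt_eq_empty_or_Ioi hf hmono (t := f x₀ + t) (x₀ := x₀)
      (by linarith [Set.mem_Ioi.1 ht]) with h | ⟨y, hy, h⟩
    · rw [h]; simp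
    · rw [h]
      have := ENNReal.ofReal_le_ofReal (htail y hy)
      rwa [ENNReal.ofReal_mul hc, measureReal_def, measureReal_def,
        ENNReal.ofReal_toReal (measure_ne_top _ _), ENNReal.ofReal_toReal (measure_ne_top _ _)]
        at this
  have hle' : c * ∫ x, g x ∂ν ≤ ∫ x, g x ∂μ := by
    rw [← ofReal_integral_eq_lintegral_ofReal (hgm ν hν inferInstance) (ae_of_all _ hg0),
      ← ofReal_integral_eq_lintegral_ofReal (hgm μ hμ inferInstance) (ae_of_all _ hg0),
      ← ENNReal.ofReal_mul hc] at hle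
    exact (ENNReal.ofReal_le_ofReal_iff (integral_nonneg hg0)).1 hle
  have h1 : (∫ x, f x ∂ν) - f x₀ ≤ ∫ x, g x ∂ν := by
    have : ∫ x, (f x - f x₀) ∂ν ≤ ∫ x, g x ∂ν :=
      integral_mono (hν.sub (integrable_const _)) (hgm ν hν inferInstance) fun x => le_max_left _ _
    rwa [integral_sub hν (integrable_const _), integral_const, probReal_univ, one_smul] at this
  have h2 : ∫ x, g x ∂μ ≤ ∫ x, f x ∂μ :=
    integral_mono (hgm μ hμ inferInstance) hμ fun x =>
      max_le (by linarith [hf0 x₀]) (hf0 x)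
  nlinarith [mul_le_mul_of_nonneg_left h1 hc]

/-- If the tail of the twofold convolution of `ν` is asymptotically `c` times the tail of `ν`, then
`c` is at most twice the exponential moment at the index. The function
`f x = exp (γ x) (exp (s min (x⁺, T)) - 1)` satisfies
`f (x + y) ≤ f x (exp (γ y) + f y) + exp (γ x) f y`. For every `s > 0` the level `T` can be chosen
so that `∫ f dν` equals a prescribed `ε`, and as `s → 0` the values of `f` on bounded sets become
negligible. Integrating `f` against the convolution and against `ν` then gives
`c ε ≤ 2 m ε + ε² + o(1)` as `s → 0`, where `m` is the exponential moment, and hence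
`c ≤ 2 m + ε`. -/
lemma convolution_constant_le {ν : Measure ℝ} [IsProbabilityMeasure ν] {γ : ℝ} (hγ : 0 < γ)
    (hν : ExpVarying (fun u => ν.real (Set.Ioi u)) γ)
    (hint : Integrable (fun x => Real.exp (γ * x)) ν) {c : ℝ}
    (hc : Tendsto (fun x : ℝ => (ν.prod ν).real {p | x < p.1 + p.2} / ν.real (Set.Ioi x)) atTop
      (𝓝 c)) : c ≤ 2 * ∫ x, Real.exp (γ * x) ∂ν := by
  set m := ∫ x, Real.exp (γ * x) ∂ν with hm
  have hm0 : 0 ≤ m := integral_nonneg fun x => (Real.exp_pos _).le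
  by_contra! hlt
  obtain ⟨c', hc'1, hc'2⟩ := exists_between hlt
  have hc'0 : 0 < c' := by linarith
  obtain ⟨x₁, hx₁⟩ := eventually_atTop.1 (hc.eventually_const_lt hc'2)
  set x₀ := max x₁ 0 with hx₀
  have hx₀0 : 0 ≤ x₀ := le_max_right _ _
  set ε := (c' - 2 * m) / 2 with hε
  have hεpos : 0 < ε := by rw [hε]; linarith
  -- a small exponent `s`, for which `f x₀` is negligible against `ε`
  obtain ⟨s, hs0, hs⟩ : ∃ s > 0, c' * (Real.exp (γ * x₀) * (Real.exp (s * x₀) - 1)) < ε ^ 2 := by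
    have hcont : Tendsto (fun s : ℝ => c' * (Real.exp (γ * x₀) * (Real.exp (s * x₀) - 1)))
        (𝓝[>] 0) (𝓝 0) := by
      have : Continuous fun s : ℝ => c' * (Real.exp (γ * x₀) * (Real.exp (s * x₀) - 1)) := by
        fun_prop
      simpa using (this.tendsto 0).mono_left nhdsWithin_le_nhds
    have h1 := hcont.eventually_lt_const (u := ε ^ 2) (by positivity)
    obtain ⟨s, hs1, hs2⟩ := (h1.and self_mem_nhdsWithin).exists
    exact ⟨s, hs2, hs1⟩
  set h : ℝ → ℝ → ℝ := fun T x => s * min (max x 0) T with hh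
  set f : ℝ → ℝ → ℝ := fun T x => Real.exp (γ * x) * (Real.exp (h T x) - 1) with hf
  have hh0 : ∀ T, 0 ≤ T → ∀ x, 0 ≤ h T x := fun T hT x =>
    mul_nonneg hs0.le (le_min (le_max_right _ _) hT)
  have hhT : ∀ T x, h T x ≤ s * T := fun T x => by
    simp only [hh]; gcongr; exact min_le_right _ _
  have hhm : ∀ T, Monotone (h T) := fun T x y hxy => by
    simp only [hh]; gcongr
  have hhadd : ∀ T, 0 ≤ T → ∀ x y, h T (x + y) ≤ h T x + h T y := by
    intro T hT x y
    simp only [hh, ← mul_add]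
    refine mul_le_mul_of_nonneg_left ?_ hs0.le
    have h1 : max (x + y) 0 ≤ max x 0 + max y 0 :=
      max_le (add_le_add (le_max_left _ _) (le_max_left _ _))
        (add_nonneg (le_max_right _ _) (le_max_right _ _))
    have hx := le_max_right x 0
    have hy := le_max_right y 0
    rcases le_total (max x 0) T with hxT | hxT <;> rcases le_total (max y 0) T with hyT | hyT
    · rw [min_eq_left hxT, min_eq_left hyT]; exact (min_le_left _ _).trans h1
    · rw [min_eq_right hyT]
      exact (min_le_right _ _).trans (le_add_of_nonneg_left (le_min hx hT))
    all_goals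
      rw [min_eq_right hxT]
      exact (min_le_right _ _).trans (le_add_of_nonneg_right (le_min hy hT))
  have hf0 : ∀ T, 0 ≤ T → ∀ x, 0 ≤ f T x := fun T hT x =>
    mul_nonneg (Real.exp_pos _).le (sub_nonneg.2 (Real.one_le_exp (hh0 T hT x)))
  have hfc : ∀ T, Continuous (f T) := fun T => by simp only [hf, hh]; fun_prop
  have hfmono : ∀ T, 0 ≤ T → Monotone (f T) := by
    intro T hT x y hxy
    simp only [hf]
    have h1 := sub_nonneg.2 (Real.one_le_exp (hh0 T hT x))
    have h2 := hhm T hxy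
    gcongr
  have hfint : ∀ T, 0 ≤ T → Integrable (f T) ν := by
    intro T hT
    refine (hint.mul_const (Real.exp (s * T) - 1)).mono' (hfc T).aestronglyMeasurable
      (ae_of_all _ fun x => ?_)
    rw [Real.norm_of_nonneg (hf0 T hT x)]
    simp only [hf]
    have := hhT T x
    gcongr
  -- the level `T`
  obtain ⟨T, hT0, hT⟩ : ∃ T, 0 ≤ T ∧ ∫ x, f T x ∂ν = ε := by
    have hgrow : Tendsto (fun u => 1 / 2 * (Real.exp ((γ + s) * u) * ν.real (Set.Ioi u))) atTop
        atTop := (hν.tendsto_exp_mul_atTop hγ (by linarith)).const_mul_atTop (by norm_num)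
    obtain ⟨T₁, hT₁, hT₁0, hT₁s⟩ := ((hgrow.eventually_ge_atTop ε).and
      ((eventually_ge_atTop 0).and (eventually_ge_atTop (Real.log 2 / s)))).exists
    have hval : ε ≤ ∫ x, f T₁ x ∂ν := by
      refine hT₁.trans ?_
      have h1 := mul_meas_ge_le_integral_of_nonneg (μ := ν) (ae_of_all _ (hf0 T₁ hT₁0))
        (hfint T₁ hT₁0) (f T₁ T₁)
      refine le_trans ?_ h1
      have h2 : ν.real (Set.Ioi T₁) ≤ ν.real {x | f T₁ T₁ ≤ f T₁ x} :=
        measureReal_mono fun x hx => hfmono T₁ hT₁0 (le_of_lt hx)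
      have h3 : 2 ≤ Real.exp (s * T₁) := by
        rw [div_le_iff₀ hs0] at hT₁s
        calc (2 : ℝ) = Real.exp (Real.log 2) := (Real.exp_log (by norm_num)).symm
          _ ≤ _ := Real.exp_le_exp.2 (by linarith)
      have h4 : f T₁ T₁ = Real.exp (γ * T₁) * (Real.exp (s * T₁) - 1) := by
        simp only [hf, hh, max_eq_left hT₁0, min_self]
      have h5 : 1 / 2 * Real.exp ((γ + s) * T₁) ≤ f T₁ T₁ := by
        rw [h4, add_mul, Real.exp_add]
        nlinarith [Real.exp_pos (γ * T₁)]
      calc 1 / 2 * (Real.exp ((γ + s) * T₁) * ν.real (Set.Ioi T₁))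
          = (1 / 2 * Real.exp ((γ + s) * T₁)) * ν.real (Set.Ioi T₁) := by ring
        _ ≤ f T₁ T₁ * ν.real {x | f T₁ T₁ ≤ f T₁ x} := by
          gcongr
          exact hf0 _ hT₁0 _
    have hcontT : ContinuousOn (fun T => ∫ x, f T x ∂ν) (Set.Icc 0 T₁) := by
      refine continuousOn_of_dominated (bound := fun x => Real.exp (γ * x) *
        (Real.exp (s * T₁) - 1)) ?_ ?_ (hint.mul_const _) ?_
      · exact fun T _ => (hfc T).aestronglyMeasurable
      · intro T hT
        refine ae_of_all _ fun x => ?_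
        rw [Real.norm_of_nonneg (hf0 T hT.1 x)]
        simp only [hf]
        have h1 : h T x ≤ s * T₁ := (hhT T x).trans (by have := hT.2; gcongr)
        gcongr
      · refine ae_of_all _ fun x => Continuous.continuousOn ?_
        simp only [hf, hh]; fun_prop
    have hzero : ∫ x, f 0 x ∂ν = 0 := by
      have : ∀ x, f 0 x = 0 := fun x => by simp [hf, hh]
      simp [this]
    obtain ⟨T, hT, hTε⟩ := intermediate_value_Icc hT₁0 hcontT
      (show ε ∈ Set.Icc (∫ x, f 0 x ∂ν) (∫ x, f T₁ x ∂ν) from ⟨hzero.trans_le hεpos.le, hval⟩)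
    exact ⟨T, hT.1, hTε⟩
  have hfi := hfint T hT0
  set μ : Measure ℝ := (ν.prod ν).map fun p => p.1 + p.2 with hμ
  have haddm : Measurable fun p : ℝ × ℝ => p.1 + p.2 := by fun_prop
  have : IsProbabilityMeasure μ := Measure.isProbabilityMeasure_map haddm.aemeasurable
  have hbound : ∀ p : ℝ × ℝ, f T (p.1 + p.2) ≤
      f T p.1 * (Real.exp (γ * p.2) + f T p.2) + Real.exp (γ * p.1) * f T p.2 := by
    rintro ⟨x, y⟩
    have h1 : Real.exp (h T (x + y)) ≤ Real.exp (h T x) * Real.exp (h T y) := by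
      rw [← Real.exp_add]; exact Real.exp_le_exp.2 (hhadd T hT0 x y)
    simp only [hf]
    calc Real.exp (γ * (x + y)) * (Real.exp (h T (x + y)) - 1)
        ≤ Real.exp (γ * (x + y)) * (Real.exp (h T x) * Real.exp (h T y) - 1) := by gcongr
      _ = _ := by rw [mul_add, Real.exp_add]; ring
  have hprodint : Integrable (fun p : ℝ × ℝ => f T p.1 * (Real.exp (γ * p.2) + f T p.2) +
      Real.exp (γ * p.1) * f T p.2) (ν.prod ν) :=
    (hfi.mul_prod (hint.add hfi)).add (hint.mul_prod hfi)
  have hsumint : Integrable (fun p : ℝ × ℝ => f T (p.1 + p.2)) (ν.prod ν) :=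
    hprodint.mono' ((hfc T).measurable.comp haddm).aestronglyMeasurable
      (ae_of_all _ fun p => by rw [Real.norm_of_nonneg (hf0 T hT0 _)]; exact hbound p)
  have hμint : Integrable (f T) μ :=
    (integrable_map_measure (hfc T).aestronglyMeasurable haddm.aemeasurable).2 hsumint
  have hμval : ∫ x, f T x ∂μ ≤ ε * (m + ε) + m * ε := by
    rw [hμ, integral_map haddm.aemeasurable (hfc T).aestronglyMeasurable]
    refine (integral_mono hsumint hprodint hbound).trans_eq ?_
    have hi₁ : Integrable (fun p : ℝ × ℝ => f T p.1 * (Real.exp (γ * p.2) + f T p.2))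
        (ν.prod ν) := hfi.mul_prod (hint.add hfi)
    rw [integral_add hi₁ (hint.mul_prod hfi),
      integral_prod_mul (f T) (fun y => Real.exp (γ * y) + f T y),
      integral_prod_mul (fun x => Real.exp (γ * x)) (f T), integral_add hint hfi, hT]
  have hmain := mul_integral_le_of_tail_le (μ := μ) (ν := ν) (hfc T) (hfmono T hT0) (hf0 T hT0)
    hμint hfi hc'0.le (x₀ := x₀) (fun x hx => by
      have h1 := (hx₁ x ((le_max_left _ _).trans hx)).le
      rw [le_div_iff₀ (hν.pos x)] at h1
      rwa [hμ, map_measureReal_apply haddm measurableSet_Ioi])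
  have hfx₀ : f T x₀ ≤ Real.exp (γ * x₀) * (Real.exp (s * x₀) - 1) := by
    simp only [hf, hh, max_eq_left hx₀0]
    gcongr
    exact min_le_left _ _
  rw [hT] at hmain
  have h6 : c' * f T x₀ < ε ^ 2 := (mul_le_mul_of_nonneg_left hfx₀ hc'0.le).trans_lt hs
  have h7 : c' = 2 * m + 2 * ε := by rw [hε]; ring
  nlinarith

/-- The probability that the sum of independent variables with laws `μ₁`, `μ₂` exceeds `u` while
both exceed `K`. -/
noncomputable def bothLarge (μ₁ μ₂ : Measure ℝ) (K u : ℝ) : ℝ :=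
  (μ₁.prod μ₂).real {p | u < p.1 + p.2 ∧ K < p.1 ∧ K < p.2}

lemma measurableSet_bothLarge (K u : ℝ) :
    MeasurableSet {p : ℝ × ℝ | u < p.1 + p.2 ∧ K < p.1 ∧ K < p.2} :=
  by measurability

lemma bothLarge_comm (μ₁ μ₂ : Measure ℝ) [IsProbabilityMeasure μ₁] [IsProbabilityMeasure μ₂]
    (K u : ℝ) : bothLarge μ₁ μ₂ K u = bothLarge μ₂ μ₁ K u := by
  rw [bothLarge, bothLarge, ← Measure.prod_swap,
    map_measureReal_apply measurable_swap (measurableSet_bothLarge K u)]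
  congr 1
  ext p
  simp only [Set.mem_preimage, Set.mem_ofPred_eq, Prod.fst_swap, Prod.snd_swap, add_comm p.2]
  tauto

lemma bothLarge_le {μ₁ ν μ₂ : Measure ℝ} [IsProbabilityMeasure μ₁] [IsProbabilityMeasure ν]
    [IsProbabilityMeasure μ₂] {K C : ℝ} (hC : 0 ≤ C)
    (h : ∀ v, K ≤ v → μ₁.real (Set.Ioi v) ≤ C * ν.real (Set.Ioi v)) (u : ℝ) :
    bothLarge μ₁ μ₂ K u ≤ C * bothLarge ν μ₂ K u := by
  have key : (μ₁.prod μ₂) {p | u < p.1 + p.2 ∧ K < p.1 ∧ K < p.2} ≤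
      ENNReal.ofReal C * (ν.prod μ₂) {p | u < p.1 + p.2 ∧ K < p.1 ∧ K < p.2} := by
    rw [Measure.prod_apply_symm (measurableSet_bothLarge K u),
      Measure.prod_apply_symm (measurableSet_bothLarge K u),
      ← lintegral_const_mul' _ _ ENNReal.ofReal_ne_top]
    refine lintegral_mono fun y => ?_
    by_cases hy : K < y
    · have hs : (fun x => (x, y)) ⁻¹' {p : ℝ × ℝ | u < p.1 + p.2 ∧ K < p.1 ∧ K < p.2} =
          Set.Ioi (max (u - y) K) := by
        ext x
        simp only [Set.mem_preimage, Set.mem_ofPred_eq, Set.mem_Ioi, max_lt_iff, hy, and_true,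
          sub_lt_iff_lt_add]
      rw [hs]
      have := ENNReal.ofReal_le_ofReal (h (max (u - y) K) (le_max_right _ _))
      rwa [ENNReal.ofReal_mul hC, measureReal_def, measureReal_def,
        ENNReal.ofReal_toReal (measure_ne_top _ _), ENNReal.ofReal_toReal (measure_ne_top _ _)]
        at this
    · have hs : (fun x => (x, y)) ⁻¹' {p : ℝ × ℝ | u < p.1 + p.2 ∧ K < p.1 ∧ K < p.2} = ∅ := by
        ext x; simp [hy]
      simp only [hs, measure_empty, zero_le]
  have h2 := ENNReal.toReal_mono (ENNReal.mul_ne_top ENNReal.ofReal_ne_top (measure_ne_top _ _)) key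
  rwa [ENNReal.toReal_mul, ENNReal.toReal_ofReal hC] at h2

/-- The contribution to the tail of a sum of the event that the first summand is bounded. -/
lemma tendsto_tail_add_of_le {μ₁ μ₂ : Measure ℝ} [IsProbabilityMeasure μ₁]
    [IsProbabilityMeasure μ₂] {H : ℝ → ℝ} {γ c : ℝ} (hH : ExpVarying H γ)
    (h₂ : Tendsto (fun u => μ₂.real (Set.Ioi u) / H u) atTop (𝓝 c)) (K : ℝ) :
    Tendsto (fun u => (μ₁.prod μ₂).real {p | u < p.1 + p.2 ∧ p.1 ≤ K} / H u) atTop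
      (𝓝 (c * ∫ x in Set.Iic K, Real.exp (γ * x) ∂μ₁)) := by
  set k : ℝ × ℝ → ℝ := {p : ℝ × ℝ | 0 < p.1 + p.2 ∧ p.1 ≤ K}.indicator fun _ => 1 with hk
  have hS : MeasurableSet {p : ℝ × ℝ | 0 < p.1 + p.2 ∧ p.1 ≤ K} :=
    by measurability
  have hin : ∀ e u, ∫ b, k (e, b - u) ∂μ₂ =
      (Set.Iic K).indicator (fun e => μ₂.real (Set.Ioi (u - e))) e := by
    intro e u
    by_cases he : e ≤ K
    · rw [Set.indicator_of_mem (by exact he), ← integral_indicator_one measurableSet_Ioi]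
      congr 1 with b
      have : ((e, b - u) ∈ {p : ℝ × ℝ | 0 < p.1 + p.2 ∧ p.1 ≤ K}) ↔ b ∈ Set.Ioi (u - e) := by
        simp only [Set.mem_ofPred_eq, Set.mem_Ioi, he, and_true]
        constructor <;> intro h <;> linarith
      simp only [hk, Set.indicator_apply, this, Pi.one_apply]
    · rw [Set.indicator_of_notMem (by exact he)]
      have : ∀ b, k (e, b - u) = 0 := fun b => by
        simp [hk, he]
      simp [this]
  have hgen : ∀ y, Tendsto (fun u => μ₂.real (Set.Ioi (u - y)) / H u) atTop
      (𝓝 (c * Real.exp (γ * y))) := fun y => by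
    simpa [sub_eq_add_neg] using hH.tendsto_div_shift h₂ (-y)
  obtain ⟨D, hD⟩ := ((hgen K).isBoundedUnder_le).eventually_le
  have hlim := tendsto_integral_prod_of_dominated (ρ := μ₁) (β := μ₂) hH.pos (k := k)
    (measurable_const.indicator hS) (C := 1) (fun p => by
      simp only [hk, Set.indicator_apply]; split_ifs <;> simp)
    (K := (Set.Iic K).indicator fun e => c * Real.exp (γ * e)) (D := fun _ => D)
    (fun e => by
      simp_rw [hin]
      by_cases he : e ≤ K
      · simp only [Set.indicator_of_mem (show e ∈ Set.Iic K from he)]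
        exact hgen e
      · simp [Set.indicator_of_notMem (show e ∉ Set.Iic K from he)])
    (integrable_const _) (by
      filter_upwards [hD] with u hu e
      rw [hin]
      rw [div_le_iff₀ (hH.pos u)] at hu
      by_cases he : e ≤ K
      · rw [Set.indicator_of_mem (by exact he), abs_of_nonneg measureReal_nonneg]
        exact (measureReal_mono (Set.Ioi_subset_Ioi (by linarith))).trans hu
      · rw [Set.indicator_of_notMem (by exact he), abs_zero]
        exact measureReal_nonneg.trans hu)
  rw [integral_indicator measurableSet_Iic, integral_const_mul] at hlim
  refine hlim.congr fun u => ?_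
  congr 1
  have hSu : MeasurableSet {p : ℝ × ℝ | u < p.1 + p.2 ∧ p.1 ≤ K} :=
    by measurability
  rw [← integral_indicator_one hSu]
  congr 1 with p
  have : ((p.1, p.2 - u) ∈ {p : ℝ × ℝ | 0 < p.1 + p.2 ∧ p.1 ≤ K}) ↔
      p ∈ {p : ℝ × ℝ | u < p.1 + p.2 ∧ p.1 ≤ K} := by
    simp only [Set.mem_ofPred_eq]
    constructor <;> rintro ⟨h1, h2⟩ <;> exact ⟨by linarith, h2⟩
  simp only [hk, Set.indicator_apply, this, Pi.one_apply]

lemma tail_add_eq {μ₁ μ₂ : Measure ℝ} [IsProbabilityMeasure μ₁] [IsProbabilityMeasure μ₂]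
    {K u : ℝ} (hu : 2 * K ≤ u) :
    (μ₁.prod μ₂).real {p | u < p.1 + p.2} =
      (μ₁.prod μ₂).real {p | u < p.1 + p.2 ∧ p.1 ≤ K} +
      (μ₂.prod μ₁).real {p | u < p.1 + p.2 ∧ p.1 ≤ K} + bothLarge μ₁ μ₂ K u := by
  have hS : MeasurableSet {p : ℝ × ℝ | u < p.1 + p.2 ∧ p.1 ≤ K} :=
    by measurability
  have hS' : MeasurableSet {p : ℝ × ℝ | u < p.1 + p.2 ∧ p.2 ≤ K} :=
    by measurability
  have h1 : (μ₂.prod μ₁).real {p | u < p.1 + p.2 ∧ p.1 ≤ K} =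
      (μ₁.prod μ₂).real {p | u < p.1 + p.2 ∧ p.2 ≤ K} := by
    rw [← Measure.prod_swap, map_measureReal_apply measurable_swap hS]
    congr 1
    ext p
    simp only [Set.mem_preimage, Set.mem_ofPred_eq, Prod.fst_swap, Prod.snd_swap, add_comm p.2]
  rw [h1, bothLarge, ← measureReal_union _ hS', ← measureReal_union _ (measurableSet_bothLarge K u)]
  · congr 1
    ext p
    simp only [Set.mem_ofPred_eq, Set.mem_union]
    constructor
    · intro h
      by_cases h1 : p.1 ≤ K
      · exact Or.inl (Or.inl ⟨h, h1⟩)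
      · by_cases h2 : p.2 ≤ K
        · exact Or.inl (Or.inr ⟨h, h2⟩)
        · exact Or.inr ⟨h, not_le.1 h1, not_le.1 h2⟩
    · rintro ((h | h) | h) <;> exact h.1
  · rw [Set.disjoint_left]
    rintro p (h | h) h'
    · exact absurd h.2 (not_le.2 h'.2.1)
    · exact absurd h.2 (not_le.2 h'.2.2)
  · rw [Set.disjoint_left]
    rintro p ⟨h1, h2⟩ ⟨_, h3⟩
    linarith

lemma tendsto_setIntegral_Iic {μ : Measure ℝ} {f : ℝ → ℝ} (hf : Integrable f μ) :
    Tendsto (fun K => ∫ x in Set.Iic K, f x ∂μ) atTop (𝓝 (∫ x, f x ∂μ)) :=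
  (aecover_Iic tendsto_id).integral_tendsto_of_countably_generated hf

/-- Convolution equivalence: two independent copies are jointly large with a probability which is
negligible with respect to the tail. -/
lemma bothLarge_self_le {ν : Measure ℝ} [IsProbabilityMeasure ν] {γ : ℝ} (hγ : 0 < γ)
    (hν : ExpVarying (fun u => ν.real (Set.Ioi u)) γ)
    (hint : Integrable (fun x => Real.exp (γ * x)) ν) {c : ℝ}
    (hc : Tendsto (fun x : ℝ => (ν.prod ν).real {p | x < p.1 + p.2} / ν.real (Set.Ioi x)) atTop
      (𝓝 c)) {ε : ℝ} (hε : 0 < ε) :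
    ∀ᶠ K in atTop, ∀ᶠ u in atTop, bothLarge ν ν K u ≤ ε * ν.real (Set.Ioi u) := by
  have hcm := convolution_constant_le hγ hν hint hc
  have hK := ((tendsto_setIntegral_Iic hint).const_mul 2).eventually_const_lt
    (u := 2 * (∫ x, Real.exp (γ * x) ∂ν) - ε) (by linarith)
  filter_upwards [hK] with K hK
  have hone : Tendsto (fun u => ν.real (Set.Ioi u) / ν.real (Set.Ioi u)) atTop (𝓝 1) :=
    tendsto_const_nhds.congr fun u => (div_self (hν.pos u).ne').symm
  have h1 := tendsto_tail_add_of_le (μ₁ := ν) (μ₂ := ν) hν hone K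
  have h2 := (hc.sub (h1.const_mul 2)).eventually_lt_const (u := ε) (by linarith)
  filter_upwards [h2, eventually_ge_atTop (2 * K)] with u hu huK
  rw [tail_add_eq huK, ← mul_div_assoc, ← sub_div, div_lt_iff₀ (hν.pos u)] at hu
  linarith

/-- The tail of a sum of two independent variables whose tails are multiples of a convolution
equivalent tail. -/
lemma tendsto_tail_add {ν μ₁ μ₂ : Measure ℝ} [IsProbabilityMeasure ν] [IsProbabilityMeasure μ₁]
    [IsProbabilityMeasure μ₂] {γ c₁ c₂ : ℝ}
    (hν : ExpVarying (fun u => ν.real (Set.Ioi u)) γ)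
    (hboth : ∀ ε > 0, ∀ᶠ K in atTop, ∀ᶠ u in atTop, bothLarge ν ν K u ≤ ε * ν.real (Set.Ioi u))
    (hi₁ : Integrable (fun x => Real.exp (γ * x)) μ₁)
    (hi₂ : Integrable (fun x => Real.exp (γ * x)) μ₂)
    (h₁ : Tendsto (fun u => μ₁.real (Set.Ioi u) / ν.real (Set.Ioi u)) atTop (𝓝 c₁))
    (h₂ : Tendsto (fun u => μ₂.real (Set.Ioi u) / ν.real (Set.Ioi u)) atTop (𝓝 c₂)) :
    Tendsto (fun u => (μ₁.prod μ₂).real {p | u < p.1 + p.2} / ν.real (Set.Ioi u)) atTop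
      (𝓝 (c₂ * (∫ x, Real.exp (γ * x) ∂μ₁) + c₁ * ∫ x, Real.exp (γ * x) ∂μ₂)) := by
  have hdom : ∀ {μ : Measure ℝ} {c : ℝ}, IsProbabilityMeasure μ →
      Tendsto (fun u => μ.real (Set.Ioi u) / ν.real (Set.Ioi u)) atTop (𝓝 c) →
      ∀ᶠ K in atTop, ∀ v, K ≤ v → μ.real (Set.Ioi v) ≤ (|c| + 1) * ν.real (Set.Ioi v) := by
    intro μ c _ h
    obtain ⟨v₀, hv₀⟩ := eventually_atTop.1 (h.eventually_lt_const
      (lt_of_le_of_lt (le_abs_self c) (lt_add_one |c|)))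
    filter_upwards [eventually_ge_atTop v₀] with K hK v hv
    exact ((div_lt_iff₀ (hν.pos v)).1 (hv₀ v (hK.trans hv))).le
  refine tendsto_of_approx fun ε hε => ?_
  have hC : 0 < (|c₁| + 1) * (|c₂| + 1) := by positivity
  have hlim := ((tendsto_setIntegral_Iic hi₁).const_mul c₂).add
    ((tendsto_setIntegral_Iic hi₂).const_mul c₁)
  obtain ⟨K, hK1, hK2, hK3, hK4⟩ := ((hboth (ε / ((|c₁| + 1) * (|c₂| + 1))) (by positivity)).and
    ((hdom inferInstance h₁).and ((hdom inferInstance h₂).and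
      (Metric.tendsto_nhds.1 hlim ε hε)))).exists
  refine ⟨_, _, (tendsto_tail_add_of_le (μ₁ := μ₁) hν h₂ K).add
    (tendsto_tail_add_of_le (μ₁ := μ₂) hν h₁ K), hK4.le, ?_⟩
  filter_upwards [hK1, eventually_ge_atTop (2 * K)] with u hu huK
  have h3 : bothLarge μ₁ μ₂ K u ≤ (|c₁| + 1) * ((|c₂| + 1) * bothLarge ν ν K u) := by
    refine (bothLarge_le (by positivity) hK2 u).trans ?_
    refine mul_le_mul_of_nonneg_left ?_ (by positivity)
    rw [bothLarge_comm]
    exact bothLarge_le (by positivity) hK3 u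
  rw [tail_add_eq huK, ← add_div, ← sub_div, add_sub_cancel_left, abs_div,
    abs_of_pos (hν.pos u), div_le_iff₀ (hν.pos u),
    abs_of_nonneg (show 0 ≤ bothLarge μ₁ μ₂ K u from measureReal_nonneg)]
  calc bothLarge μ₁ μ₂ K u ≤ (|c₁| + 1) * ((|c₂| + 1) * bothLarge ν ν K u) := h3
    _ ≤ (|c₁| + 1) * ((|c₂| + 1) * (ε / ((|c₁| + 1) * (|c₂| + 1)) * ν.real (Set.Ioi u))) := by
      gcongr
    _ = ε * ν.real (Set.Ioi u) := by field_simp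

/-! ### Convolution powers under infinite exponential moments -/

lemma prod_real_tail_inter {ν μ : Measure ℝ} [IsProbabilityMeasure ν] [IsProbabilityMeasure μ]
    (w t : ℝ) : (ν.prod μ).real {p | w < p.1 + p.2 ∧ p.2 ≤ t} =
      ∫ x in Set.Iic t, ν.real (Set.Ioi (w - x)) ∂μ := by
  have hS : MeasurableSet {p : ℝ × ℝ | w < p.1 + p.2 ∧ p.2 ≤ t} := by measurability
  rw [← integral_indicator_one hS, integral_prod_symm _ ((integrable_const _).indicator hS),
    ← integral_indicator measurableSet_Iic]
  congr 1 with y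
  by_cases hy : y ≤ t
  · rw [Set.indicator_of_mem (by exact hy), ← integral_indicator_one measurableSet_Ioi]
    congr 1 with x
    have : ((x, y) ∈ {p : ℝ × ℝ | w < p.1 + p.2 ∧ p.2 ≤ t}) ↔ x ∈ Set.Ioi (w - y) := by
      simp only [Set.mem_ofPred_eq, Set.mem_Ioi, hy, and_true, sub_lt_iff_lt_add]
    simp only [Set.indicator_apply, this, Pi.one_apply]
  · rw [Set.indicator_of_notMem (by exact hy)]
    simp [hy]

/-- The law of the sum of independent variables with laws `ν` and `μ`. -/
noncomputable def sumLaw (ν μ : Measure ℝ) : Measure ℝ := (ν.prod μ).map fun p => p.1 + p.2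

instance (ν μ : Measure ℝ) [IsProbabilityMeasure ν] [IsProbabilityMeasure μ] :
    IsProbabilityMeasure (sumLaw ν μ) :=
  Measure.isProbabilityMeasure_map (by fun_prop)

lemma sumLaw_real_Ioi (ν μ : Measure ℝ) (u : ℝ) :
    (sumLaw ν μ).real (Set.Ioi u) = (ν.prod μ).real {p | u < p.1 + p.2} := by
  rw [sumLaw, map_measureReal_apply (by fun_prop) measurableSet_Ioi]; rfl

/-- If the exponential moment of `ν` at the index `γ` is infinite, then the tail of `μ` is
negligible with respect to the tail of the convolution of `ν` and `μ`. -/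
lemma tendsto_tail_div_sumLaw {ν μ : Measure ℝ} [IsProbabilityMeasure ν] [IsProbabilityMeasure μ]
    {γ : ℝ} (hμ : ExpVarying (fun u => μ.real (Set.Ioi u)) γ)
    (hinf : ∫⁻ y, ENNReal.ofReal (Real.exp (γ * y)) ∂ν = ⊤) (hγ : 0 < γ) :
    Tendsto (fun u => (sumLaw ν μ).real (Set.Ioi u) / μ.real (Set.Ioi u)) atTop atTop := by
  have hgrow : Tendsto (fun n : ℕ => ∫⁻ x in Set.Iic (n : ℝ), ENNReal.ofReal (Real.exp (γ * x)) ∂ν)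
      atTop (𝓝 ⊤) := by
    rw [← hinf]
    exact (aecover_Iic tendsto_natCast_atTop_atTop).lintegral_tendsto_of_countably_generated
      (by fun_prop)
  have hone : Tendsto (fun u => μ.real (Set.Ioi u) / μ.real (Set.Ioi u)) atTop (𝓝 1) :=
    tendsto_const_nhds.congr fun u => (div_self (hμ.pos u).ne').symm
  refine tendsto_atTop.2 fun M => ?_
  obtain ⟨n, hn⟩ := (hgrow.eventually_const_lt (u := ENNReal.ofReal (|M| + 1))
    ENNReal.ofReal_lt_top).exists
  have hint : IntegrableOn (fun x => Real.exp (γ * x)) (Set.Iic (n : ℝ)) ν := by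
    refine Measure.integrableOn_of_bounded (M := Real.exp (γ * n)) (measure_ne_top _ _)
      (by fun_prop) ?_
    filter_upwards [ae_restrict_mem measurableSet_Iic] with x hx
    rw [Real.norm_of_nonneg (Real.exp_pos _).le]
    exact Real.exp_le_exp.2 (by gcongr; exact hx)
  rw [← ofReal_integral_eq_lintegral_ofReal hint (ae_of_all _ fun x => (Real.exp_pos _).le)] at hn
  have hn' : M < ∫ x in Set.Iic (n : ℝ), Real.exp (γ * x) ∂ν := by
    have := (ENNReal.ofReal_lt_ofReal_iff_of_nonneg (by positivity)).1 hn
    linarith [le_abs_self M]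
  have h1 := tendsto_tail_add_of_le (μ₁ := ν) hμ hone n
  rw [one_mul] at h1
  filter_upwards [h1.eventually_const_lt hn'] with u hu
  refine hu.le.trans ?_
  rw [sumLaw_real_Ioi]
  exact div_le_div_of_nonneg_right (measureReal_mono fun p hp => hp.1) (hμ.pos u).le

/-- The class of laws with exponentially varying tails is stable under convolution with a law of
infinite exponential moment. -/
lemma ExpVarying.sumLaw {ν μ : Measure ℝ} [IsProbabilityMeasure ν] [IsProbabilityMeasure μ]
    {γ : ℝ} (hγ : 0 < γ) (hν : ExpVarying (fun u => ν.real (Set.Ioi u)) γ)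
    (hμ : ExpVarying (fun u => μ.real (Set.Ioi u)) γ)
    (hinf : ∫⁻ y, ENNReal.ofReal (Real.exp (γ * y)) ∂ν = ⊤) :
    ExpVarying (fun u => (sumLaw ν μ).real (Set.Ioi u)) γ := by
  have hpos : ∀ u, 0 < (SVField.sumLaw ν μ).real (Set.Ioi u) := by
    intro u
    rw [sumLaw_real_Ioi]
    have h1 : Set.Ioi (0 : ℝ) ×ˢ Set.Ioi u ⊆ {p : ℝ × ℝ | u < p.1 + p.2} := by
      rintro p ⟨h1, h2⟩
      have h1 := Set.mem_Ioi.1 h1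
      have h2 := Set.mem_Ioi.1 h2
      show u < p.1 + p.2
      linarith
    refine lt_of_lt_of_le ?_ (measureReal_mono h1)
    rw [measureReal_prod_prod]
    exact mul_pos (hν.pos 0) (hμ.pos u)
  refine ⟨hpos, fun u v huv => measureReal_mono (Set.Ioi_subset_Ioi huv),
    fun u => measureReal_le_one, fun y => ?_⟩
  have hratio : Tendsto (fun u => μ.real (Set.Ioi u) / (SVField.sumLaw ν μ).real (Set.Ioi u)) atTop
      (𝓝 0) := by
    refine (tendsto_inv_atTop_zero.comp (tendsto_tail_div_sumLaw hμ hinf hγ)).congr fun u => ?_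
    simp
  rw [Metric.tendsto_nhds]
  intro ε hε
  obtain ⟨K, hK⟩ := eventually_atTop.1 (Metric.tendsto_nhds.1 (hν.lim y) (ε / 2) (by positivity))
  have hsmall : Tendsto (fun u => (1 + Real.exp (γ * y)) *
      (μ.real (Set.Ioi (u - K)) / μ.real (Set.Ioi u) *
        (μ.real (Set.Ioi u) / (SVField.sumLaw ν μ).real (Set.Ioi u)))) atTop (𝓝 0) := by
    simpa using ((hμ.lim K).mul hratio).const_mul (1 + Real.exp (γ * y))
  filter_upwards [hsmall.eventually_lt_const (u := ε / 2) (by positivity)] with u hu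
  rw [div_mul_div_cancel₀ (hμ.pos u).ne', ← mul_div_assoc, div_lt_iff₀ (hpos u)] at hu
  have hsplit : ∀ w, (SVField.sumLaw ν μ).real (Set.Ioi w) =
      (∫ x in Set.Iic (u - K), ν.real (Set.Ioi (w - x)) ∂μ) +
        (ν.prod μ).real {p | w < p.1 + p.2 ∧ u - K < p.2} := by
    intro w
    have h1 : MeasurableSet {p : ℝ × ℝ | w < p.1 + p.2 ∧ u - K < p.2} := by measurability
    rw [sumLaw_real_Ioi, ← prod_real_tail_inter, ← measureReal_union _ h1]
    · congr 1
      ext p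
      simp only [Set.mem_ofPred_eq, Set.mem_union, ← and_or_left, le_or_gt, and_true]
    · rw [Set.disjoint_left]
      rintro p ⟨_, h2⟩ ⟨_, h3⟩
      linarith
  have hrest : ∀ w, (ν.prod μ).real {p | w < p.1 + p.2 ∧ u - K < p.2} ≤
      μ.real (Set.Ioi (u - K)) := by
    intro w
    have h1 : {p : ℝ × ℝ | w < p.1 + p.2 ∧ u - K < p.2} ⊆ Set.univ ×ˢ Set.Ioi (u - K) :=
      fun p hp => ⟨trivial, hp.2⟩
    refine (measureReal_mono h1).trans_eq ?_
    rw [measureReal_prod_prod]; simp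
  have hrest0 : ∀ w, 0 ≤ (ν.prod μ).real {p | w < p.1 + p.2 ∧ u - K < p.2} :=
    fun w => measureReal_nonneg
  have hGm : ∀ w, Measurable fun x => ν.real (Set.Ioi (w - x)) := fun w =>
    (Monotone.measurable fun x x' h =>
      measureReal_mono (Set.Ioi_subset_Ioi (by linarith)))
  have hGi : ∀ w, Integrable (fun x => ν.real (Set.Ioi (w - x))) (μ.restrict (Set.Iic (u - K))) :=
    fun w => Integrable.of_bound (hGm w).aestronglyMeasurable 1 (ae_of_all _ fun x => by
      rw [Real.norm_of_nonneg measureReal_nonneg]; exact measureReal_le_one)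
  have hmain : |(∫ x in Set.Iic (u - K), ν.real (Set.Ioi (u - y - x)) ∂μ) -
      Real.exp (γ * y) * ∫ x in Set.Iic (u - K), ν.real (Set.Ioi (u - x)) ∂μ| ≤
      ε / 2 * (SVField.sumLaw ν μ).real (Set.Ioi u) := by
    rw [← integral_const_mul, ← integral_sub (hGi _) ((hGi _).const_mul _)]
    calc _ ≤ ∫ x in Set.Iic (u - K), |ν.real (Set.Ioi (u - y - x)) -
            Real.exp (γ * y) * ν.real (Set.Ioi (u - x))| ∂μ := abs_integral_le_integral_abs
      _ ≤ ∫ x in Set.Iic (u - K), ε / 2 * ν.real (Set.Ioi (u - x)) ∂μ := by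
        refine setIntegral_mono_on ((hGi _).sub ((hGi _).const_mul _)).abs
          ((hGi _).const_mul _) measurableSet_Iic fun x hx => ?_
        have h1 := hK (u - x) (by linarith [Set.mem_Iic.1 hx])
        have h2 := hν.pos (u - x)
        rw [Real.dist_eq, show u - x - y = u - y - x by ring] at h1
        have h3 : ν.real (Set.Ioi (u - y - x)) - Real.exp (γ * y) * ν.real (Set.Ioi (u - x)) =
            (ν.real (Set.Ioi (u - y - x)) / ν.real (Set.Ioi (u - x)) - Real.exp (γ * y)) *
              ν.real (Set.Ioi (u - x)) := by
          rw [sub_mul, div_mul_cancel₀ _ h2.ne']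
        rw [h3, abs_mul, abs_of_pos h2]
        gcongr
      _ = ε / 2 * ∫ x in Set.Iic (u - K), ν.real (Set.Ioi (u - x)) ∂μ := integral_const_mul _ _
      _ ≤ _ := by
        gcongr
        rw [hsplit u]
        linarith [hrest0 u]
  rw [Real.dist_eq, div_sub' (hpos u).ne', abs_div, abs_of_pos (hpos u), div_lt_iff₀ (hpos u)]
  rw [hsplit (u - y)]
  have h4 := hsplit u
  have h5 := hrest u
  have h6 := hrest (u - y)
  have h7 := hrest0 u
  have h8 := hrest0 (u - y)
  have he := Real.exp_pos (γ * y)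
  set A := ∫ x in Set.Iic (u - K), ν.real (Set.Ioi (u - y - x)) ∂μ
  set A' := ∫ x in Set.Iic (u - K), ν.real (Set.Ioi (u - x)) ∂μ
  set T := (SVField.sumLaw ν μ).real (Set.Ioi u)
  set r := (ν.prod μ).real {p | u < p.1 + p.2 ∧ u - K < p.2}
  set r' := (ν.prod μ).real {p | u - y < p.1 + p.2 ∧ u - K < p.2}
  set t := μ.real (Set.Ioi (u - K))
  have h9 : A + r' - T * Real.exp (γ * y) = (A - Real.exp (γ * y) * A') +
      (r' - Real.exp (γ * y) * r) := by rw [h4]; ring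
  have h10 : |r' - Real.exp (γ * y) * r| ≤ (1 + Real.exp (γ * y)) * t := by
    rw [abs_le]; constructor <;> nlinarith
  rw [h9]
  refine (abs_add_le _ _).trans_lt ?_
  linarith

/-- The `n`-fold convolution power of `ν`. -/
noncomputable def convPow (ν : Measure ℝ) : ℕ → Measure ℝ
  | 0 => Measure.dirac 0
  | n + 1 => sumLaw ν (convPow ν n)

instance (ν : Measure ℝ) [IsProbabilityMeasure ν] (n : ℕ) : IsProbabilityMeasure (convPow ν n) := by
  induction n with
  | zero => unfold convPow; infer_instance
  | succ n ih => unfold convPow; infer_instance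

lemma sumLaw_dirac_zero (ν : Measure ℝ) [IsProbabilityMeasure ν] :
    sumLaw ν (Measure.dirac 0) = ν := by
  rw [sumLaw, Measure.prod_dirac, Measure.map_map (by fun_prop) (by fun_prop)]
  have : ((fun p : ℝ × ℝ => p.1 + p.2) ∘ fun x => (x, (0 : ℝ))) = id := by ext x; simp
  rw [this, Measure.map_id]

lemma expVarying_convPow {ν : Measure ℝ} [IsProbabilityMeasure ν] {γ : ℝ} (hγ : 0 < γ)
    (hν : ExpVarying (fun u => ν.real (Set.Ioi u)) γ)
    (hinf : ∫⁻ y, ENNReal.ofReal (Real.exp (γ * y)) ∂ν = ⊤) {n : ℕ} (hn : 1 ≤ n) :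
    ExpVarying (fun u => (convPow ν n).real (Set.Ioi u)) γ := by
  induction n, hn using Nat.le_induction with
  | base => rw [convPow, convPow, sumLaw_dirac_zero]; exact hν
  | succ n hn ih => exact ExpVarying.sumLaw hγ hν ih hinf

/-- Higher convolution powers have heavier tails. -/
lemma tendsto_convPow_div {ν : Measure ℝ} [IsProbabilityMeasure ν] {γ : ℝ} (hγ : 0 < γ)
    (hν : ExpVarying (fun u => ν.real (Set.Ioi u)) γ)
    (hinf : ∫⁻ y, ENNReal.ofReal (Real.exp (γ * y)) ∂ν = ⊤) {m n : ℕ} (hm : 1 ≤ m) (hmn : m < n) :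
    Tendsto (fun u => (convPow ν m).real (Set.Ioi u) / (convPow ν n).real (Set.Ioi u)) atTop
      (𝓝 0) := by
  have hstep : ∀ k, 1 ≤ k → Tendsto (fun u => (convPow ν k).real (Set.Ioi u) /
      (convPow ν (k + 1)).real (Set.Ioi u)) atTop (𝓝 0) := fun k hk =>
    (tendsto_inv_atTop_zero.comp (tendsto_tail_div_sumLaw
      (expVarying_convPow hγ hν hinf hk) hinf hγ)).congr fun u => by simp [convPow]
  induction n, hmn using Nat.le_induction with
  | base => exact hstep m hm
  | succ n hn ih =>
    have hn1 : 1 ≤ n := hm.trans (Nat.le_of_lt hn)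
    have := ih.mul (hstep n hn1)
    rw [mul_zero] at this
    refine this.congr fun u => ?_
    rw [div_mul_div_cancel₀ ((expVarying_convPow hγ hν hinf hn1).pos u).ne']

/-! ### Linear forms of an iid field -/

/-- The field `ξ` is iid with marginal law `ν`. -/
structure IIDField {Ω : Type*} [MeasurableSpace Ω] (P : Measure Ω) {Q : Type*} (ξ : Q → Ω → ℝ)
    (ν : Measure ℝ) : Prop where
  meas : ∀ q, Measurable (ξ q)
  indep : iIndepFun ξ P
  law : ∀ q, P.map (ξ q) = ν

/-- The linear form `∑ w_q ξ_q`; its value is zero where the series does not converge. -/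
noncomputable def linForm {Ω Q : Type*} (ξ : Q → Ω → ℝ) (w : Q → ℝ) (ω : Ω) : ℝ :=
  ∑' q, w q * ξ q ω

/-- Coefficients in `[0, 1]` which are summable and for which the linear form converges absolutely
almost surely. -/
structure IsWeight {Ω : Type*} [MeasurableSpace Ω] (P : Measure Ω) {Q : Type*} (ξ : Q → Ω → ℝ)
    (w : Q → ℝ) : Prop where
  nonneg : ∀ q, 0 ≤ w q
  le_one : ∀ q, w q ≤ 1
  summable : Summable w
  ae_summable : ∀ᵐ ω ∂P, Summable fun q => w q * ξ q ω

section

variable {Ω : Type*} [MeasurableSpace Ω] {P : Measure Ω} [IsProbabilityMeasure P]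
  {Q : Type*} [Countable Q] {ξ : Q → Ω → ℝ} {ν : Measure ℝ}

lemma IsWeight.mono {w w' : Q → ℝ} (hw : IsWeight P ξ w) (h0 : ∀ q, 0 ≤ w' q)
    (hle : ∀ q, w' q ≤ w q) : IsWeight P ξ w' where
  nonneg := h0
  le_one q := (hle q).trans (hw.le_one q)
  summable := Summable.of_nonneg_of_le h0 hle hw.summable
  ae_summable := by
    filter_upwards [hw.ae_summable] with ω hω
    refine Summable.of_norm_bounded hω.abs fun q => ?_
    rw [Real.norm_eq_abs, abs_mul, abs_mul, abs_of_nonneg (h0 q), abs_of_nonneg (hw.nonneg q)]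
    exact mul_le_mul_of_nonneg_right (hle q) (abs_nonneg _)

lemma IsWeight.indicator {w : Q → ℝ} (hw : IsWeight P ξ w) (S : Set Q) :
    IsWeight P ξ (S.indicator w) :=
  hw.mono (fun q => Set.indicator_nonneg (fun q _ => hw.nonneg q) q)
    (fun q => Set.indicator_le_self' (fun q _ => hw.nonneg q) q)

lemma measurable_linForm (hξ : ∀ q, Measurable (ξ q)) (w : Q → ℝ) : Measurable (linForm ξ w) :=
  Measurable.tsum fun q => (hξ q).const_mul _

lemma linForm_indicator_eq (S : Set Q) (w : Q → ℝ) (ω : Ω) :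
    linForm ξ (S.indicator w) ω = ∑' q, w q * S.indicator (fun q => ξ q ω) q := by
  refine tsum_congr fun q => ?_
  by_cases hq : q ∈ S <;> simp [hq]

/-- Splitting off finitely many terms of a linear form. -/
lemma linForm_eq_sum_add {w : Q → ℝ} (hw : IsWeight P ξ w) (j : Finset Q) :
    ∀ᵐ ω ∂P, linForm ξ w ω = (∑ q ∈ j, w q * ξ q ω) +
      linForm ξ ((j : Set Q)ᶜ.indicator w) ω := by
  filter_upwards [(hw.indicator (j : Set Q)).ae_summable,
    (hw.indicator (j : Set Q)ᶜ).ae_summable] with ω h1 h2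
  have h3 : ∑ q ∈ j, w q * ξ q ω = ∑' q, (j : Set Q).indicator w q * ξ q ω := by
    rw [tsum_eq_sum (s := j)]
    · refine Finset.sum_congr rfl fun q hq => ?_
      rw [Set.indicator_of_mem (by exact hq)]
    · intro q hq
      rw [Set.indicator_of_notMem (by exact hq), zero_mul]
  rw [h3, linForm, linForm, ← h1.tsum_add h2]
  refine tsum_congr fun q => ?_
  rw [← add_mul, ← Pi.add_apply, Set.indicator_self_add_compl]

lemma linForm_eq_add {w : Q → ℝ} (hw : IsWeight P ξ w) (q : Q) :
    ∀ᵐ ω ∂P, linForm ξ w ω = w q * ξ q ω + linForm ξ (({q} : Set Q)ᶜ.indicator w) ω := by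
  simpa using linForm_eq_sum_add hw {q}

/-- The restrictions of an independent field to a set of indices and to its complement are
independent. -/
lemma indepFun_indicator (hξ : ∀ q, Measurable (ξ q)) (hind : iIndepFun ξ P) (S : Set Q) :
    IndepFun (fun ω => Sᶜ.indicator fun q => ξ q ω) (fun ω => S.indicator fun q => ξ q ω) P := by
  classical
  have hm : ∀ (T : Set Q) (q : Q), Measurable fun ω => T.indicator (fun q => ξ q ω) q := by
    intro T q
    by_cases hq : q ∈ T
    · simpa [hq] using hξ q
    · simp [hq]
  refine IndepFun.process_indepFun_process (hm Sᶜ) (hm S) fun I J => ?_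
  obtain ⟨F, hF⟩ : ∃ F : Set Q → Finset Q → Finset Q, ∀ T I q, q ∈ F T I ↔ q ∈ I ∧ q ∈ T :=
    ⟨fun T I => I.filter (· ∈ T), fun T I q => Finset.mem_filter⟩
  have hdisj : Disjoint (F Sᶜ I) (F S J) := by
    rw [Finset.disjoint_left]
    intro q h1 h2
    exact ((hF _ _ _).1 h1).2 ((hF _ _ _).1 h2).2
  have h := hind.indepFun_finset _ _ hdisj hξ
  have hφ : ∀ (T : Set Q) (I : Finset Q), ∃ φ : (↥(F T I) → ℝ) → (I → ℝ),
      Measurable φ ∧ (fun ω (i : I) => T.indicator (fun q => ξ q ω) i) =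
        φ ∘ fun ω (i : ↥(F T I)) => ξ i ω := by
    intro T I
    refine ⟨fun x i => if h : (i : Q) ∈ T then x ⟨i, (hF _ _ _).2 ⟨i.2, h⟩⟩ else 0, ?_, ?_⟩
    · refine measurable_pi_lambda _ fun i => ?_
      by_cases hi : (i : Q) ∈ T
      · simp only [hi, dif_pos]; exact measurable_pi_apply _
      · simp only [hi, dif_neg, not_false_eq_true]; exact measurable_const
    · ext ω i
      by_cases hi : (i : Q) ∈ T <;> simp [hi]
  obtain ⟨φ, hφm, hφ'⟩ := hφ Sᶜ I
  obtain ⟨ψ, hψm, hψ'⟩ := hφ S J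
  rw [hφ', hψ']
  exact h.comp hφm hψm

/-- The exponential moments of a linear form with coefficients in `[0, 1]`: by convexity
`exp (θ w x⁺) ≤ 1 - w + w exp (θ x⁺)`, so that the product of the moments of the terms is
bounded. -/
lemma lintegral_exp_linForm_lt_top (hξ : IIDField P ξ ν) {w : Q → ℝ} (hw : IsWeight P ξ w) {θ : ℝ}
    (hθ : 0 ≤ θ) (hν : ∫⁻ x, ENNReal.ofReal (Real.exp (θ * max x 0)) ∂ν < ⊤) :
    ∫⁻ ω, ENNReal.ofReal (Real.exp (θ * linForm ξ w ω)) ∂P < ⊤ := by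
  set M := ∫⁻ x, ENNReal.ofReal (Real.exp (θ * max x 0)) ∂ν with hM
  have hone : ∀ q, ∫⁻ ω, ENNReal.ofReal (Real.exp (θ * (w q * ξ q ω))) ∂P ≤
      ENNReal.ofReal (Real.exp (w q * M.toReal)) := by
    intro q
    have hw0 := hw.nonneg q
    have hw1 := hw.le_one q
    have hpt : ∀ x : ℝ, Real.exp (θ * (w q * x)) ≤
        (1 - w q) + w q * Real.exp (θ * max x 0) := by
      intro x
      have h1 := convexOn_exp.2 (Set.mem_univ (0 : ℝ)) (Set.mem_univ (θ * max x 0))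
        (sub_nonneg.2 hw1) hw0 (by ring)
      simp only [smul_eq_mul, mul_zero, zero_add, Real.exp_zero, mul_one] at h1
      refine le_trans (Real.exp_le_exp.2 ?_) h1
      have h2 : x ≤ max x 0 := le_max_left _ _
      calc θ * (w q * x) ≤ θ * (w q * max x 0) := by gcongr
        _ = _ := by ring
    calc ∫⁻ ω, ENNReal.ofReal (Real.exp (θ * (w q * ξ q ω))) ∂P
        = ∫⁻ x, ENNReal.ofReal (Real.exp (θ * (w q * x))) ∂ν := by
          rw [← hξ.law q, lintegral_map (by fun_prop) (hξ.meas q)]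
      _ ≤ ∫⁻ x, (ENNReal.ofReal (1 - w q) +
            ENNReal.ofReal (w q) * ENNReal.ofReal (Real.exp (θ * max x 0))) ∂ν := by
          refine lintegral_mono fun x => ?_
          rw [← ENNReal.ofReal_mul hw0, ← ENNReal.ofReal_add (sub_nonneg.2 hw1) (by positivity)]
          exact ENNReal.ofReal_le_ofReal (hpt x)
      _ = ENNReal.ofReal (1 - w q) + ENNReal.ofReal (w q) * M := by
          have : IsProbabilityMeasure ν := by
            rw [← hξ.law q]; exact Measure.isProbabilityMeasure_map (hξ.meas q).aemeasurable
          rw [lintegral_add_left measurable_const, lintegral_const_mul _ (by fun_prop)]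
          simp [hM]
      _ = ENNReal.ofReal (1 - w q + w q * M.toReal) := by
          rw [ENNReal.ofReal_add (sub_nonneg.2 hw1) (by positivity), ENNReal.ofReal_mul hw0,
            ENNReal.ofReal_toReal hν.ne]
      _ ≤ _ := by
          refine ENNReal.ofReal_le_ofReal ?_
          have := Real.add_one_le_exp (w q * M.toReal)
          linarith
  have hfin : ∀ s : Finset Q, ∫⁻ ω, ENNReal.ofReal (Real.exp (θ * ∑ q ∈ s, w q * ξ q ω)) ∂P ≤
      ENNReal.ofReal (Real.exp ((∑' q, w q) * M.toReal)) := by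
    intro s
    have h1 : ∀ ω, ENNReal.ofReal (Real.exp (θ * ∑ q ∈ s, w q * ξ q ω)) =
        ∏ q ∈ s, ENNReal.ofReal (Real.exp (θ * (w q * ξ q ω))) := by
      intro ω
      rw [Finset.mul_sum, Real.exp_sum, ENNReal.ofReal_prod_of_nonneg]
      exact fun q _ => (Real.exp_pos _).le
    simp_rw [h1]
    have hind : iIndepFun (fun q ω => ENNReal.ofReal (Real.exp (θ * (w q * ξ q ω)))) P :=
      hξ.indep.comp (fun q x => ENNReal.ofReal (Real.exp (θ * (w q * x)))) fun q => by fun_prop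
    rw [lintegral_prod_eq_prod_lintegral_of_indepFun s _ hind fun q => by
      have := hξ.meas q; fun_prop]
    calc ∏ q ∈ s, ∫⁻ ω, ENNReal.ofReal (Real.exp (θ * (w q * ξ q ω))) ∂P
        ≤ ∏ q ∈ s, ENNReal.ofReal (Real.exp (w q * M.toReal)) :=
          Finset.prod_le_prod' fun q _ => hone q
      _ = ENNReal.ofReal (Real.exp ((∑ q ∈ s, w q) * M.toReal)) := by
          rw [← ENNReal.ofReal_prod_of_nonneg fun q _ => (Real.exp_pos _).le, ← Real.exp_sum,
            Finset.sum_mul]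
      _ ≤ _ := by
          gcongr
          exact hw.summable.sum_le_tsum s fun q _ => hw.nonneg q
  obtain ⟨s, hs⟩ := exists_seq_tendsto (atTop : Filter (Finset Q))
  have hlim : ∀ᵐ ω ∂P, ENNReal.ofReal (Real.exp (θ * linForm ξ w ω)) =
      liminf (fun n => ENNReal.ofReal (Real.exp (θ * ∑ q ∈ s n, w q * ξ q ω))) atTop := by
    filter_upwards [hw.ae_summable] with ω hω
    refine (Tendsto.liminf_eq ?_).symm
    have h1 : Tendsto (fun n => ∑ q ∈ s n, w q * ξ q ω) atTop (𝓝 (linForm ξ w ω)) :=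
      hω.hasSum.comp hs
    exact (ENNReal.continuous_ofReal.tendsto _).comp
      ((Real.continuous_exp.tendsto _).comp (h1.const_mul θ))
  rw [lintegral_congr_ae hlim]
  refine lt_of_le_of_lt (lintegral_liminf_le fun n => ?_) (lt_of_le_of_lt
    (liminf_le_of_le (a := ENNReal.ofReal (Real.exp ((∑' q, w q) * M.toReal)))
      (by isBoundedDefault) ?_)
    ENNReal.ofReal_lt_top)
  · have := hξ.meas; fun_prop
  · intro b hb
    obtain ⟨n, hn⟩ := hb.exists
    exact hn.trans (hfin (s n))

lemma integrable_exp_linForm (hξ : IIDField P ξ ν) {w : Q → ℝ} (hw : IsWeight P ξ w) {θ : ℝ}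
    (hθ : 0 ≤ θ) (hν : ∫⁻ x, ENNReal.ofReal (Real.exp (θ * max x 0)) ∂ν < ⊤) :
    Integrable (fun ω => Real.exp (θ * linForm ξ w ω)) P := by
  have := measurable_linForm hξ.meas w
  refine ⟨by fun_prop, ?_⟩
  rw [hasFiniteIntegral_iff_ofReal (ae_of_all _ fun ω => (Real.exp_pos _).le)]
  exact lintegral_exp_linForm_lt_top hξ hw hθ hν

/-- If the coefficients stay below some `θ₀ < 1`, the exponential of the linear form has a moment of
order larger than the index of the innovations. -/
lemma exists_integrable_exp_linForm [IsProbabilityMeasure ν] (hξ : IIDField P ξ ν) {γ : ℝ}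
    (hγ : 0 < γ) (hν : ExpVarying (fun u => ν.real (Set.Ioi u)) γ) {θ₀ : ℝ} (hθ₀ : θ₀ < 1) :
    ∃ b, γ < b ∧ ∀ w : Q → ℝ, IsWeight P ξ w → (∀ q, w q ≤ θ₀) →
      Integrable (fun ω => Real.exp (b * linForm ξ w ω)) P := by
  set t := max θ₀ (1 / 2) with ht
  have ht0 : 0 < t := lt_of_lt_of_le (by norm_num) (le_max_right _ _)
  have ht1 : t < 1 := max_lt hθ₀ (by norm_num)
  obtain ⟨b, hb1, hb2⟩ := exists_between (show γ < γ / t by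
    rw [lt_div_iff₀ ht0]; nlinarith)
  refine ⟨b, hb1, fun w hw hwle => ?_⟩
  have hw' : IsWeight P ξ (fun q => w q / t) := by
    refine ⟨fun q => div_nonneg (hw.nonneg q) ht0.le, fun q => ?_, hw.summable.div_const t, ?_⟩
    · rw [div_le_one ht0]; exact (hwle q).trans (le_max_left _ _)
    · filter_upwards [hw.ae_summable] with ω hω
      refine (hω.div_const t).congr fun q => ?_
      ring
  have hbt : b * t < γ := by rwa [lt_div_iff₀ ht0] at hb2
  have hbt0 : 0 ≤ b * t := mul_nonneg (hγ.trans hb1).le ht0.le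
  have h := integrable_exp_linForm hξ hw' hbt0 (lintegral_exp_posPart_lt_top hν hbt0 hbt)
  refine h.congr (ae_of_all _ fun ω => ?_)
  have : linForm ξ w ω = t * linForm ξ (fun q => w q / t) ω := by
    rw [linForm, linForm, ← tsum_mul_left]
    refine tsum_congr fun q => ?_
    field_simp
  simp only
  rw [this, mul_assoc]

/-- A variable with an exponential moment of order larger than the index has a negligible tail. -/
lemma tendsto_tail_div_zero {H : ℝ → ℝ} {γ b : ℝ} (hγ : 0 < γ) (hH : ExpVarying H γ) (hb : γ < b)
    {X : Ω → ℝ} (hX : Integrable (fun ω => Real.exp (b * X ω)) P) :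
    Tendsto (fun u => P.real {ω | u < X ω} / H u) atTop (𝓝 0) := by
  have h1 := (hH.tendsto_exp_mul_atTop hγ hb)
  have h2 := (tendsto_inv_atTop_zero.comp h1).const_mul (∫ ω, Real.exp (b * X ω) ∂P)
  rw [mul_zero] at h2
  refine squeeze_zero (fun u => div_nonneg measureReal_nonneg (hH.pos u).le) (fun u => ?_) h2
  have h3 := mul_meas_ge_le_integral_of_nonneg (μ := P)
    (ae_of_all _ fun ω => (Real.exp_pos (b * X ω)).le) hX (Real.exp (b * u))
  have h4 : P.real {ω | u < X ω} ≤ P.real {ω | Real.exp (b * u) ≤ Real.exp (b * X ω)} := by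
    refine measureReal_mono fun ω hω => Real.exp_le_exp.2 ?_
    have : u < X ω := hω
    have : 0 < b := hγ.trans hb
    gcongr
  have h5 : P.real {ω | u < X ω} * Real.exp (b * u) ≤ ∫ ω, Real.exp (b * X ω) ∂P := by
    refine le_trans ?_ h3
    rw [mul_comm]
    gcongr
  have hp := hH.pos u
  simp only [Function.comp]
  rw [div_le_iff₀ hp, mul_inv, mul_assoc, mul_assoc, inv_mul_cancel₀ hp.ne', mul_one,
    ← div_eq_mul_inv, le_div_iff₀ (Real.exp_pos _)]
  exact h5

end

/-! ### Limits along random rays -/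

section

variable {Ω : Type*} [MeasurableSpace Ω] {P : Measure Ω} [IsProbabilityMeasure P]
  {ι : Type*} [Fintype ι]

/-- The limit behaviour of the vector `exp L` on the scale `exp u`: for all test functions `g`,
`E g (exp (L - u))`, normalised by `H u`, converges to the sum of the integrals of `g` with respect
to the images of the radial measure along the random rays through the `R j`, `j ∈ J`. The coordinate
`a₀` is one that contributes to the limit. -/
structure IsLimitFamily (P : Measure Ω) (L : ι → Ω → ℝ) (H : ℝ → ℝ) (γ : ℝ) {K : Type*}
    (J : Finset K) (R : K → Ω → ι → ℝ) (a₀ : ι) : Prop where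
  expVarying : ExpVarying H γ
  meas : ∀ j, Measurable (R j)
  nonneg : ∀ j ω a, 0 ≤ R j ω a
  integrable : ∀ j ∈ J, ∀ a, Integrable (fun ω => R j ω a ^ γ) P
  pos : ∃ j ∈ J, ∀ ω, 0 < R j ω a₀
  lim : ∀ g : (ι → ℝ) → ℝ, TestFn g →
    Tendsto (fun u => (∫ ω, g (fun a => Real.exp (L a ω - u)) ∂P) / H u) atTop
      (𝓝 (∑ j ∈ J, ∫ ω, rayIntegral γ g (R j ω) ∂P))

lemma abs_sub_sum_le_of_dominant {g : (ι → ℝ) → ℝ} {ε δ κ : ℝ} {K : Type*} {J : Finset K}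
    {G : K → Set ι} (hg0 : ∀ v, (∀ a, |v a| ≤ ε) → g v = 0)
    (htr : ∀ j, ∀ v : ι → ℝ, (∀ a ∉ G j, |v a| ≤ δ) → |g v - g ((G j).indicator v)| ≤ κ)
    {v : ι → ℝ} {z : K → ι → ℝ} {j₀ : K} (hj₀ : j₀ ∈ J) (hz : z j₀ = (G j₀).indicator v)
    (hv : ∀ a ∉ G j₀, |v a| ≤ δ) (hzj : ∀ j ∈ J, j ≠ j₀ → ∀ a, |z j a| ≤ ε) :
    |g v - ∑ j ∈ J, g (z j)| ≤ κ := by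
  rw [Finset.sum_eq_single_of_mem j₀ hj₀ fun j hj hne => hg0 _ (hzj j hj hne), hz]
  exact htr j₀ v hv

lemma abs_sub_sum_le_card {g : (ι → ℝ) → ℝ} {C : ℝ} {K : Type*} (J : Finset K)
    (hC : ∀ v, |g v| ≤ C) (v : ι → ℝ) (z : K → ι → ℝ) :
    |g v - ∑ j ∈ J, g (z j)| ≤ (1 + J.card) * C := by
  calc |g v - ∑ j ∈ J, g (z j)| ≤ |g v| + |∑ j ∈ J, g (z j)| := abs_sub _ _
    _ ≤ C + ∑ j ∈ J, C := add_le_add (hC v) ((Finset.abs_sum_le_sum_abs _ _).trans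
        (Finset.sum_le_sum fun j _ => hC _))
    _ = _ := by rw [Finset.sum_const, nsmul_eq_mul]; ring

/-- Up to an error controlled by the probability of a bad event, `E g (exp (L - u))` is the sum of
the contributions of the groups of coordinates `G j`, if outside the bad event at most one group is
large and the coordinates outside the group are small. -/
lemma eventually_abs_integral_sub_sum_le {L : ι → Ω → ℝ} (hL : ∀ a, Measurable (L a)) {H : ℝ → ℝ}
    {γ : ℝ} (hH : ExpVarying H γ)
    (htail : ∀ a, ∃ c, Tendsto (fun u => P.real {ω | u < L a ω} / H u) atTop (𝓝 c))
    {K : Type*} {J : Finset K} {G : K → Set ι} {B : K → Ω → ℝ} {R : K → Ω → ι → ℝ}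
    (hB : ∀ j, Measurable (B j)) (hR : ∀ j, Measurable (R j))
    (hBR : ∀ j ∈ J, ∀ᵐ ω ∂P, ∀ a, R j ω a = 0 ∨ Real.exp (B j ω) * R j ω a = Real.exp (L a ω))
    {g : (ι → ℝ) → ℝ} (hg : TestFn g) {C ε η η' : ℝ} (hC : ∀ v, |g v| ≤ C) (hε : 0 < ε)
    (hg0 : ∀ v, (∀ a, |v a| ≤ ε) → g v = 0) (hη : (1 + J.card) * C * η < η')
    (hbad : ∀ δ, 0 < δ → δ ≤ ε → ∃ S : ℝ → Set Ω, (∀ u, MeasurableSet (S u)) ∧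
      (∀ᶠ u in atTop, P.real (S u) ≤ η * H u) ∧
      ∀ᶠ u in atTop, ∀ᵐ ω ∂P, (∃ a, u + Real.log ε < L a ω) → ω ∉ S u →
        ∃ j₀ ∈ J, (∀ a ∈ G j₀, Real.exp (B j₀ ω) * R j₀ ω a = Real.exp (L a ω)) ∧
          (∀ a ∉ G j₀, R j₀ ω a = 0 ∧ L a ω ≤ u + Real.log δ) ∧
          ∀ j ∈ J, j ≠ j₀ → ∀ a, R j ω a = 0 ∨ L a ω ≤ u + Real.log ε) :
    ∀ᶠ u in atTop, |(∫ ω, g (fun a => Real.exp (L a ω - u)) ∂P) -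
      ∑ j ∈ J, ∫ ω, g (fun a => Real.exp (B j ω - u) * R j ω a) ∂P| ≤ η' * H u := by
  have hC0 : 0 ≤ C := (abs_nonneg _).trans (hC 0)
  choose c hc using htail
  -- the tails of the coordinates at level `u + log ε`
  set A := ∑ a, (|c a * Real.exp (-(γ * Real.log ε))| + 1) with hA
  have hA0 : 0 ≤ A := Finset.sum_nonneg fun a _ => by positivity
  have htail' : ∀ᶠ u in atTop, ∑ a, P.real {ω | u + Real.log ε < L a ω} ≤ A * H u := by
    have : ∀ a, ∀ᶠ u in atTop, P.real {ω | u + Real.log ε < L a ω} ≤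
        (|c a * Real.exp (-(γ * Real.log ε))| + 1) * H u := by
      intro a
      have h1 := hH.tendsto_div_shift (T := fun u => P.real {ω | u < L a ω}) (hc a) (Real.log ε)
      filter_upwards [h1.eventually_lt_const
        (lt_of_le_of_lt (le_abs_self _) (lt_add_one _))] with u hu
      exact ((div_lt_iff₀ (hH.pos u)).1 hu).le
    filter_upwards [eventually_all.2 this] with u hu
    rw [hA, Finset.sum_mul]
    exact Finset.sum_le_sum fun a _ => hu a
  obtain ⟨κ, hκ, hκη⟩ : ∃ κ > 0, κ * A + (1 + J.card) * C * η ≤ η' := by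
    refine ⟨(η' - (1 + J.card) * C * η) / (A + 1), div_pos (by linarith) (by linarith), ?_⟩
    rw [div_mul_eq_mul_div, ← le_sub_iff_add_le, div_le_iff₀ (by linarith)]
    nlinarith
  -- a common truncation level for the finitely many groups
  obtain ⟨δ, hδ, hδε, htr⟩ : ∃ δ > 0, δ ≤ ε ∧ ∀ (T : Set ι) (v : ι → ℝ), (∀ a ∉ T, |v a| ≤ δ) →
      |g v - g (T.indicator v)| ≤ κ := by
    choose δ hδ htr using fun T => hg.trunc T κ hκ
    have : Nonempty (Set ι) := ⟨∅⟩
    obtain ⟨T₀, hT₀⟩ := Finite.exists_min δ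
    refine ⟨min (δ T₀) ε, lt_min (hδ T₀) hε, min_le_right _ _, fun T v hv => htr T v fun a ha => ?_⟩
    exact (hv a ha).trans ((min_le_left _ _).trans (hT₀ T))
  obtain ⟨S, hSm, hSP, hS⟩ := hbad δ hδ hδε
  filter_upwards [hSP, hS, htail'] with u hSP hS htail'
  have hgm := hg.cont.measurable
  have hint1 : Integrable (fun ω => g (fun a => Real.exp (L a ω - u))) P :=
    Integrable.of_bound (hgm.comp (by fun_prop)).aestronglyMeasurable C
      (ae_of_all _ fun ω => hC _)
  have hint2 : ∀ j, Integrable (fun ω => g (fun a => Real.exp (B j ω - u) * R j ω a)) P :=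
    fun j => Integrable.of_bound (hgm.comp (by
      have := hB j; have := hR j; fun_prop)).aestronglyMeasurable C (ae_of_all _ fun ω => hC _)
  rw [← integral_finsetSum _ fun j _ => hint2 j,
    ← integral_sub hint1 (integrable_finsetSum _ fun j _ => hint2 j)]
  have hLm : ∀ a, MeasurableSet {ω | u + Real.log ε < L a ω} := fun a =>
    measurableSet_lt measurable_const (hL a)
  have hpt : ∀ᵐ ω ∂P, |g (fun a => Real.exp (L a ω - u)) -
      ∑ j ∈ J, g (fun a => Real.exp (B j ω - u) * R j ω a)| ≤
      κ * (∑ a, {ω | u + Real.log ε < L a ω}.indicator (fun _ => (1 : ℝ)) ω) +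
        (1 + J.card) * C * (S u).indicator (fun _ => (1 : ℝ)) ω := by
    have hBR' : ∀ᵐ ω ∂P, ∀ j ∈ J, ∀ a,
        R j ω a = 0 ∨ Real.exp (B j ω) * R j ω a = Real.exp (L a ω) :=
      (ae_ball_iff J.countable_toSet).2 hBR
    filter_upwards [hS, hBR'] with ω hS hBR'
    have hexp : ∀ (t : ℝ), 0 < t → ∀ a, L a ω ≤ u + Real.log t → |Real.exp (L a ω - u)| ≤ t := by
      intro t ht a ha
      rw [abs_of_pos (Real.exp_pos _), ← Real.le_log_iff_exp_le ht]
      linarith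
    have hzexp : ∀ j a, Real.exp (B j ω) * R j ω a = Real.exp (L a ω) →
        Real.exp (B j ω - u) * R j ω a = Real.exp (L a ω - u) := by
      intro j a h
      rw [Real.exp_sub, Real.exp_sub, ← h]; ring
    have hind0 : ∀ a, 0 ≤ {ω | u + Real.log ε < L a ω}.indicator (fun _ => (1 : ℝ)) ω :=
      fun a => Set.indicator_nonneg (fun _ _ => zero_le_one) _
    have hindS : 0 ≤ (S u).indicator (fun _ => (1 : ℝ)) ω :=
      Set.indicator_nonneg (fun _ _ => zero_le_one) _
    have hpos1 : 0 ≤ κ * (∑ a, {ω | u + Real.log ε < L a ω}.indicator (fun _ => (1 : ℝ)) ω) :=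
      mul_nonneg hκ.le (Finset.sum_nonneg fun a _ => hind0 a)
    have hpos2 : 0 ≤ (1 + (J.card : ℝ)) * C := by positivity
    by_cases hex : ∃ a, u + Real.log ε < L a ω
    · by_cases hωS : ω ∈ S u
      · rw [Set.indicator_of_mem hωS, mul_one]
        exact (abs_sub_sum_le_card J hC _ _).trans (le_add_of_nonneg_left hpos1)
      · obtain ⟨j₀, hj₀, h1, h2, h3⟩ := hS hex hωS
        obtain ⟨a, ha⟩ := hex
        have h4 : (1 : ℝ) ≤ ∑ a, {ω | u + Real.log ε < L a ω}.indicator (fun _ => (1 : ℝ)) ω := by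
          refine le_trans ?_ (Finset.single_le_sum (f := fun a =>
            {ω | u + Real.log ε < L a ω}.indicator (fun _ => (1 : ℝ)) ω) (fun a _ => hind0 a)
            (Finset.mem_univ a))
          rw [Set.indicator_of_mem (by exact ha)]
        refine (abs_sub_sum_le_of_dominant (δ := δ) (κ := κ) (G := G) hg0
          (fun j v hv => htr (G j) v hv) hj₀ ?_ ?_ ?_).trans ?_
        · ext a
          by_cases haG : a ∈ G j₀
          · rw [Set.indicator_of_mem haG]; exact hzexp _ _ (h1 a haG)
          · rw [Set.indicator_of_notMem haG, (h2 a haG).1, mul_zero]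
        · exact fun a ha => hexp δ hδ a (h2 a ha).2
        · intro j hj hne a
          rcases hBR' j hj a with h | h
          · rw [h, mul_zero, abs_zero]; exact hε.le
          · rcases h3 j hj hne a with h' | h'
            · rw [h', mul_zero, abs_zero]; exact hε.le
            · rw [hzexp _ _ h]; exact hexp ε hε a h'
        · have := mul_nonneg hpos2 hindS
          nlinarith
    · push Not at hex
      have h1 : g (fun a => Real.exp (L a ω - u)) = 0 := hg0 _ fun a => hexp ε hε a (hex a)
      have h2 : ∀ j ∈ J, g (fun a => Real.exp (B j ω - u) * R j ω a) = 0 := by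
        refine fun j hj => hg0 _ fun a => ?_
        rcases hBR' j hj a with h | h
        · rw [h, mul_zero, abs_zero]; exact hε.le
        · rw [hzexp _ _ h]; exact hexp ε hε a (hex a)
      rw [h1, Finset.sum_eq_zero h2, sub_zero, abs_zero]
      exact add_nonneg hpos1 (mul_nonneg hpos2 hindS)
  have hint3 : ∀ a, Integrable
      (fun ω => {ω | u + Real.log ε < L a ω}.indicator (fun _ => (1 : ℝ)) ω) P := fun a =>
    (integrable_const _).indicator (hLm a)
  have hint4 : Integrable (fun ω => (S u).indicator (fun _ => (1 : ℝ)) ω) P :=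
    (integrable_const _).indicator (hSm u)
  have hint5 : Integrable (fun ω =>
      κ * ∑ a, {ω | u + Real.log ε < L a ω}.indicator (fun _ => (1 : ℝ)) ω) P :=
    (integrable_finsetSum _ fun a _ => hint3 a).const_mul κ
  calc |∫ ω, (g (fun a => Real.exp (L a ω - u)) -
        ∑ j ∈ J, g (fun a => Real.exp (B j ω - u) * R j ω a)) ∂P|
      ≤ ∫ ω, |g (fun a => Real.exp (L a ω - u)) -
        ∑ j ∈ J, g (fun a => Real.exp (B j ω - u) * R j ω a)| ∂P := abs_integral_le_integral_abs
    _ ≤ ∫ ω, (κ * (∑ a, {ω | u + Real.log ε < L a ω}.indicator (fun _ => (1 : ℝ)) ω) +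
        (1 + J.card) * C * (S u).indicator (fun _ => (1 : ℝ)) ω) ∂P :=
      integral_mono_ae (hint1.sub (integrable_finsetSum _ fun j _ => hint2 j)).abs
        (hint5.add (hint4.const_mul _)) hpt
    _ = κ * (∑ a, P.real {ω | u + Real.log ε < L a ω}) + (1 + J.card) * C * P.real (S u) := by
      rw [integral_add hint5 (hint4.const_mul _), integral_const_mul, integral_const_mul,
        integral_finsetSum _ fun a _ => hint3 a, integral_indicator (hSm u)]
      simp only [integral_indicator (hLm _)]
      simp
    _ ≤ κ * (A * H u) + (1 + J.card) * C * (η * H u) := by gcongr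
    _ = (κ * A + (1 + J.card) * C * η) * H u := by ring
    _ ≤ η' * H u := by
      have := (hH.pos u).le
      gcongr

lemma measurable_rayIntegral {g : (ι → ℝ) → ℝ} (hg : Continuous g) (γ : ℝ) :
    Measurable (rayIntegral γ g) := by
  have h : Measurable fun p : (ι → ℝ) × ℝ => g (fun a => Real.exp p.2 * p.1 a) :=
    hg.measurable.comp (by fun_prop)
  exact (h.stronglyMeasurable.integral_prod_right (ν := expDensity γ)).measurable

lemma expDensity_ray_lt {γ ε r : ℝ} (hγ : 0 < γ) (hε : 0 < ε) (hr : 0 ≤ r) :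
    expDensity γ {s | ε < Real.exp s * r} = ENNReal.ofReal ((r / ε) ^ γ) := by
  rcases hr.eq_or_lt' with h0 | h0
  · have : {s : ℝ | ε < Real.exp s * r} = ∅ := by ext s; simp [h0, hε.le]
    rw [this, measure_empty, h0, zero_div, Real.zero_rpow hγ.ne', ENNReal.ofReal_zero]
  · have : {s : ℝ | ε < Real.exp s * r} = Set.Ioi (-Real.log (r / ε)) := by
      ext s
      simpa using exp_sub_mul_gt_iff (b := s) (u := 0) hε h0
    rw [this, expDensity_Ioi hγ, Real.rpow_def_of_pos (by positivity)]
    ring_nf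

lemma lintegral_ray_le {γ C ε : ℝ} (hγ : 0 < γ) {g : (ι → ℝ) → ℝ}
    (hC : ∀ v, |g v| ≤ C) (hε : 0 < ε) (hg0 : ∀ v, (∀ a, |v a| ≤ ε) → g v = 0) (r : ι → ℝ) :
    ∫⁻ s, ‖g (fun a => Real.exp s * r a)‖ₑ ∂(expDensity γ) ≤
      ENNReal.ofReal (C * ∑ a, (|r a| / ε) ^ γ) := by
  have hC0 : 0 ≤ C := (abs_nonneg _).trans (hC 0)
  have hm : ∀ a, MeasurableSet {s : ℝ | ε < Real.exp s * |r a|} := fun a =>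
    measurableSet_lt measurable_const (by fun_prop)
  calc ∫⁻ s, ‖g (fun a => Real.exp s * r a)‖ₑ ∂(expDensity γ)
      ≤ ∫⁻ s, ∑ a, {s : ℝ | ε < Real.exp s * |r a|}.indicator
          (fun _ => ENNReal.ofReal C) s ∂(expDensity γ) := by
        refine lintegral_mono fun s => ?_
        by_cases hy : ∀ a, |Real.exp s * r a| ≤ ε
        · simp only [hg0 _ hy, enorm_zero, zero_le]
        · push Not at hy
          obtain ⟨a, ha⟩ := hy
          rw [abs_mul, abs_of_pos (Real.exp_pos _)] at ha
          refine le_trans ?_ (Finset.single_le_sum (f := fun a =>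
            {s : ℝ | ε < Real.exp s * |r a|}.indicator (fun _ => ENNReal.ofReal C) s)
            (fun a _ => zero_le) (Finset.mem_univ a))
          rw [Set.indicator_of_mem (by exact ha), ← ofReal_norm]
          exact ENNReal.ofReal_le_ofReal (hC _)
    _ = ∑ a, ENNReal.ofReal C * ENNReal.ofReal ((|r a| / ε) ^ γ) := by
        rw [lintegral_finsetSum _ fun a _ => measurable_const.indicator (hm a)]
        refine Finset.sum_congr rfl fun a _ => ?_
        rw [lintegral_indicator (hm a), lintegral_const, Measure.restrict_apply_univ,
          expDensity_ray_lt hγ hε (abs_nonneg _)]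
    _ = _ := by
        rw [← Finset.mul_sum, ENNReal.ofReal_mul hC0, ENNReal.ofReal_sum_of_nonneg]
        intro a _; positivity

lemma abs_rayIntegral_le {γ C ε : ℝ} (hγ : 0 < γ) {g : (ι → ℝ) → ℝ}
    (hC : ∀ v, |g v| ≤ C) (hε : 0 < ε) (hg0 : ∀ v, (∀ a, |v a| ≤ ε) → g v = 0) (r : ι → ℝ) :
    |rayIntegral γ g r| ≤ C * ∑ a, (|r a| / ε) ^ γ := by
  have hC0 : 0 ≤ C := (abs_nonneg _).trans (hC 0)
  have h1 := (enorm_integral_le_lintegral_enorm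
    (fun s => g (fun a => Real.exp s * r a)) (μ := expDensity γ)).trans
      (lintegral_ray_le hγ hC hε hg0 r)
  rw [← ofReal_norm, ENNReal.ofReal_le_ofReal_iff (mul_nonneg hC0
    (Finset.sum_nonneg fun a _ => by positivity))] at h1
  exact h1

lemma integrable_rayIntegral {γ : ℝ} (hγ : 0 < γ) {g : (ι → ℝ) → ℝ} (hg : TestFn g)
    {R : Ω → ι → ℝ} (hR : Measurable R) (hR0 : ∀ ω a, 0 ≤ R ω a)
    (hRi : ∀ a, Integrable (fun ω => R ω a ^ γ) P) :
    Integrable (fun ω => rayIntegral γ g (R ω)) P := by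
  obtain ⟨C, hC⟩ := hg.bdd
  obtain ⟨ε, hε, hg0⟩ := hg.vanish
  refine Integrable.mono' (g := fun ω => C * ∑ a, (|R ω a| / ε) ^ γ) ?_
    ((measurable_rayIntegral hg.cont γ).comp hR).aestronglyMeasurable
    (ae_of_all _ fun ω => abs_rayIntegral_le hγ hC hε hg0 _)
  refine (integrable_finsetSum _ fun a _ => ?_).const_mul _
  simp_rw [abs_of_nonneg (hR0 _ _), Real.div_rpow (hR0 _ _) hε.le]
  exact (hRi a).div_const _

/-- The tail of a sum of independent variables, one of which has a lighter tail. -/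
lemma tendsto_tail_add_light {B Y : Ω → ℝ} (hB : Measurable B) (hY : Measurable Y)
    (hind : IndepFun Y B P) {H : ℝ → ℝ} {γ b : ℝ} (hH : ExpVarying H γ)
    (hHB : ∀ u, P.real {ω | u < B ω} = H u) (hγ : 0 < γ) (hb : γ < b)
    (hmom : Integrable (fun ω => Real.exp (b * Y ω)) P) :
    Tendsto (fun u => P.real {ω | u < B ω + Y ω} / H u) atTop
      (𝓝 (∫ ω, Real.exp (γ * Y ω) ∂P)) := by
  have : IsProbabilityMeasure (P.map B) := Measure.isProbabilityMeasure_map hB.aemeasurable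
  have hβ : (fun u => (P.map B).real (Set.Ioi u)) = H := by
    ext u; rw [map_measureReal_apply hB measurableSet_Ioi, ← hHB u]; rfl
  have hS : MeasurableSet {v : Unit → ℝ | 1 < v ()} :=
    measurableSet_lt measurable_const (measurable_pi_apply _)
  have h := tendsto_integral_exp_mul (ι := Unit) (R := fun ω _ => Real.exp (Y ω)) hB
    (by fun_prop) (hind.comp (φ := fun y _ => Real.exp y) (ψ := id) (by fun_prop) measurable_id)
    hH hHB hγ hb (fun _ => by
      simpa only [abs_of_pos (Real.exp_pos _), ← Real.exp_mul, mul_comm] using hmom)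
    (g := {v : Unit → ℝ | 1 < v ()}.indicator fun _ => 1) (measurable_const.indicator hS)
    (C := 1) (ε := 1) (fun v => by
      simp only [Set.indicator_apply]; split_ifs <;> simp) one_pos
    (fun v hv => Set.indicator_of_notMem (by
      simpa using (le_abs_self _).trans (hv ())) _)
    (K := fun r => (max (r ()) 0) ^ γ) (fun r => by
      have := tendsto_coord_indicator (β := P.map B) hγ (by rw [hβ]; exact hH) () r
      simpa only [congrFun hβ] using this)
  simp only [max_eq_left (Real.exp_pos _).le, ← Real.exp_mul, mul_comm _ γ] at h
  refine h.congr fun u => ?_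
  congr 1
  rw [← integral_indicator_one (measurableSet_lt measurable_const (by fun_prop))]
  congr 1 with ω
  have : ((fun _ : Unit => Real.exp (B ω - u) * Real.exp (Y ω)) ∈ {v : Unit → ℝ | 1 < v ()}) ↔
      ω ∈ {ω | u < B ω + Y ω} := by
    simp only [Set.mem_ofPred_eq, ← Real.exp_add, Real.one_lt_exp_iff]
    constructor <;> intro h <;> linarith
  simp only [Set.indicator_apply, this, Pi.one_apply]

/-- By summability, the coefficients different from one are bounded away from one. -/
lemma exists_lt_one_of_summable {Q : Type*} {w : Q → ℝ} (hw : Summable w) {F : Finset Q}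
    (hle : ∀ q, w q ≤ 1) (hF : ∀ q, q ∈ F ↔ w q = 1) : ∃ θ, 0 ≤ θ ∧ θ < 1 ∧ ∀ q ∉ F, w q ≤ θ := by
  have h1 : ∀ᶠ q in cofinite, w q < 1 / 2 :=
    hw.tendsto_cofinite_zero.eventually_lt_const (by norm_num)
  have hfin : {q | ¬ w q < 1 / 2}.Finite := h1
  have hlt : ∀ q ∉ F, w q < 1 := fun q hq => lt_of_le_of_ne (hle q) fun h => hq ((hF q).2 h)
  classical
  rcases (hfin.toFinset \ F).eq_empty_or_nonempty with h | h
  · refine ⟨1 / 2, by norm_num, by norm_num, fun q hq => ?_⟩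
    by_contra hq'
    have : q ∈ hfin.toFinset \ F := Finset.mem_sdiff.2 ⟨hfin.mem_toFinset.2 fun h => hq' h.le, hq⟩
    exact absurd this (h ▸ Finset.notMem_empty q)
  · obtain ⟨q₀, hq₀, hmax⟩ := Finset.exists_max_image _ w h
    refine ⟨max (w q₀) (1 / 2), le_max_of_le_right (by norm_num),
      max_lt (hlt q₀ (Finset.mem_sdiff.1 hq₀).2) (by norm_num),
      fun q hq => ?_⟩
    by_cases hq' : w q < 1 / 2
    · exact hq'.le.trans (le_max_right _ _)
    · exact (hmax q (Finset.mem_sdiff.2 ⟨hfin.mem_toFinset.2 hq', hq⟩)).trans (le_max_left _ _)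

end

/-! ### Linear forms: infinite exponential moment -/

section

variable {Ω : Type*} [MeasurableSpace Ω] {P : Measure Ω} [IsProbabilityMeasure P]
  {Q : Type*} [Countable Q] {ξ : Q → Ω → ℝ} {ν : Measure ℝ} [IsProbabilityMeasure ν]
  {ι : Type*} [Fintype ι]

lemma measureReal_congr_of_ae {s t : Set Ω} (h : ∀ᵐ ω ∂P, ω ∈ s ↔ ω ∈ t) : P.real s = P.real t :=
  measureReal_congr (Filter.eventuallyEq_set.2 h)

lemma measureReal_mono_of_ae {s t : Set Ω} (h : ∀ᵐ ω ∂P, ω ∈ s → ω ∈ t) : P.real s ≤ P.real t :=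
  ENNReal.toReal_mono (measure_ne_top _ _) (measure_mono_ae h)

lemma map_add_eq_sumLaw {X Y : Ω → ℝ} (hX : Measurable X) (hY : Measurable Y)
    (h : IndepFun X Y P) : P.map (fun ω => X ω + Y ω) = sumLaw (P.map X) (P.map Y) := by
  rw [sumLaw, ← (indepFun_iff_map_prod_eq_prod_map_map hX.aemeasurable hY.aemeasurable).1 h,
    Measure.map_map (by fun_prop) (hX.prodMk hY)]
  rfl

lemma map_sum_eq_convPow (hξ : IIDField P ξ ν) (j : Finset Q) :
    P.map (fun ω => ∑ q ∈ j, ξ q ω) = convPow ν j.card := by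
  classical
  induction j using Finset.induction_on with
  | empty => simp [convPow, Measure.map_const]
  | insert q s hq ih =>
    have hm : Measurable fun ω => ∑ q ∈ s, ξ q ω :=
      Finset.measurable_sum _ fun q _ => hξ.meas q
    have hind : IndepFun (ξ q) (fun ω => ∑ q ∈ s, ξ q ω) P := by
      have := (hξ.indep.indepFun_finsetSum_of_notMem hξ.meas hq).symm
      refine this.congr (ae_of_all _ fun _ => rfl) (ae_of_all _ fun ω => by simp)
    simp_rw [Finset.sum_insert hq]
    rw [map_add_eq_sumLaw (hξ.meas q) hm hind, ih, hξ.law q, Finset.card_insert_of_notMem hq,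
      convPow]

lemma indepFun_linForm_compl_sum (hξ : IIDField P ξ ν) (j : Finset Q) {E : Type*}
    [MeasurableSpace E] {Φ : (Q → ℝ) → E} (hΦ : Measurable Φ) :
    IndepFun (fun ω => Φ ((j : Set Q)ᶜ.indicator fun q => ξ q ω)) (fun ω => ∑ q ∈ j, ξ q ω) P := by
  have h := (indepFun_indicator hξ.meas hξ.indep (j : Set Q)).comp (φ := Φ)
    (ψ := fun x : Q → ℝ => ∑ q ∈ j, x q) hΦ (by fun_prop)
  refine h.congr (ae_of_all _ fun ω => rfl) (ae_of_all _ fun ω => ?_)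
  refine Finset.sum_congr rfl fun q hq => ?_
  simp only
  rw [Set.indicator_of_mem (by exact hq)]

lemma measurable_tsum_mul (w : Q → ℝ) : Measurable fun x : Q → ℝ => ∑' q, w q * x q :=
  Measurable.tsum fun q => (measurable_pi_apply q).const_mul _

lemma indicator_compl_le {w : Q → ℝ} {F : Finset Q} {θ : ℝ} (hθ0 : 0 ≤ θ)
    (hθ : ∀ q ∉ F, w q ≤ θ) (q : Q) : (F : Set Q)ᶜ.indicator w q ≤ θ := by
  by_cases hq : q ∈ F
  · rw [Set.indicator_of_notMem (by simpa using hq)]; exact hθ0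
  · rw [Set.indicator_of_mem (by simpa using hq)]; exact hθ q hq

lemma exists_lt_one_of_family [Nonempty ι] {w : ι → Q → ℝ} (hw : ∀ a, IsWeight P ξ (w a))
    {F : ι → Finset Q} (hF : ∀ a q, q ∈ F a ↔ w a q = 1) :
    ∃ θ, 0 ≤ θ ∧ θ < 1 ∧ ∀ a, ∀ q ∉ F a, w a q ≤ θ := by
  choose θ h0 h1 h2 using fun a => exists_lt_one_of_summable (hw a).summable (hw a).le_one (hF a)
  obtain ⟨a, ha⟩ := Finite.exists_max θ
  exact ⟨θ a, h0 a, h1 a, fun b q hq => (h2 b q hq).trans (ha b)⟩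

/-- When the exponential moment at the index is infinite, the tail of a linear form is determined by
the number of coefficients equal to one. -/
lemma tendsto_tail_linForm_div_convPow (hξ : IIDField P ξ ν) {γ : ℝ} (hγ : 0 < γ)
    (hν : ExpVarying (fun u => ν.real (Set.Ioi u)) γ)
    (hinf : ∫⁻ y, ENNReal.ofReal (Real.exp (γ * y)) ∂ν = ⊤) {w : Q → ℝ} (hw : IsWeight P ξ w)
    {F : Finset Q} (hF : ∀ q, q ∈ F ↔ w q = 1) {n : ℕ} (hn : 1 ≤ n) (hFn : F.card ≤ n) :
    ∃ c, Tendsto (fun u => P.real {ω | u < linForm ξ w ω} / (convPow ν n).real (Set.Ioi u)) atTop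
      (𝓝 c) ∧ (F.card < n → c = 0) := by
  obtain ⟨θ, hθ0, hθ1, hθ⟩ := exists_lt_one_of_summable hw.summable hw.le_one hF
  obtain ⟨b, hb, hmom⟩ := exists_integrable_exp_linForm hξ hγ hν hθ1
  have hHn := expVarying_convPow hγ hν hinf hn
  have hYm := measurable_linForm hξ.meas ((F : Set Q)ᶜ.indicator w)
  have hYmom : Integrable (fun ω => Real.exp (b * linForm ξ ((F : Set Q)ᶜ.indicator w) ω)) P :=
    hmom _ (hw.indicator _) (indicator_compl_le hθ0 hθ)
  rcases Nat.eq_zero_or_pos F.card with h0 | hpos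
  · rw [Finset.card_eq_zero] at h0
    subst h0
    refine ⟨0, tendsto_tail_div_zero hγ hHn hb ?_, fun _ => rfl⟩
    simpa using hYmom
  · have hHm := expVarying_convPow hγ hν hinf hpos
    have hBm : Measurable fun ω => ∑ q ∈ F, ξ q ω := Finset.measurable_sum _ fun q _ => hξ.meas q
    have hind : IndepFun (linForm ξ ((F : Set Q)ᶜ.indicator w)) (fun ω => ∑ q ∈ F, ξ q ω) P := by
      refine (indepFun_linForm_compl_sum hξ F (measurable_tsum_mul w)).congr
        (ae_of_all _ fun ω => ?_) (ae_of_all _ fun _ => rfl)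
      exact (linForm_indicator_eq _ _ _).symm
    have h := tendsto_tail_add_light hBm hYm hind hHm (fun u => by
      rw [← map_sum_eq_convPow hξ F, map_measureReal_apply hBm measurableSet_Ioi]; rfl) hγ hb hYmom
    have heq : ∀ u, P.real {ω | u < (∑ q ∈ F, ξ q ω) + linForm ξ ((F : Set Q)ᶜ.indicator w) ω} =
        P.real {ω | u < linForm ξ w ω} := by
      intro u
      refine measureReal_congr_of_ae ?_
      filter_upwards [linForm_eq_sum_add hw F] with ω hω
      have h1 : ∑ q ∈ F, w q * ξ q ω = ∑ q ∈ F, ξ q ω :=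
        Finset.sum_congr rfl fun q hq => by rw [(hF q).1 hq, one_mul]
      rw [h1] at hω
      simp only [hω]
    simp_rw [heq] at h
    rcases hFn.lt_or_eq with hlt | heqn
    · refine ⟨0, ?_, fun _ => rfl⟩
      have h2 := h.mul (tendsto_convPow_div hγ hν hinf hpos hlt)
      rw [mul_zero] at h2
      refine h2.congr fun u => ?_
      rw [div_mul_div_cancel₀ (hHm.pos u).ne']
    · exact ⟨_, heqn ▸ h, fun hlt => absurd heqn hlt.ne⟩

lemma IsWeight.half_add {w w' : Q → ℝ} (hw : IsWeight P ξ w) (hw' : IsWeight P ξ w') :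
    IsWeight P ξ (fun q => (w q + w' q) / 2) where
  nonneg q := by have := hw.nonneg q; have := hw'.nonneg q; positivity
  le_one q := by have := hw.le_one q; have := hw'.le_one q; linarith
  summable := (hw.summable.add hw'.summable).div_const 2
  ae_summable := by
    filter_upwards [hw.ae_summable, hw'.ae_summable] with ω h1 h2
    refine ((h1.add h2).div_const 2).congr fun q => ?_
    ring

lemma linForm_half_add {w w' : Q → ℝ} (hw : IsWeight P ξ w) (hw' : IsWeight P ξ w') :
    ∀ᵐ ω ∂P, linForm ξ (fun q => (w q + w' q) / 2) ω = (linForm ξ w ω + linForm ξ w' ω) / 2 := by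
  filter_upwards [hw.ae_summable, hw'.ae_summable] with ω h1 h2
  rw [linForm, linForm, linForm, ← h1.tsum_add h2, ← tsum_div_const]
  refine tsum_congr fun q => ?_
  ring

/-- The limit of a vector of linear forms when the exponential moment of the innovations at the
index is infinite: only the coordinates with the maximal number of coefficients equal to one
contribute. Two of them are simultaneously large with non-negligible probability only if these
coefficients are at the same places, since the minimum of two forms is at most their mean. -/
theorem isLimitFamily_of_infinite_moment (hξ : IIDField P ξ ν) {γ : ℝ} (hγ : 0 < γ)
    (hν : ExpVarying (fun u => ν.real (Set.Ioi u)) γ)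
    (hinf : ∫⁻ y, ENNReal.ofReal (Real.exp (γ * y)) ∂ν = ⊤) {w : ι → Q → ℝ}
    (hw : ∀ a, IsWeight P ξ (w a)) {F : ι → Finset Q} (hF : ∀ a q, q ∈ F a ↔ w a q = 1) {a₀ : ι}
    (ha₀ : ∀ a, (F a).card ≤ (F a₀).card) (hF₀ : 1 ≤ (F a₀).card) :
    ∃ (H : ℝ → ℝ) (J : Finset (Finset Q)) (R : Finset Q → Ω → ι → ℝ),
      IsLimitFamily P (fun a => linForm ξ (w a)) H γ J R a₀ := by
  classical
  have : Nonempty ι := ⟨a₀⟩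
  obtain ⟨θ, hθ0, hθ1, hθ⟩ := exists_lt_one_of_family hw hF
  obtain ⟨b, hb, hmom⟩ := exists_integrable_exp_linForm hξ hγ hν hθ1
  set n := (F a₀).card with hn
  set H : ℝ → ℝ := fun u => (convPow ν n).real (Set.Ioi u) with hHdef
  have hH : ExpVarying H γ := expVarying_convPow hγ hν hinf hF₀
  set J : Finset (Finset Q) := (Finset.univ.image F).filter fun j => j.card = n with hJ
  set B : Finset Q → Ω → ℝ := fun j ω => ∑ q ∈ j, ξ q ω with hBdef
  set R : Finset Q → Ω → ι → ℝ := fun j ω a =>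
    if F a = j then Real.exp (linForm ξ ((j : Set Q)ᶜ.indicator (w a)) ω) else 0 with hRdef
  have hJn : ∀ j ∈ J, j.card = n := fun j hj => (Finset.mem_filter.1 hj).2
  have hBm : ∀ j, Measurable (B j) := fun j => Finset.measurable_sum _ fun q _ => hξ.meas q
  have hLm : ∀ a, Measurable (linForm ξ (w a)) := fun a => measurable_linForm hξ.meas _
  have hRm : ∀ j, Measurable (R j) := by
    refine fun j => measurable_pi_lambda _ fun a => ?_
    simp only [hRdef]
    split_ifs
    · exact (measurable_linForm hξ.meas _).exp
    · exact measurable_const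
  have hR0 : ∀ j ω a, 0 ≤ R j ω a := fun j ω a => by
    simp only [hRdef]; split_ifs <;> positivity
  have hRb : ∀ t, (∀ a, Integrable (fun ω =>
      Real.exp (t * linForm ξ ((F a : Set Q)ᶜ.indicator (w a)) ω)) P) → 0 < t →
      ∀ j a, Integrable (fun ω => R j ω a ^ t) P := by
    intro t ht ht0 j a
    by_cases hj : F a = j
    · subst hj
      simp only [hRdef, if_true, ← Real.exp_mul, mul_comm _ t]
      exact ht a
    · simp only [hRdef, if_neg hj, Real.zero_rpow ht0.ne']
      exact integrable_const _
  have hmomb : ∀ a, Integrable (fun ω =>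
      Real.exp (b * linForm ξ ((F a : Set Q)ᶜ.indicator (w a)) ω)) P := fun a =>
    hmom _ ((hw a).indicator _) (indicator_compl_le hθ0 (hθ a))
  have hmomγ : ∀ a, Integrable (fun ω =>
      Real.exp (γ * linForm ξ ((F a : Set Q)ᶜ.indicator (w a)) ω)) P := by
    intro a
    have hm := measurable_linForm hξ.meas ((F a : Set Q)ᶜ.indicator (w a))
    refine ((integrable_const (1 : ℝ)).add (hmomb a)).mono' (by fun_prop) (ae_of_all _ fun ω => ?_)
    rw [Real.norm_of_nonneg (Real.exp_pos _).le, Pi.add_apply]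
    set x := linForm ξ ((F a : Set Q)ᶜ.indicator (w a)) ω
    rcases le_total x 0 with hx | hx
    · have h1 : Real.exp (γ * x) ≤ 1 :=
        Real.exp_le_one_iff.2 (mul_nonpos_of_nonneg_of_nonpos hγ.le hx)
      linarith [Real.exp_pos (b * x)]
    · have h1 : Real.exp (γ * x) ≤ Real.exp (b * x) := by gcongr
      linarith
  have hBR : ∀ j ∈ J, ∀ᵐ ω ∂P, ∀ a, F a = j →
      Real.exp (B j ω) * R j ω a = Real.exp (linForm ξ (w a) ω) := by
    intro j _
    refine ae_all_iff.2 fun a => ?_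
    filter_upwards [linForm_eq_sum_add (hw a) (F a)] with ω hω hj
    have h1 : ∑ q ∈ F a, w a q * ξ q ω = ∑ q ∈ F a, ξ q ω :=
      Finset.sum_congr rfl fun q hq => by rw [(hF a q).1 hq, one_mul]
    simp only [hRdef, hBdef, if_pos hj]
    rw [← Real.exp_add, hω, h1, hj]
  have htail : ∀ a, ∃ c, Tendsto (fun u => P.real {ω | u < linForm ξ (w a) ω} / H u) atTop (𝓝 c) :=
    fun a => by
      obtain ⟨c, hc, _⟩ := tendsto_tail_linForm_div_convPow hξ hγ hν hinf (hw a) (hF a) hF₀ (ha₀ a)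
      exact ⟨c, hc⟩
  have hlawB : ∀ j ∈ J, ∀ u, P.real {ω | u < B j ω} = H u := by
    intro j hj u
    rw [hHdef, ← hJn j hj, ← map_sum_eq_convPow hξ j]
    simp only
    rw [map_measureReal_apply (hBm j) measurableSet_Ioi]
    rfl
  have hindB : ∀ j, IndepFun (R j) (B j) P := by
    intro j
    have hΦ : Measurable fun (x : Q → ℝ) (a : ι) =>
        if F a = j then Real.exp (∑' q, w a q * x q) else 0 := by
      refine measurable_pi_lambda _ fun a => ?_
      split_ifs
      · exact (measurable_tsum_mul (w a)).exp
      · exact measurable_const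
    refine (indepFun_linForm_compl_sum hξ j hΦ).congr (ae_of_all _ fun ω => ?_)
      (ae_of_all _ fun _ => rfl)
    ext a
    simp only [hRdef, linForm_indicator_eq]
  refine ⟨H, J, R, hH, hRm, hR0, fun j _ => hRb γ hmomγ hγ j, ⟨F a₀, ?_, fun ω => ?_⟩,
    fun g hg => ?_⟩
  · exact Finset.mem_filter.2 ⟨Finset.mem_image_of_mem _ (Finset.mem_univ _), rfl⟩
  · simp only [hRdef, if_true]; exact Real.exp_pos _
  obtain ⟨C, hC⟩ := hg.bdd
  obtain ⟨ε, hε, hg0⟩ := hg.vanish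
  refine tendsto_of_approx fun κ hκ => ?_
  refine ⟨fun u => ∑ j ∈ J, (∫ ω, g (fun a => Real.exp (B j ω - u) * R j ω a) ∂P) / H u,
    _, tendsto_finsetSum _ fun j hj => ?_, (by rw [sub_self, abs_zero]; exact hκ.le), ?_⟩
  · have hmapB : (fun u => (P.map (B j)).real (Set.Ioi u)) = H := by
      ext u; rw [map_measureReal_apply (hBm j) measurableSet_Ioi, ← hlawB j hj u]; rfl
    have : IsProbabilityMeasure (P.map (B j)) :=
      Measure.isProbabilityMeasure_map (hBm j).aemeasurable
    refine tendsto_integral_exp_mul (hBm j) (hRm j) (hindB j) hH (hlawB j hj) hγ hb ?_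
      hg.cont.measurable hC hε hg0 (K := rayIntegral γ g) fun r => ?_
    · intro a
      simp_rw [abs_of_nonneg (hR0 _ _ _)]
      exact hRb b hmomb (hγ.trans hb) j a
    · have := tendsto_ray (β := P.map (B j)) hγ (by rw [hmapB]; exact hH) hg r
      simpa only [congrFun hmapB] using this
  have hC0 : 0 ≤ C := (abs_nonneg _).trans (hC 0)
  obtain ⟨η, hη0, hη⟩ : ∃ η > 0, (1 + (J.card : ℝ)) * C * η < κ := by
    refine ⟨κ / ((1 + (J.card : ℝ)) * C + 1), by positivity, ?_⟩
    rw [← mul_div_assoc, div_lt_iff₀ (by positivity)]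
    nlinarith
  have hmain := eventually_abs_integral_sub_sum_le (L := fun a => linForm ξ (w a)) hLm hH htail
    (J := J) (G := fun j => {a | F a = j}) (B := B) (R := R) hBm hRm ?_ hg hC hε hg0 hη ?_
  · filter_upwards [hmain] with u hu
    rw [← Finset.sum_div, ← sub_div, abs_div, abs_of_pos (hH.pos u), div_le_iff₀ (hH.pos u)]
    exact hu
  · intro j hj
    filter_upwards [hBR j hj] with ω hω a
    by_cases ha : F a = j
    · exact Or.inr (hω a ha)
    · left; simp only [hRdef, if_neg ha]
  · intro δ hδ hδε
    -- two coordinates are large although their coefficients one are not at the same places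
    set T : Finset (ι × ι) := Finset.univ.filter fun p => (F p.1 ∩ F p.2).card < n with hT
    set S : ι × ι → ℝ → Set Ω := fun p u => {ω | u + Real.log δ < linForm ξ (w p.1) ω ∧
      u + Real.log δ < linForm ξ (w p.2) ω} with hS
    have hSm : ∀ p u, MeasurableSet (S p u) := fun p u =>
      (measurableSet_lt measurable_const (hLm p.1)).inter
        (measurableSet_lt measurable_const (hLm p.2))
    refine ⟨fun u => ⋃ p ∈ T, S p u, fun u => Finset.measurableSet_biUnion _ fun p _ => hSm p u,
      ?_, ?_⟩
    · have hp : ∀ p ∈ T, Tendsto (fun u => P.real (S p u) / H u) atTop (𝓝 0) := by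
        intro p hp
        have hFp : ∀ q, q ∈ F p.1 ∩ F p.2 ↔ (w p.1 q + w p.2 q) / 2 = 1 := by
          intro q
          rw [Finset.mem_inter, hF, hF]
          have h1 := (hw p.1).le_one q
          have h2 := (hw p.2).le_one q
          constructor
          · rintro ⟨h3, h4⟩; rw [h3, h4]; norm_num
          · intro h; constructor <;> linarith
        have hcard := (Finset.mem_filter.1 hp).2
        obtain ⟨c, hc, hc0⟩ := tendsto_tail_linForm_div_convPow hξ hγ hν hinf
          ((hw p.1).half_add (hw p.2)) hFp hF₀ hcard.le
        have h1 := hH.tendsto_div_shift hc (Real.log δ)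
        rw [hc0 hcard, zero_mul] at h1
        refine squeeze_zero (fun u => div_nonneg measureReal_nonneg (hH.pos u).le) (fun u => ?_) h1
        refine div_le_div_of_nonneg_right ?_ (hH.pos u).le
        refine measureReal_mono_of_ae ?_
        filter_upwards [linForm_half_add (hw p.1) (hw p.2)] with ω hω hωS
        have h2 : u + Real.log δ < linForm ξ (w p.1) ω := hωS.1
        have h3 : u + Real.log δ < linForm ξ (w p.2) ω := hωS.2
        show u + Real.log δ < linForm ξ (fun q => (w p.1 q + w p.2 q) / 2) ω
        rw [hω]; linarith
      have hsum := tendsto_finsetSum T hp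
      rw [Finset.sum_const_zero] at hsum
      filter_upwards [hsum.eventually_lt_const hη0] with u hu
      rw [← Finset.sum_div, div_lt_iff₀ (hH.pos u)] at hu
      exact (measureReal_biUnion_finset_le _ _).trans hu.le
    · refine Eventually.of_forall fun u => ?_
      filter_upwards [(ae_ball_iff J.countable_toSet).2 hBR] with ω hω hex hωS
      obtain ⟨a, ha⟩ := hex
      have hlog : Real.log δ ≤ Real.log ε := Real.log_le_log hδ hδε
      have ha' : u + Real.log δ < linForm ξ (w a) ω := by linarith
      have hnot : ∀ c d, (F c ∩ F d).card < n → u + Real.log δ < linForm ξ (w c) ω →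
          linForm ξ (w d) ω ≤ u + Real.log δ := by
        intro c d hcd hc
        by_contra! hd
        exact hωS (Set.mem_biUnion (x := (c, d))
          (Finset.mem_filter.2 ⟨Finset.mem_univ _, hcd⟩) ⟨hc, hd⟩)
      have hcard : (F a).card = n := by
        by_contra hne
        have h1 := hnot a a (by rw [Finset.inter_self]; exact lt_of_le_of_ne (ha₀ a) hne) ha'
        linarith
      have hother : ∀ d, F d ≠ F a → linForm ξ (w d) ω ≤ u + Real.log δ := by
        intro d hd
        refine hnot a d ?_ ha'
        by_contra! hle
        have h1 : F a ∩ F d = F a :=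
          Finset.eq_of_subset_of_card_le Finset.inter_subset_left (by rw [hcard]; exact hle)
        have h2 : F a ∩ F d = F d :=
          Finset.eq_of_subset_of_card_le Finset.inter_subset_right ((ha₀ d).trans hle)
        exact hd (h2.symm.trans h1)
      have hFJ : F a ∈ J :=
        Finset.mem_filter.2 ⟨Finset.mem_image_of_mem _ (Finset.mem_univ _), hcard⟩
      refine ⟨F a, hFJ, fun d hd => hω _ hFJ d hd, fun d hd => ⟨?_, hother d hd⟩,
        fun j hj hne d => ?_⟩
      · simp only [hRdef]; exact if_neg hd
      · by_cases hdj : F d = j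
        · right
          exact (hother d (hdj ▸ hne)).trans (by linarith)
        · left; simp only [hRdef, if_neg hdj]

end

/-! ### Tails of linear forms of convolution equivalent variables -/

section

variable {Ω : Type*} [MeasurableSpace Ω] {P : Measure Ω} [IsProbabilityMeasure P]
  {Q : Type*} [Countable Q] {ξ : Q → Ω → ℝ} {ν : Measure ℝ} [IsProbabilityMeasure ν]
  {ι : Type*} [Fintype ι]

lemma lintegral_exp_posPart_lt_top_of_integrable {θ : ℝ}
    (hint : Integrable (fun x => Real.exp (θ * x)) ν) :
    ∫⁻ x, ENNReal.ofReal (Real.exp (θ * max x 0)) ∂ν < ⊤ := by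
  have h : Integrable (fun x => Real.exp (θ * max x 0)) ν := by
    refine ((integrable_const (1 : ℝ)).add hint).mono'
      (Continuous.aestronglyMeasurable (by fun_prop)) (ae_of_all _ fun x => ?_)
    rw [Real.norm_of_nonneg (Real.exp_pos _).le, Pi.add_apply]
    rcases le_total x 0 with hx | hx
    · rw [max_eq_right hx]; simp [(Real.exp_pos _).le]
    · rw [max_eq_left hx]; linarith
  rw [← hasFiniteIntegral_iff_ofReal (ae_of_all _ fun ω => (Real.exp_pos _).le)]
  exact h.2

/-- On the event that the variables with index in `T` are at most `K`, a linear form is bounded by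
its part outside `T`. -/
lemma linForm_le_of_forall_le {w : Q → ℝ} (hw : IsWeight P ξ w) (T : Finset Q) {K : ℝ}
    (hK : 0 ≤ K) : ∀ᵐ ω ∂P, (∀ q ∈ T, ξ q ω ≤ K) →
      linForm ξ w ω ≤ T.card * K + linForm ξ ((T : Set Q)ᶜ.indicator w) ω := by
  filter_upwards [linForm_eq_sum_add hw T] with ω hω h
  rw [hω]
  gcongr
  rw [← nsmul_eq_mul]
  refine Finset.sum_le_card_nsmul _ _ _ fun q hq => ?_
  calc w q * ξ q ω ≤ w q * K := mul_le_mul_of_nonneg_left (h q hq) (hw.nonneg q)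
    _ ≤ 1 * K := mul_le_mul_of_nonneg_right (hw.le_one q) hK
    _ = K := one_mul K

/-- A linear form is large only with negligible probability while all variables with index in `T`
are bounded, if the coefficients outside `T` stay below some `θ < 1`. -/
lemma tendsto_tail_truncated (hξ : IIDField P ξ ν) {γ : ℝ} (hγ : 0 < γ)
    (hν : ExpVarying (fun u => ν.real (Set.Ioi u)) γ) {w : Q → ℝ} (hw : IsWeight P ξ w)
    (T : Finset Q) {θ : ℝ} (hθ0 : 0 ≤ θ) (hθ1 : θ < 1) (hT : ∀ q ∉ T, w q ≤ θ) {K : ℝ}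
    (hK : 0 ≤ K) :
    Tendsto (fun u => P.real {ω | u < linForm ξ w ω ∧ ∀ q ∈ T, ξ q ω ≤ K} / ν.real (Set.Ioi u))
      atTop (𝓝 0) := by
  obtain ⟨b, hb, hmom⟩ := exists_integrable_exp_linForm hξ hγ hν hθ1
  have h1 := tendsto_tail_div_zero hγ hν hb
    (hmom _ (hw.indicator (T : Set Q)ᶜ) (indicator_compl_le hθ0 hT))
  have h2 := hν.tendsto_div_shift h1 (-(T.card * K))
  rw [zero_mul] at h2
  refine squeeze_zero (fun u => div_nonneg measureReal_nonneg (hν.pos u).le) (fun u => ?_) h2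
  refine div_le_div_of_nonneg_right (measureReal_mono_of_ae ?_) (hν.pos u).le
  filter_upwards [linForm_le_of_forall_le hw T hK] with ω hω h
  have h3 := hω h.2
  have h4 : u < linForm ξ w ω := h.1
  show u + -(T.card * K) < linForm ξ ((T : Set Q)ᶜ.indicator w) ω
  linarith

lemma indepFun_linForm_compl_single (hξ : IIDField P ξ ν) (q : Q) {E : Type*}
    [MeasurableSpace E] {Φ : (Q → ℝ) → E} (hΦ : Measurable Φ) :
    IndepFun (fun ω => Φ (({q} : Set Q)ᶜ.indicator fun q => ξ q ω)) (ξ q) P := by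
  simpa using indepFun_linForm_compl_sum hξ {q} hΦ

lemma indepFun_linForm_single (hξ : IIDField P ξ ν) (q : Q) (w : Q → ℝ) :
    IndepFun (linForm ξ (({q} : Set Q)ᶜ.indicator w)) (ξ q) P := by
  refine (indepFun_linForm_compl_single hξ q (measurable_tsum_mul w)).congr
    (ae_of_all _ fun ω => ?_) (ae_of_all _ fun _ => rfl)
  exact (linForm_indicator_eq _ _ _).symm

/-- The tail of a linear form of convolution equivalent variables: each coefficient equal to one
contributes the exponential moment of the sum of the other terms. -/
lemma tendsto_tail_linForm (hξ : IIDField P ξ ν) {γ : ℝ} (hγ : 0 < γ)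
    (hν : ExpVarying (fun u => ν.real (Set.Ioi u)) γ)
    (hint : Integrable (fun x => Real.exp (γ * x)) ν)
    (hboth : ∀ ε > 0, ∀ᶠ K in atTop, ∀ᶠ u in atTop, bothLarge ν ν K u ≤ ε * ν.real (Set.Ioi u))
    {w : Q → ℝ} (hw : IsWeight P ξ w) {F : Finset Q} (hF : ∀ q, q ∈ F ↔ w q = 1) :
    Tendsto (fun u => P.real {ω | u < linForm ξ w ω} / ν.real (Set.Ioi u)) atTop
      (𝓝 (∑ q ∈ F, ∫ ω, Real.exp (γ * linForm ξ (({q} : Set Q)ᶜ.indicator w) ω) ∂P)) := by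
  classical
  have hpos := lintegral_exp_posPart_lt_top_of_integrable hint
  induction F using Finset.induction_on generalizing w with
  | empty =>
    obtain ⟨θ, hθ0, hθ1, hθ⟩ := exists_lt_one_of_summable hw.summable hw.le_one hF
    simpa using tendsto_tail_truncated hξ hγ hν hw ∅ hθ0 hθ1 hθ le_rfl
  | insert p s hp ih =>
    set w' := ({p} : Set Q)ᶜ.indicator w with hw'def
    have hw' : IsWeight P ξ w' := hw.indicator _
    have hwp : w p = 1 := (hF p).1 (Finset.mem_insert_self p s)
    have hF' : ∀ q, q ∈ s ↔ w' q = 1 := by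
      intro q
      by_cases hq : q = p
      · subst hq; simp [hw'def, hp]
      · rw [hw'def, Set.indicator_of_mem (by simpa using hq), ← hF q]
        simp [hq]
    have hYm := measurable_linForm hξ.meas w'
    have hind : IndepFun (ξ p) (linForm ξ w') P := (indepFun_linForm_single hξ p w).symm
    have : IsProbabilityMeasure (P.map (linForm ξ w')) :=
      Measure.isProbabilityMeasure_map hYm.aemeasurable
    have hexp : AEStronglyMeasurable (fun x : ℝ => Real.exp (γ * x)) (P.map (linForm ξ w')) :=
      Continuous.aestronglyMeasurable (by fun_prop)
    have hexp' : AEStronglyMeasurable (fun x : ℝ => Real.exp (γ * x)) (P.map (ξ p)) :=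
      Continuous.aestronglyMeasurable (by fun_prop)
    have hone : Tendsto (fun u => ν.real (Set.Ioi u) / ν.real (Set.Ioi u)) atTop (𝓝 1) :=
      tendsto_const_nhds.congr fun u => (div_self (hν.pos u).ne').symm
    have hmap : ∀ u, (P.map (linForm ξ w')).real (Set.Ioi u) = P.real {ω | u < linForm ξ w' ω} :=
      fun u => by rw [map_measureReal_apply hYm measurableSet_Ioi]; rfl
    have key := tendsto_tail_add (μ₁ := ν) (μ₂ := P.map (linForm ξ w')) hν hboth hint
      ((integrable_map_measure hexp hYm.aemeasurable).2
        (integrable_exp_linForm hξ hw' hγ.le hpos)) hone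
      (by simp_rw [hmap]; exact ih hw' hF')
    rw [one_mul, integral_map hYm.aemeasurable hexp] at key
    have hconst : ∀ q ∈ s, ∫ ω, Real.exp (γ * linForm ξ (({q} : Set Q)ᶜ.indicator w) ω) ∂P =
        (∫ ω, Real.exp (γ * linForm ξ (({q} : Set Q)ᶜ.indicator w') ω) ∂P) *
          ∫ x, Real.exp (γ * x) ∂ν := by
      intro q hq
      have hqp : p ≠ q := fun h => hp (h ▸ hq)
      have hcomm : ({p} : Set Q)ᶜ.indicator (({q} : Set Q)ᶜ.indicator w) =
          ({q} : Set Q)ᶜ.indicator w' := by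
        rw [hw'def, Set.indicator_indicator, Set.indicator_indicator, Set.inter_comm]
      have h1 := linForm_eq_add (hw.indicator ({q} : Set Q)ᶜ) p
      rw [hcomm] at h1
      have h2 := indepFun_linForm_single hξ p (({q} : Set Q)ᶜ.indicator w)
      rw [hcomm] at h2
      have h3 := (h2.comp (φ := fun x => Real.exp (γ * x)) (ψ := fun x => Real.exp (γ * x))
        (by fun_prop) (by fun_prop)).integral_fun_mul_eq_mul_integral
        ((measurable_linForm hξ.meas _).const_mul γ).exp.aestronglyMeasurable
        ((hξ.meas p).const_mul γ).exp.aestronglyMeasurable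
      rw [← hξ.law p, integral_map (hξ.meas p).aemeasurable hexp']
      refine Eq.trans (integral_congr_ae ?_) h3
      filter_upwards [h1] with ω hω
      rw [Set.indicator_of_mem (show p ∈ ({q} : Set Q)ᶜ from hqp), hwp, one_mul] at hω
      simp only [Function.comp]
      rw [hω, ← Real.exp_add]; ring_nf
    rw [Finset.sum_insert hp, Finset.sum_congr rfl hconst, ← Finset.sum_mul, add_comm]
    refine key.congr fun u => ?_
    congr 1
    rw [← sumLaw_real_Ioi, ← hξ.law p, ← map_add_eq_sumLaw (hξ.meas p) hYm hind,
      map_measureReal_apply (f := fun ω => ξ p ω + linForm ξ w' ω) ((hξ.meas p).add hYm)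
        measurableSet_Ioi]
    refine measureReal_congr_of_ae ?_
    filter_upwards [linForm_eq_add hw p] with ω hω
    rw [hwp, one_mul] at hω
    show u < ξ p ω + linForm ξ w' ω ↔ u < linForm ξ w ω
    rw [hω]

end

/-! ### Linear forms: convolution equivalence -/

section

variable {Ω : Type*} [MeasurableSpace Ω] {P : Measure Ω} [IsProbabilityMeasure P]
  {Q : Type*} [Countable Q] {ξ : Q → Ω → ℝ} {ν : Measure ℝ} [IsProbabilityMeasure ν]
  {ι : Type*} [Fintype ι]

open Classical in
/-- The random ray along which `ξ_q` drives the vector of linear forms with coefficients `w`: the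
coordinates with coefficient one at `q` are multiplied by the exponential of the rest of the form,
the others are negligible. -/
noncomputable def singleRay (ξ : Q → Ω → ℝ) (w : ι → Q → ℝ) (q : Q) (ω : Ω) (a : ι) : ℝ :=
  if w a q = 1 then Real.exp (linForm ξ (({q} : Set Q)ᶜ.indicator (w a)) ω) else 0

/-- The event that all variables with index in `F` other than `ξ_q` are at most `K`. -/
def othersLe (ξ : Q → Ω → ℝ) (F : Finset Q) (K : ℝ) (q : Q) : Set Ω :=
  {ω | ∀ p ∈ F, p ≠ q → ξ p ω ≤ K}

lemma measurableSet_othersLe (hξ : ∀ q, Measurable (ξ q)) (F : Finset Q) (K : ℝ) (q : Q) :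
    MeasurableSet (othersLe ξ F K q) := by
  have : othersLe ξ F K q = ⋂ p ∈ F, {ω | p ≠ q → ξ p ω ≤ K} := by
    ext ω; simp [othersLe]
  rw [this]
  refine Finset.measurableSet_biInter _ fun p _ => ?_
  by_cases hp : p = q
  · simp [hp]
  · simpa [hp] using measurableSet_le (hξ p) measurable_const

lemma measurable_singleRay (hξ : ∀ q, Measurable (ξ q)) (w : ι → Q → ℝ) (q : Q) :
    Measurable (singleRay ξ w q) := by
  refine measurable_pi_lambda _ fun a => ?_
  unfold singleRay
  split_ifs
  · exact (measurable_linForm hξ _).exp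
  · exact measurable_const

lemma singleRay_nonneg (w : ι → Q → ℝ) (q : Q) (ω : Ω) (a : ι) : 0 ≤ singleRay ξ w q ω a := by
  unfold singleRay; split_ifs <;> positivity

lemma exp_mul_singleRay {w : ι → Q → ℝ} (hw : ∀ a, IsWeight P ξ (w a)) (q : Q) :
    ∀ᵐ ω ∂P, ∀ a, w a q = 1 →
      Real.exp (ξ q ω) * singleRay ξ w q ω a = Real.exp (linForm ξ (w a) ω) := by
  refine ae_all_iff.2 fun a => ?_
  filter_upwards [linForm_eq_add (hw a) q] with ω hω ha
  rw [singleRay, if_pos ha, ← Real.exp_add, hω, ha, one_mul]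

/-- The ray `singleRay` restricted to the event that the other variables with index in `F` are at
most `K`. -/
noncomputable def truncRay (ξ : Q → Ω → ℝ) (w : ι → Q → ℝ) (F : Finset Q) (K : ℝ) (q : Q) :
    Ω → ι → ℝ :=
  (othersLe ξ F K q).indicator (singleRay ξ w q)

lemma measurable_truncRay (hξ : ∀ q, Measurable (ξ q)) (w : ι → Q → ℝ) (F : Finset Q) (K : ℝ)
    (q : Q) : Measurable (truncRay ξ w F K q) :=
  (measurable_singleRay hξ w q).indicator (measurableSet_othersLe hξ F K q)

lemma truncRay_nonneg (w : ι → Q → ℝ) (F : Finset Q) (K : ℝ) (q : Q) (ω : Ω) (a : ι) :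
    0 ≤ truncRay ξ w F K q ω a := by
  by_cases h : ω ∈ othersLe ξ F K q
  · rw [truncRay, Set.indicator_of_mem h]; exact singleRay_nonneg w q ω a
  · rw [truncRay, Set.indicator_of_notMem h]; exact le_rfl

lemma indepFun_truncRay (hξ : IIDField P ξ ν) (w : ι → Q → ℝ) (F : Finset Q) (K : ℝ) (q : Q) :
    IndepFun (truncRay ξ w F K q) (ξ q) P := by
  classical
  -- the truncated ray as a function of the field off `q`
  set Φ : (Q → ℝ) → ι → ℝ := othersLe (fun p (x : Q → ℝ) => x p) F K q |>.indicator
    fun x a => if w a q = 1 then Real.exp (∑' p, w a p * x p) else 0 with hΦ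
  have hΦm : Measurable Φ := by
    refine Measurable.indicator ?_ (measurableSet_othersLe (fun p => measurable_pi_apply p) F K q)
    refine measurable_pi_lambda _ fun a => ?_
    split_ifs
    · exact (measurable_tsum_mul (w a)).exp
    · exact measurable_const
  refine (indepFun_linForm_compl_single hξ q hΦm).congr (ae_of_all _ fun ω => ?_)
    (ae_of_all _ fun _ => rfl)
  have hmem : (({q} : Set Q)ᶜ.indicator fun q => ξ q ω) ∈ othersLe (fun p (x : Q → ℝ) => x p) F K q
      ↔ ω ∈ othersLe ξ F K q := by
    refine forall₃_congr fun p _ hp => ?_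
    show (({q} : Set Q)ᶜ.indicator fun q => ξ q ω) p ≤ K ↔ ξ p ω ≤ K
    rw [Set.indicator_of_mem (by simpa using hp)]
  show Φ _ = _
  by_cases h : ω ∈ othersLe ξ F K q
  · rw [hΦ, truncRay, Set.indicator_of_mem h, Set.indicator_of_mem (hmem.2 h)]
    ext a
    rw [singleRay, linForm_indicator_eq]
  · rw [hΦ, truncRay, Set.indicator_of_notMem h, Set.indicator_of_notMem (fun h' => h (hmem.1 h'))]

lemma integrable_singleRay_rpow (hξ : IIDField P ξ ν) {γ : ℝ} (hγ : 0 < γ)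
    (hint : Integrable (fun x => Real.exp (γ * x)) ν) {w : ι → Q → ℝ}
    (hw : ∀ a, IsWeight P ξ (w a)) (q : Q) (a : ι) :
    Integrable (fun ω => singleRay ξ w q ω a ^ γ) P := by
  unfold singleRay
  split_ifs
  · simp only [← Real.exp_mul, mul_comm _ γ]
    exact integrable_exp_linForm hξ ((hw a).indicator _) hγ.le
      (lintegral_exp_posPart_lt_top_of_integrable hint)
  · simp only [Real.zero_rpow hγ.ne']
    exact integrable_const _

lemma exists_integrable_truncRay_rpow (hξ : IIDField P ξ ν) {γ : ℝ} (hγ : 0 < γ)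
    (hν : ExpVarying (fun u => ν.real (Set.Ioi u)) γ) {w : ι → Q → ℝ}
    (hw : ∀ a, IsWeight P ξ (w a)) {F : Finset Q} {θ : ℝ} (hθ0 : 0 ≤ θ) (hθ1 : θ < 1)
    (hθ : ∀ a, ∀ q ∉ F, w a q ≤ θ) :
    ∃ b, γ < b ∧ ∀ K, 0 ≤ K → ∀ q ∈ F, ∀ a, Integrable (fun ω => truncRay ξ w F K q ω a ^ b) P := by
  classical
  obtain ⟨b, hb, hmom⟩ := exists_integrable_exp_linForm hξ hγ hν hθ1
  have hb0 := hγ.trans hb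
  refine ⟨b, hb, fun K hK q hq a => ?_⟩
  have h1 := (hmom _ ((hw a).indicator (F : Set Q)ᶜ) (indicator_compl_le hθ0 (hθ a))).const_mul
    (Real.exp (b * ((F.erase q).card * K)))
  have hm := measurable_pi_iff.1 (measurable_truncRay hξ.meas w F K q) a
  refine h1.mono' (hm.pow_const b).aestronglyMeasurable ?_
  filter_upwards [linForm_le_of_forall_le ((hw a).indicator ({q} : Set Q)ᶜ) (F.erase q) hK] with ω h
  rw [Real.norm_of_nonneg (Real.rpow_nonneg (truncRay_nonneg w F K q ω a) b), ← Real.exp_add]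
  by_cases hω : ω ∈ othersLe ξ F K q
  · rw [truncRay, Set.indicator_of_mem hω, singleRay]
    split_ifs
    · have h2 := h fun p hp => hω p (Finset.mem_of_mem_erase hp) (Finset.ne_of_mem_erase hp)
      have hset : ((F.erase q : Finset Q) : Set Q)ᶜ ∩ ({q} : Set Q)ᶜ = (F : Set Q)ᶜ := by
        ext p
        by_cases hp : p = q
        · subst hp; simp [hq]
        · simp [hp]
      rw [Set.indicator_indicator, hset] at h2
      rw [← Real.exp_mul, ← mul_add, mul_comm _ b]
      gcongr
    · rw [Real.zero_rpow hb0.ne']; positivity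
  · rw [truncRay, Set.indicator_of_notMem hω, Pi.zero_apply, Real.zero_rpow hb0.ne']; positivity

/-- Integrals over the truncated rays converge as the truncation level tends to infinity. -/
lemma tendsto_integral_truncRay (hξ : ∀ q, Measurable (ξ q)) (w : ι → Q → ℝ) (F : Finset Q)
    (q : Q) {φ : (ι → ℝ) → ℝ} (hφ : Measurable φ) (hφ0 : φ 0 = 0)
    (hi : Integrable (fun ω => φ (singleRay ξ w q ω)) P) :
    Tendsto (fun K => ∫ ω, φ (truncRay ξ w F K q ω) ∂P) atTop
      (𝓝 (∫ ω, φ (singleRay ξ w q ω) ∂P)) := by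
  refine tendsto_integral_filter_of_dominated_convergence (fun ω => |φ (singleRay ξ w q ω)|)
    (Eventually.of_forall fun K => (hφ.comp (measurable_truncRay hξ w F K q)).aestronglyMeasurable)
    (Eventually.of_forall fun K => ae_of_all _ fun ω => ?_) hi.abs (ae_of_all _ fun ω => ?_)
  · by_cases h : ω ∈ othersLe ξ F K q
    · rw [truncRay, Set.indicator_of_mem h]; exact le_rfl
    · rw [truncRay, Set.indicator_of_notMem h, hφ0, norm_zero]; exact abs_nonneg _
  · refine tendsto_const_nhds.congr' ?_
    filter_upwards [eventually_ge_atTop (∑ p ∈ F, |ξ p ω|)] with K hK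
    have h : ω ∈ othersLe ξ F K q := fun p hp _ => (le_abs_self _).trans
      ((Finset.single_le_sum (f := fun p => |ξ p ω|) (fun p _ => abs_nonneg _) hp).trans hK)
    rw [truncRay, Set.indicator_of_mem h]

/-- The event that exactly one of the variables with index in `F` exceeds `K`. -/
def exactlyOne (ξ : Q → Ω → ℝ) (F : Finset Q) (K : ℝ) : Set Ω :=
  ⋃ q ∈ F, othersLe ξ F K q ∩ {ω | K < ξ q ω}

lemma measurableSet_exactlyOne (hξ : ∀ q, Measurable (ξ q)) (F : Finset Q) (K : ℝ) :
    MeasurableSet (exactlyOne ξ F K) :=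
  Finset.measurableSet_biUnion _ fun q _ =>
    (measurableSet_othersLe hξ F K q).inter (measurableSet_lt measurable_const (hξ q))

/-- The contribution of a single variable `ξ_q` with coefficient one to the tail of a linear form,
while the other variables with index in `F` are bounded. -/
lemma tendsto_tail_truncRay (hξ : IIDField P ξ ν) {γ : ℝ} (hγ : 0 < γ)
    (hν : ExpVarying (fun u => ν.real (Set.Ioi u)) γ) {w : ι → Q → ℝ}
    (hw : ∀ a, IsWeight P ξ (w a)) {F : Finset Q} {b : ℝ} (hb : γ < b) {K : ℝ} {q : Q}
    (hmom : ∀ a, Integrable (fun ω => truncRay ξ w F K q ω a ^ b) P) {a : ι} (ha : w a q = 1) :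
    Tendsto (fun u => P.real ({ω | u < linForm ξ (w a) ω} ∩ othersLe ξ F K q) /
      ν.real (Set.Ioi u)) atTop (𝓝 (∫ ω, truncRay ξ w F K q ω a ^ γ ∂P)) := by
  have hS : MeasurableSet {v : ι → ℝ | 1 < v a} :=
    measurableSet_lt measurable_const (measurable_pi_apply _)
  have hlaw : ∀ u, P.real {ω | u < ξ q ω} = ν.real (Set.Ioi u) := fun u => by
    rw [← hξ.law q, map_measureReal_apply (hξ.meas q) measurableSet_Ioi]; rfl
  have h := tendsto_integral_exp_mul (hξ.meas q) (measurable_truncRay hξ.meas w F K q)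
    (indepFun_truncRay hξ w F K q) hν hlaw hγ hb (fun a => by
      simpa only [abs_of_nonneg (truncRay_nonneg w F K q _ a)] using hmom a)
    (g := {v : ι → ℝ | 1 < v a}.indicator fun _ => 1) (measurable_const.indicator hS)
    (C := 1) (ε := 1) (fun v => by
      simp only [Set.indicator_apply]; split_ifs <;> simp) one_pos
    (fun v hv => Set.indicator_of_notMem (by
      simpa using (le_abs_self _).trans (hv a)) _)
    (K := fun r => (max (r a) 0) ^ γ) (fun r => by
      rw [hξ.law q]
      exact tendsto_coord_indicator hγ hν a r)
  simp only [max_eq_left (truncRay_nonneg w F K q _ a)] at h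
  refine h.congr fun u => ?_
  congr 1
  rw [← integral_indicator_one ((measurableSet_lt measurable_const
    (measurable_linForm hξ.meas _)).inter (measurableSet_othersLe hξ.meas F K q))]
  refine integral_congr_ae ?_
  filter_upwards [exp_mul_singleRay hw q] with ω hω
  have : ((fun a => Real.exp (ξ q ω - u) * truncRay ξ w F K q ω a) ∈ {v : ι → ℝ | 1 < v a}) ↔
      ω ∈ {ω | u < linForm ξ (w a) ω} ∩ othersLe ξ F K q := by
    by_cases hmem : ω ∈ othersLe ξ F K q
    · have h1 : Real.exp (ξ q ω - u) * singleRay ξ w q ω a =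
          Real.exp (linForm ξ (w a) ω - u) := by
        rw [Real.exp_sub, Real.exp_sub, ← hω a ha]; ring
      simp only [Set.mem_ofPred_eq, truncRay, Set.indicator_of_mem hmem, Set.mem_inter_iff, hmem,
        and_true, h1, Real.one_lt_exp_iff, sub_pos]
    · simp [truncRay, hmem]
  by_cases hm : ω ∈ {ω | u < linForm ξ (w a) ω} ∩ othersLe ξ F K q
  · rw [Set.indicator_of_mem hm, Set.indicator_of_mem (this.2 hm)]; rfl
  · rw [Set.indicator_of_notMem hm, Set.indicator_of_notMem fun h' => hm (this.1 h')]

/-- A linear form of convolution equivalent variables is large, without exactly one of the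
variables with index in `F` being large, only with negligible probability. This follows from the
comparison of the tail with the contributions of the single large variables. -/
lemma tail_not_exactlyOne_le (hξ : IIDField P ξ ν) {γ : ℝ} (hγ : 0 < γ)
    (hν : ExpVarying (fun u => ν.real (Set.Ioi u)) γ)
    (hint : Integrable (fun x => Real.exp (γ * x)) ν)
    (hboth : ∀ ε > 0, ∀ᶠ K in atTop, ∀ᶠ u in atTop, bothLarge ν ν K u ≤ ε * ν.real (Set.Ioi u))
    {w : ι → Q → ℝ} (hw : ∀ a, IsWeight P ξ (w a)) {F : Finset Q} {θ : ℝ} (hθ0 : 0 ≤ θ)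
    (hθ1 : θ < 1) (hθ : ∀ a, ∀ q ∉ F, w a q ≤ θ) (a : ι) {Fa : Finset Q} (hFa : Fa ⊆ F)
    (hFa1 : ∀ q, q ∈ Fa ↔ w a q = 1) (s : ℝ) {η : ℝ} (hη : 0 < η) :
    ∀ᶠ K in atTop, ∀ᶠ u in atTop,
      P.real ({ω | u + s < linForm ξ (w a) ω} ∩ (exactlyOne ξ F K)ᶜ) ≤ η * ν.real (Set.Ioi u) := by
  classical
  obtain ⟨b, hb, hmom⟩ := exists_integrable_truncRay_rpow hξ hγ hν hw hθ0 hθ1 hθ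
  set L := linForm ξ (w a) with hL
  have hLm : Measurable L := measurable_linForm hξ.meas _
  have hlimK : Tendsto (fun K => ((∑ q ∈ Fa, ∫ ω, singleRay ξ w q ω a ^ γ ∂P) -
      ∑ q ∈ Fa, ∫ ω, truncRay ξ w F K q ω a ^ γ ∂P) * Real.exp (-(γ * s))) atTop (𝓝 0) := by
    have h1 := tendsto_finsetSum Fa fun q _ => tendsto_integral_truncRay hξ.meas w F q
      (φ := fun r => r a ^ γ) ((measurable_pi_apply a).pow_const γ)
      (by simp [Real.zero_rpow hγ.ne'])
      (integrable_singleRay_rpow hξ hγ hint hw q a)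
    simpa using (h1.const_sub (∑ q ∈ Fa, ∫ ω, singleRay ξ w q ω a ^ γ ∂P)).mul_const
      (Real.exp (-(γ * s)))
  filter_upwards [hlimK.eventually_lt_const hη, eventually_ge_atTop 0] with K hK hK0
  -- the tail, the contributions of the single large variables, and the event that all are small
  have h1 : Tendsto (fun u => P.real {ω | u < L ω} / ν.real (Set.Ioi u)) atTop
      (𝓝 (∑ q ∈ Fa, ∫ ω, singleRay ξ w q ω a ^ γ ∂P)) := by
    have h := tendsto_tail_linForm hξ hγ hν hint hboth (hw a) hFa1
    have hc : ∀ q ∈ Fa, ∫ ω, Real.exp (γ * linForm ξ (({q} : Set Q)ᶜ.indicator (w a)) ω) ∂P =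
        ∫ ω, singleRay ξ w q ω a ^ γ ∂P := by
      intro q hq
      congr 1 with ω
      rw [singleRay, if_pos ((hFa1 q).1 hq), ← Real.exp_mul, mul_comm]
    rwa [Finset.sum_congr rfl hc] at h
  have h2 : Tendsto (fun u => ∑ q ∈ Fa, P.real ({ω | u < L ω} ∩ othersLe ξ F K q) /
      ν.real (Set.Ioi u)) atTop (𝓝 (∑ q ∈ Fa, ∫ ω, truncRay ξ w F K q ω a ^ γ ∂P)) :=
    tendsto_finsetSum _ fun q hq => tendsto_tail_truncRay hξ hγ hν hw hb
      (fun a => hmom K hK0 q (hFa hq) a) ((hFa1 q).1 hq)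
  have h3 := (tendsto_tail_truncated hξ hγ hν (hw a) F hθ0 hθ1 (hθ a) hK0).const_mul (Fa.card : ℝ)
  rw [mul_zero] at h3
  have h4 := (h1.sub h2).add h3
  rw [add_zero] at h4
  have h5 := hν.tendsto_div_shift (T := fun u => P.real {ω | u < L ω} -
    (∑ q ∈ Fa, P.real ({ω | u < L ω} ∩ othersLe ξ F K q)) +
    Fa.card * P.real {ω | u < L ω ∧ ∀ q ∈ F, ξ q ω ≤ K}) (by
      refine h4.congr fun u => ?_
      rw [← Finset.sum_div, ← sub_div, ← mul_div_assoc, ← add_div]) s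
  filter_upwards [h5.eventually_lt_const hK] with u hu
  rw [div_lt_iff₀ (hν.pos u)] at hu
  refine le_trans ?_ hu.le
  set A : Set Ω := {ω | u + s < L ω} with hA
  have hAm : MeasurableSet A := measurableSet_lt measurable_const hLm
  set D : Q → Set Ω := fun q => A ∩ (othersLe ξ F K q ∩ {ω | K < ξ q ω}) with hD
  have hDm : ∀ q, MeasurableSet (D q) := fun q => hAm.inter
    ((measurableSet_othersLe hξ.meas F K q).inter (measurableSet_lt measurable_const (hξ.meas q)))
  have hdisj : Set.PairwiseDisjoint (Fa : Set Q) D := by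
    intro p hp q _ hpq
    rw [Function.onFun, Set.disjoint_left]
    rintro ω ⟨_, _, h6⟩ ⟨_, h7, _⟩
    exact absurd (h7 p (hFa hp) hpq) (not_le.2 h6)
  have hdisj' : Disjoint (A ∩ (exactlyOne ξ F K)ᶜ) (⋃ q ∈ Fa, D q) := by
    rw [Set.disjoint_left]
    rintro ω ⟨_, h6⟩ h7
    obtain ⟨q, hq, h8⟩ := Set.mem_iUnion₂.1 h7
    exact h6 (Set.mem_iUnion₂.2 ⟨q, hFa hq, h8.2⟩)
  have hsum : P.real (A ∩ (exactlyOne ξ F K)ᶜ) + ∑ q ∈ Fa, P.real (D q) ≤ P.real A := by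
    rw [← measureReal_biUnion_finset hdisj fun q _ => hDm q,
      ← measureReal_union hdisj' (Finset.measurableSet_biUnion _ fun q _ => hDm q)
        (measure_ne_top _ _) (measure_ne_top _ _)]
    refine measureReal_mono (Set.union_subset Set.inter_subset_left ?_)
    exact Set.iUnion₂_subset fun q _ => Set.inter_subset_left
  have hDq : ∀ q ∈ Fa, P.real (A ∩ othersLe ξ F K q) ≤
      P.real (D q) + P.real {ω | u + s < L ω ∧ ∀ q ∈ F, ξ q ω ≤ K} := by
    intro q hq
    refine le_trans (measureReal_mono ?_) (measureReal_union_le _ _)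
    rintro ω ⟨h6, h7⟩
    by_cases h8 : K < ξ q ω
    · exact Or.inl ⟨h6, h7, h8⟩
    · refine Or.inr ⟨h6, fun p hp => ?_⟩
      by_cases hpq : p = q
      · rw [hpq]; exact not_lt.1 h8
      · exact h7 p hp hpq
  have hsum' := Finset.sum_le_sum hDq
  rw [Finset.sum_add_distrib, Finset.sum_const, nsmul_eq_mul] at hsum'
  linarith

/-- The limit of a vector of linear forms of convolution equivalent variables: a large value is
caused by a single large variable, with coefficient one. -/
theorem isLimitFamily_of_convolution (hξ : IIDField P ξ ν) {γ : ℝ} (hγ : 0 < γ)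
    (hν : ExpVarying (fun u => ν.real (Set.Ioi u)) γ)
    (hint : Integrable (fun x => Real.exp (γ * x)) ν)
    (hboth : ∀ ε > 0, ∀ᶠ K in atTop, ∀ᶠ u in atTop, bothLarge ν ν K u ≤ ε * ν.real (Set.Ioi u))
    {w : ι → Q → ℝ} (hw : ∀ a, IsWeight P ξ (w a)) {F : ι → Finset Q}
    (hF : ∀ a q, q ∈ F a ↔ w a q = 1) {a₀ : ι} (hF₀ : 1 ≤ (F a₀).card) :
    ∃ (J : Finset Q) (R : Q → Ω → ι → ℝ), IsLimitFamily P (fun a => linForm ξ (w a))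
      (fun u => ν.real (Set.Ioi u)) γ J R a₀ := by
  classical
  have : Nonempty ι := ⟨a₀⟩
  obtain ⟨θ, hθ0, hθ1, hθ⟩ := exists_lt_one_of_family hw hF
  set J : Finset Q := Finset.univ.biUnion F with hJ
  have hFJ : ∀ a, F a ⊆ J := fun a => Finset.subset_biUnion_of_mem F (Finset.mem_univ a)
  have hθJ : ∀ a, ∀ q ∉ J, w a q ≤ θ := fun a q hq => hθ a q fun h => hq (hFJ a h)
  obtain ⟨b, hb, hmom⟩ := exists_integrable_truncRay_rpow hξ hγ hν hw hθ0 hθ1 hθJ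
  have hLm : ∀ a, Measurable (linForm ξ (w a)) := fun a => measurable_linForm hξ.meas _
  have hlaw : ∀ q u, P.real {ω | u < ξ q ω} = ν.real (Set.Ioi u) := fun q u => by
    rw [← hξ.law q, map_measureReal_apply (hξ.meas q) measurableSet_Ioi]; rfl
  refine ⟨J, singleRay ξ w, hν, measurable_singleRay hξ.meas w, singleRay_nonneg w,
    fun q _ a => integrable_singleRay_rpow hξ hγ hint hw q a, ?_, fun g hg => ?_⟩
  · obtain ⟨q, hq⟩ := Finset.card_pos.1 hF₀
    refine ⟨q, hFJ a₀ hq, fun ω => ?_⟩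
    rw [singleRay, if_pos ((hF a₀ q).1 hq)]; exact Real.exp_pos _
  obtain ⟨C, hC⟩ := hg.bdd
  obtain ⟨ε, hε, hg0⟩ := hg.vanish
  have hC0 : 0 ≤ C := (abs_nonneg _).trans (hC 0)
  refine tendsto_of_approx fun κ hκ => ?_
  obtain ⟨η, hη0, hη⟩ : ∃ η > 0, (1 + (J.card : ℝ)) * C * η < κ := by
    refine ⟨κ / ((1 + (J.card : ℝ)) * C + 1), by positivity, ?_⟩
    rw [← mul_div_assoc, div_lt_iff₀ (by positivity)]
    nlinarith
  have hlimK : Tendsto (fun K => ∑ q ∈ J, ∫ ω, rayIntegral γ g (truncRay ξ w J K q ω) ∂P) atTop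
      (𝓝 (∑ q ∈ J, ∫ ω, rayIntegral γ g (singleRay ξ w q ω) ∂P)) := by
    refine tendsto_finsetSum _ fun q _ => tendsto_integral_truncRay hξ.meas w J q
      (measurable_rayIntegral hg.cont γ) ?_ (integrable_rayIntegral hγ hg
        (measurable_singleRay hξ.meas w q) (singleRay_nonneg w q)
        (integrable_singleRay_rpow hξ hγ hint hw q))
    have : ∀ s : ℝ, g (fun a => Real.exp s * (0 : ι → ℝ) a) = 0 := fun s =>
      hg0 _ fun a => by simp [hε.le]
    unfold rayIntegral
    simp_rw [this]
    simp
  have hcard : (0 : ℝ) < 2 * Fintype.card ι := by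
    have := Fintype.card_pos (α := ι); positivity
  obtain ⟨K, hK1, hK2, hK0⟩ := ((Metric.tendsto_nhds.1 hlimK κ hκ).and ((eventually_all.2 fun a =>
    tail_not_exactlyOne_le hξ hγ hν hint hboth hw hθ0 hθ1 hθJ a (hFJ a) (hF a) (Real.log ε)
      (η := η / (2 * Fintype.card ι)) (by positivity)).and (eventually_ge_atTop 0))).exists
  refine ⟨fun u => ∑ q ∈ J, (∫ ω, g (fun a => Real.exp (ξ q ω - u) * truncRay ξ w J K q ω a) ∂P) /
    ν.real (Set.Ioi u), _, tendsto_finsetSum _ fun q hq => ?_, hK1.le, ?_⟩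
  · refine tendsto_integral_exp_mul (hξ.meas q) (measurable_truncRay hξ.meas w J K q)
      (indepFun_truncRay hξ w J K q) hν (hlaw q) hγ hb ?_ hg.cont.measurable hC hε hg0
      (K := rayIntegral γ g) fun r => ?_
    · intro a
      simpa only [abs_of_nonneg (truncRay_nonneg w J K q _ a)] using hmom K hK0 q hq a
    · rw [hξ.law q]; exact tendsto_ray hγ hν hg r
  have hmain := eventually_abs_integral_sub_sum_le (L := fun a => linForm ξ (w a)) hLm hν
    (fun a => ⟨_, tendsto_tail_linForm hξ hγ hν hint hboth (hw a) (hF a)⟩)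
    (J := J) (G := fun q => {a | q ∈ F a}) (B := ξ) (R := truncRay ξ w J K) hξ.meas
    (measurable_truncRay hξ.meas w J K) ?_ hg hC hε hg0 hη ?_
  · filter_upwards [hmain] with u hu
    rw [← Finset.sum_div, ← sub_div, abs_div, abs_of_pos (hν.pos u), div_le_iff₀ (hν.pos u)]
    exact hu
  · intro q _
    filter_upwards [exp_mul_singleRay hw q] with ω hω a
    by_cases hmem : ω ∈ othersLe ξ J K q
    · rw [truncRay, Set.indicator_of_mem hmem]
      by_cases ha : w a q = 1
      · exact Or.inr (hω a ha)
      · left; rw [singleRay, if_neg ha]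
    · left; rw [truncRay, Set.indicator_of_notMem hmem]; rfl
  · intro δ hδ hδε
    set S₁ : ι → ℝ → Set Ω := fun a u =>
      {ω | u + Real.log ε < linForm ξ (w a) ω} ∩ (exactlyOne ξ J K)ᶜ with hS₁
    set T : Finset (Q × ι) := (J ×ˢ Finset.univ).filter fun p => p.1 ∉ F p.2 with hT
    set S₂ : Q × ι → ℝ → Set Ω := fun p u =>
      {ω | u + Real.log δ < linForm ξ (w p.2) ω} ∩ othersLe ξ J K p.1 with hS₂
    have hS₁m : ∀ a u, MeasurableSet (S₁ a u) := fun a u =>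
      (measurableSet_lt measurable_const (hLm a)).inter (measurableSet_exactlyOne hξ.meas J K).compl
    have hS₂m : ∀ p u, MeasurableSet (S₂ p u) := fun p u =>
      (measurableSet_lt measurable_const (hLm p.2)).inter (measurableSet_othersLe hξ.meas J K p.1)
    refine ⟨fun u => (⋃ a ∈ (Finset.univ : Finset ι), S₁ a u) ∪ ⋃ p ∈ T, S₂ p u, fun u =>
      (Finset.measurableSet_biUnion _ fun a _ => hS₁m a u).union
        (Finset.measurableSet_biUnion _ fun p _ => hS₂m p u), ?_, ?_⟩
    · have hp : ∀ p ∈ T, Tendsto (fun u => P.real (S₂ p u) / ν.real (Set.Ioi u)) atTop (𝓝 0) := by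
        intro p hp
        obtain ⟨hp1, hp2⟩ := Finset.mem_filter.1 hp
        have h1 := tendsto_tail_truncated hξ hγ hν (hw p.2) (J.erase p.1) hθ0 hθ1 (fun q hq => by
          by_cases hqp : q = p.1
          · rw [hqp]; exact hθ p.2 p.1 hp2
          · exact hθJ p.2 q fun h => hq (Finset.mem_erase.2 ⟨hqp, h⟩)) hK0
        have h2 := hν.tendsto_div_shift h1 (Real.log δ)
        rw [zero_mul] at h2
        refine squeeze_zero (fun u => div_nonneg measureReal_nonneg (hν.pos u).le) (fun u => ?_) h2
        refine div_le_div_of_nonneg_right (measureReal_mono ?_) (hν.pos u).le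
        rintro ω ⟨h3, h4⟩
        exact ⟨h3, fun q hq => h4 q (Finset.mem_of_mem_erase hq) (Finset.ne_of_mem_erase hq)⟩
      have hsum := tendsto_finsetSum T hp
      rw [Finset.sum_const_zero] at hsum
      filter_upwards [hsum.eventually_lt_const (half_pos hη0), eventually_all.2 hK2] with u hu hu'
      rw [← Finset.sum_div, div_lt_iff₀ (hν.pos u)] at hu
      have h1 : P.real (⋃ a ∈ (Finset.univ : Finset ι), S₁ a u) ≤ η / 2 * ν.real (Set.Ioi u) := by
        refine (measureReal_biUnion_finset_le _ _).trans ?_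
        refine (Finset.sum_le_sum fun a _ => hu' a).trans_eq ?_
        rw [Finset.sum_const, Finset.card_univ, nsmul_eq_mul]
        field_simp
      have h2 : P.real (⋃ p ∈ T, S₂ p u) ≤ η / 2 * ν.real (Set.Ioi u) :=
        (measureReal_biUnion_finset_le _ _).trans hu.le
      refine (measureReal_union_le _ _).trans ?_
      linarith
    · refine Eventually.of_forall fun u => ?_
      filter_upwards [(ae_ball_iff J.countable_toSet).2 fun q (_ : q ∈ (J : Set Q)) =>
        exp_mul_singleRay hw q] with ω hω hex hωS
      rw [Set.mem_union, not_or] at hωS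
      obtain ⟨a, ha⟩ := hex
      have hone : ω ∈ exactlyOne ξ J K := by
        by_contra h
        exact hωS.1 (Set.mem_biUnion (x := a) (Finset.mem_univ a) ⟨ha, h⟩)
      obtain ⟨q₀, hq₀, hmem, hlarge⟩ := Set.mem_iUnion₂.1 hone
      have hR : truncRay ξ w J K q₀ ω = singleRay ξ w q₀ ω := by
        rw [truncRay, Set.indicator_of_mem hmem]
      refine ⟨q₀, hq₀, fun d hd => ?_, fun d hd => ⟨?_, ?_⟩, fun q _ hne d => Or.inl ?_⟩
      · rw [hR]; exact hω q₀ hq₀ d ((hF d q₀).1 hd)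
      · rw [hR, singleRay, if_neg fun h => hd ((hF d q₀).2 h)]
      · by_contra! h
        exact hωS.2 (Set.mem_biUnion (x := (q₀, d)) (Finset.mem_filter.2
          ⟨Finset.mem_product.2 ⟨hq₀, Finset.mem_univ d⟩, hd⟩) ⟨h, hmem⟩)
      · have : ω ∉ othersLe ξ J K q := fun h =>
          absurd (h q₀ hq₀ hne.symm) (not_le.2 hlarge)
        rw [truncRay, Set.indicator_of_notMem this]; rfl

end

/-! ### The limit measure on the punctured space -/

section

variable {Ω : Type*} [MeasurableSpace Ω] {P : Measure Ω} [IsProbabilityMeasure P]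
  {ι : Type*} [Fintype ι]

/-- The embedding of `ℝ^ι` into `[-∞, ∞]^ι`. -/
noncomputable def toEReal (v : ι → ℝ) (a : ι) : EReal := (v a : EReal)

lemma continuous_toEReal : Continuous (toEReal : (ι → ℝ) → ι → EReal) :=
  continuous_pi fun a => continuous_coe_real_ereal.comp (continuous_apply a)

lemma measurable_toEReal : Measurable (toEReal : (ι → ℝ) → ι → EReal) :=
  measurable_pi_lambda _ fun a => measurable_coe_real_ereal.comp (measurable_pi_apply a)

/-- The extension of `f` by zero from the punctured space to `[-∞, ∞]^ι`. -/
noncomputable def zeroExtend (f : Punctured ι → ℝ) : (ι → EReal) → ℝ :=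
  Function.extend Subtype.val f 0

lemma zeroExtend_coe (f : Punctured ι → ℝ) (y : Punctured ι) : zeroExtend f y.1 = f y :=
  Subtype.val_injective.extend_apply f 0 y

lemma zeroExtend_zero (f : Punctured ι → ℝ) : zeroExtend f 0 = 0 :=
  Function.extend_apply' _ _ _ fun ⟨y, hy⟩ => y.2 hy

lemma continuous_zeroExtend (f : C_c(Punctured ι, ℝ)) : Continuous (zeroExtend f) :=
  HasCompactSupport.continuous_extend_zero (U := {x : ι → EReal | x ≠ 0}) isOpen_ne f.continuous
    f.hasCompactSupport

/-- Compact subsets of the punctured space stay away from the origin. -/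
lemma exists_forall_notMem_of_isCompact {K : Set (Punctured ι)} (hK : IsCompact K) :
    ∃ ε > 0, ∀ v : ι → ℝ, (∀ a, |v a| ≤ ε) → toEReal v ∉ Subtype.val '' K := by
  have hc : IsClosed (Subtype.val '' K) := (hK.image continuous_subtype_val).isClosed
  have h0 : toEReal (0 : ι → ℝ) ∉ Subtype.val '' K := by
    rintro ⟨y, _, hy⟩
    exact y.2 (hy.trans (by ext a; simp [toEReal]))
  obtain ⟨ε, hε, h⟩ := Metric.eventually_nhds_iff.1
    (continuous_toEReal.continuousAt.eventually (hc.isOpen_compl.mem_nhds h0))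
  refine ⟨ε / 2, half_pos hε, fun v hv => h ?_⟩
  rw [dist_zero_right]
  exact ((pi_norm_le_iff_of_nonneg (half_pos hε).le).2 hv).trans_lt (half_lt_self hε)

/-- Continuous functions with compact support in the punctured space are test functions. -/
lemma testFn_zeroExtend (f : C_c(Punctured ι, ℝ)) : TestFn fun v => zeroExtend f (toEReal v) where
  cont := (continuous_zeroExtend f).comp continuous_toEReal
  bdd := by
    obtain ⟨C, hC⟩ := isCompact_univ.exists_bound_of_continuousOn
      (continuous_zeroExtend f).continuousOn
    exact ⟨C, fun v => hC _ (Set.mem_univ _)⟩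
  vanish := by
    obtain ⟨ε, hε, h⟩ := exists_forall_notMem_of_isCompact f.hasCompactSupport.isCompact
    refine ⟨ε, hε, fun v hv => ?_⟩
    by_contra hne
    by_cases h0 : toEReal v = 0
    · rw [h0] at hne; exact hne (zeroExtend_zero f)
    · refine h v hv ⟨⟨toEReal v, h0⟩, subset_tsupport _ ?_, rfl⟩
      rw [Function.mem_support, ← zeroExtend_coe f]
      exact hne
  trunc := by
    classical
    intro G κ hκ
    by_contra! hcon
    -- a sequence of counterexamples has a limit point, by compactness of `[-∞, ∞]^ι`
    choose v hv hgv using fun n : ℕ => hcon (1 / ((n : ℝ) + 1)) (by positivity)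
    obtain ⟨y, φ, hφ, hy⟩ := CompactSpace.tendsto_subseq fun n => toEReal (v n)
    have hF := continuous_zeroExtend f
    have hy0 : ∀ a ∉ G, y a = 0 := by
      intro a ha
      have h1 : Tendsto (fun n => v n a) atTop (𝓝 0) :=
        squeeze_zero_norm (fun n => hv n a ha) tendsto_one_div_add_atTop_nhds_zero_nat
      have h2 := (continuous_coe_real_ereal.tendsto 0).comp (h1.comp hφ.tendsto_atTop)
      exact tendsto_nhds_unique ((tendsto_pi_nhds.1 hy) a) h2
    set T : (ι → EReal) → ι → EReal := fun y a => if a ∈ G then y a else 0 with hT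
    have hTc : Continuous T := by
      refine continuous_pi fun a => ?_
      by_cases ha : a ∈ G
      · simpa [hT, ha] using continuous_apply a
      · simpa [hT, ha] using continuous_const
    have hTy : T y = y := by
      ext a
      by_cases ha : a ∈ G
      · simp [hT, ha]
      · simp [hT, ha, hy0 a ha]
    have hTv : ∀ v : ι → ℝ, toEReal (G.indicator v) = T (toEReal v) := by
      intro v; ext a
      by_cases ha : a ∈ G <;> simp [hT, ha, toEReal]
    have h3 : Tendsto (fun n => |zeroExtend f (toEReal (v (φ n))) -
        zeroExtend f (T (toEReal (v (φ n))))|) atTop (𝓝 0) := by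
      have h4 := ((hF.tendsto y).comp hy).sub ((hF.tendsto (T y)).comp ((hTc.tendsto y).comp hy))
      rw [hTy, sub_self] at h4
      simpa using h4.abs
    obtain ⟨n, hn⟩ := (h3.eventually_lt_const hκ).exists
    have h5 := hgv (φ n)
    rw [hTv] at h5
    exact lt_asymm hn h5

lemma measurableSet_ne_zero : MeasurableSet {x : ι → EReal | x ≠ 0} := isOpen_ne.measurableSet

lemma comap_coe_apply (m : Measure (ι → EReal)) (B : Set (Punctured ι)) :
    m.comap (Subtype.val : Punctured ι → ι → EReal) B = m (Subtype.val '' B) :=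
  (MeasurableEmbedding.subtype_coe measurableSet_ne_zero).comap_apply m B

lemma integral_comap_coe (m : Measure (ι → EReal)) (f : Punctured ι → ℝ) :
    ∫ y, f y ∂(m.comap (Subtype.val : Punctured ι → ι → EReal)) = ∫ y, zeroExtend f y ∂m := by
  have he : MeasurableEmbedding (Subtype.val : Punctured ι → ι → EReal) :=
    MeasurableEmbedding.subtype_coe measurableSet_ne_zero
  rw [← setIntegral_eq_integral_of_forall_compl_eq_zero
    (s := Set.range (Subtype.val : Punctured ι → ι → EReal)), ← he.map_comap]
  · rw [he.integral_map]
    exact integral_congr_ae (ae_of_all _ fun y => (zeroExtend_coe f y).symm)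
  · intro y hy
    exact Function.extend_apply' _ _ _ hy

lemma integral_scaledLaw {V : Ω → ι → ℝ} (hV : Measurable V) (f : C_c(Punctured ι, ℝ)) (x : ℝ) :
    ∫ y, f y ∂(scaledLaw P V x) = ∫ ω, zeroExtend f (toEReal (fun a => x⁻¹ * V ω a)) ∂P := by
  rw [scaledLaw, integral_comap_coe, integral_map]
  · rfl
  · refine (measurable_toEReal.comp (?_ : Measurable fun ω a => x⁻¹ * V ω a)).aemeasurable
    exact measurable_pi_lambda _ fun a => (measurable_pi_iff.1 hV a).const_mul _
  · exact (continuous_zeroExtend f).aestronglyMeasurable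

/-- The radial measure is multiplied by `exp (-γ b)` under a translation by `b`. -/
lemma expDensity_preimage_sub (γ b : ℝ) {A : Set ℝ} (hA : MeasurableSet A) :
    expDensity γ ((fun s => s - b) ⁻¹' A) =
      ENNReal.ofReal (Real.exp (-(γ * b))) * expDensity γ A := by
  have hA' : MeasurableSet ((fun s : ℝ => s - b) ⁻¹' A) := measurable_sub_const b hA
  rw [expDensity, withDensity_apply _ hA, withDensity_apply _ hA', ← lintegral_indicator hA,
    ← lintegral_indicator hA', ← lintegral_const_mul _ (Measurable.indicator (by fun_prop) hA)]
  refine Eq.trans (lintegral_congr fun s => ?_) (lintegral_sub_right_eq_self (μ := volume) _ b)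
  by_cases hs : s - b ∈ A
  · rw [Set.indicator_of_mem (by exact hs), Set.indicator_of_mem hs,
      ← ENNReal.ofReal_mul (Real.exp_pos _).le]
    congr 1
    rw [mul_left_comm, ← Real.exp_add]; ring_nf
  · rw [Set.indicator_of_notMem (by exact hs), Set.indicator_of_notMem hs, mul_zero]

/-- The sum of the images of the radial measure along the random rays through `R j`, `j ∈ J`, as a
measure on `[-∞, ∞]^ι`. -/
noncomputable def rayMeasure (P : Measure Ω) (γ : ℝ) {K : Type*} (J : Finset K)
    (R : K → Ω → ι → ℝ) : Measure (ι → EReal) :=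
  ∑ j ∈ J, ((expDensity γ).prod P).map fun p => toEReal fun a => Real.exp p.1 * R j p.2 a

lemma measurable_ray {R : Ω → ι → ℝ} (hR : Measurable R) :
    Measurable fun p : ℝ × Ω => fun a => Real.exp p.1 * R p.2 a :=
  measurable_pi_lambda _ fun a => (Real.measurable_exp.comp measurable_fst).mul
    ((measurable_pi_iff.1 hR a).comp measurable_snd)

section

variable {K : Type*} {J : Finset K} {R : K → Ω → ι → ℝ} {γ : ℝ}

lemma rayMeasure_apply (hR : ∀ j, Measurable (R j)) {S : Set (ι → EReal)} (hS : MeasurableSet S) :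
    rayMeasure P γ J R S = ∑ j ∈ J, ∫⁻ ω,
      expDensity γ {s | (toEReal fun a => Real.exp s * R j ω a) ∈ S} ∂P := by
  rw [rayMeasure, Measure.finsetSum_apply]
  refine Finset.sum_congr rfl fun j _ => ?_
  have hm : Measurable fun p : ℝ × Ω => toEReal fun a => Real.exp p.1 * R j p.2 a :=
    measurable_toEReal.comp (measurable_ray (hR j))
  rw [Measure.map_apply hm hS, Measure.prod_apply_symm (hm hS)]
  rfl

lemma lintegral_ofReal_rpow_lt_top {X : Ω → ℝ} (hX0 : ∀ ω, 0 ≤ X ω)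
    (hX : Integrable (fun ω => X ω ^ γ) P) {ε : ℝ} (hε : 0 < ε) :
    ∫⁻ ω, ENNReal.ofReal ((X ω / ε) ^ γ) ∂P < ⊤ := by
  have h : Integrable (fun ω => (X ω / ε) ^ γ) P := by
    simp_rw [Real.div_rpow (hX0 _) hε.le]
    exact hX.div_const _
  rw [← ofReal_integral_eq_lintegral_ofReal h (ae_of_all _ fun ω =>
    Real.rpow_nonneg (div_nonneg (hX0 ω) hε.le) _)]
  exact ENNReal.ofReal_lt_top

lemma rayMeasure_lt_top (hγ : 0 < γ) (hR : ∀ j, Measurable (R j)) (hR0 : ∀ j ω a, 0 ≤ R j ω a)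
    (hRi : ∀ j ∈ J, ∀ a, Integrable (fun ω => R j ω a ^ γ) P) {ε : ℝ} (hε : 0 < ε)
    {S : Set (ι → EReal)} (hS : MeasurableSet S)
    (hSε : ∀ v : ι → ℝ, (∀ a, |v a| ≤ ε) → toEReal v ∉ S) : rayMeasure P γ J R S < ⊤ := by
  rw [rayMeasure_apply hR hS, ENNReal.sum_lt_top]
  intro j hj
  have hle : ∀ ω, expDensity γ {s | (toEReal fun a => Real.exp s * R j ω a) ∈ S} ≤
      ∑ a, ENNReal.ofReal ((R j ω a / ε) ^ γ) := by
    intro ω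
    refine (measure_mono (t := ⋃ a ∈ (Finset.univ : Finset ι),
      {s | ε < Real.exp s * R j ω a}) fun s hs => ?_).trans
      ((measure_biUnion_finset_le _ _).trans_eq (Finset.sum_congr rfl fun a _ =>
        expDensity_ray_lt hγ hε (hR0 j ω a)))
    by_contra hcon
    refine hSε _ (fun a => ?_) hs
    rw [abs_of_nonneg (mul_nonneg (Real.exp_pos s).le (hR0 j ω a))]
    by_contra! h
    exact hcon (Set.mem_biUnion (x := a) (Finset.mem_univ a) h)
  refine (lintegral_mono hle).trans_lt ?_
  rw [lintegral_finsetSum _ fun a _ => (((measurable_pi_iff.1 (hR j) a).div_const ε).pow_const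
    γ).ennreal_ofReal, ENNReal.sum_lt_top]
  exact fun a _ => lintegral_ofReal_rpow_lt_top (fun ω => hR0 j ω a) (hRi j hj a) hε

lemma rayMeasure_pos (hγ : 0 < γ) (hR : ∀ j, Measurable (R j)) {j : K} (hj : j ∈ J) {a : ι}
    (hpos : ∀ ω, 0 < R j ω a) :
    0 < rayMeasure P γ J R {y | (1 : EReal) < y a} := by
  have hS : MeasurableSet {y : ι → EReal | (1 : EReal) < y a} :=
    measurableSet_lt measurable_const (measurable_pi_apply a)
  rw [rayMeasure_apply hR hS]
  refine lt_of_lt_of_le ?_ (Finset.single_le_sum (fun _ _ => zero_le) hj)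
  have h : ∀ ω, expDensity γ {s | (toEReal fun a => Real.exp s * R j ω a) ∈
      {y : ι → EReal | (1 : EReal) < y a}} = ENNReal.ofReal ((R j ω a / 1) ^ γ) := by
    intro ω
    rw [← expDensity_ray_lt hγ one_pos (hpos ω).le]
    congr 1; ext s
    show (1 : EReal) < ((Real.exp s * R j ω a : ℝ) : EReal) ↔ 1 < Real.exp s * R j ω a
    exact_mod_cast Iff.rfl
  simp_rw [h]
  rw [lintegral_pos_iff_support (((measurable_pi_iff.1 (hR j) a).div_const 1).pow_const
    γ).ennreal_ofReal]
  have : (Function.support fun ω => ENNReal.ofReal ((R j ω a / 1) ^ γ)) = Set.univ := by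
    ext ω
    have := hpos ω
    simp only [Function.mem_support, Set.mem_univ, iff_true]
    exact (ENNReal.ofReal_pos.2 (by positivity)).ne'
  rw [this]
  simp

lemma image_dilate {c : ℝ} (hc : 0 < c) (B : Set (Punctured ι)) :
    Subtype.val '' dilate c B =
      (fun (y : ι → EReal) a => ((c⁻¹ : ℝ) : EReal) * y a) ⁻¹' (Subtype.val '' B) := by
  have h1 : ((c⁻¹ : ℝ) : EReal) * (c : EReal) = 1 := by
    rw [← EReal.coe_mul, inv_mul_cancel₀ hc.ne']; rfl
  have h2 : (c : EReal) * ((c⁻¹ : ℝ) : EReal) = 1 := by rw [mul_comm, h1]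
  ext y
  constructor
  · rintro ⟨z, ⟨x, hx, hz⟩, rfl⟩
    refine ⟨x, hx, funext fun a => ?_⟩
    show x.1 a = ((c⁻¹ : ℝ) : EReal) * z.1 a
    rw [hz, ← mul_assoc, h1, one_mul]
  · rintro ⟨x, hx, hy⟩
    have hy' : ∀ a, y a = (c : EReal) * x.1 a := fun a => by
      rw [hy, ← mul_assoc, h2, one_mul]
    refine ⟨⟨y, fun h0 => x.2 ?_⟩, ⟨x, hx, hy'⟩, rfl⟩
    rw [hy, h0]; ext a; simp

lemma rayMeasure_dilate (hR : ∀ j, Measurable (R j)) {c : ℝ} (hc : 0 < c)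
    {B : Set (Punctured ι)} (hB : MeasurableSet B) :
    rayMeasure P γ J R (Subtype.val '' dilate c B) =
      ENNReal.ofReal (c ^ (-γ)) * rayMeasure P γ J R (Subtype.val '' B) := by
  have hS : MeasurableSet (Subtype.val '' B) := measurableSet_ne_zero.subtype_image hB
  have hm : Measurable fun (y : ι → EReal) a => ((c⁻¹ : ℝ) : EReal) * y a :=
    measurable_pi_lambda _ fun a => (measurable_pi_apply a).const_mul _
  rw [image_dilate hc, rayMeasure_apply hR hS, rayMeasure_apply hR (hm hS), Finset.mul_sum]
  refine Finset.sum_congr rfl fun j _ => ?_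
  rw [← lintegral_const_mul' _ _ ENNReal.ofReal_ne_top]
  refine lintegral_congr fun ω => ?_
  have hray : Measurable fun s : ℝ => toEReal fun a => Real.exp s * R j ω a :=
    measurable_toEReal.comp (measurable_pi_lambda _ fun a => by fun_prop)
  have h := expDensity_preimage_sub γ (Real.log c) (hray hS)
  rw [Real.rpow_def_of_pos hc, mul_neg, mul_comm (Real.log c)]
  refine Eq.trans ?_ h
  congr 1; ext s
  show (fun a => ((c⁻¹ : ℝ) : EReal) * ((Real.exp s * R j ω a : ℝ) : EReal)) ∈ Subtype.val '' B ↔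
    (toEReal fun a => Real.exp (s - Real.log c) * R j ω a) ∈ Subtype.val '' B
  have : (fun a => ((c⁻¹ : ℝ) : EReal) * ((Real.exp s * R j ω a : ℝ) : EReal)) =
      toEReal fun a => Real.exp (s - Real.log c) * R j ω a := by
    ext a
    rw [← EReal.coe_mul, toEReal, Real.exp_sub, Real.exp_log hc]
    congr 1; ring
  rw [this]

lemma integral_rayMeasure (hγ : 0 < γ) (hR : ∀ j, Measurable (R j)) (hR0 : ∀ j ω a, 0 ≤ R j ω a)
    (hRi : ∀ j ∈ J, ∀ a, Integrable (fun ω => R j ω a ^ γ) P) (f : C_c(Punctured ι, ℝ)) :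
    ∫ y, zeroExtend f y ∂(rayMeasure P γ J R) =
      ∑ j ∈ J, ∫ ω, rayIntegral γ (fun v => zeroExtend f (toEReal v)) (R j ω) ∂P := by
  have hg := testFn_zeroExtend f
  obtain ⟨C, hC⟩ := hg.bdd
  obtain ⟨ε, hε, hg0⟩ := hg.vanish
  have hF := continuous_zeroExtend f
  have hm : ∀ j, Measurable fun p : ℝ × Ω => toEReal fun a => Real.exp p.1 * R j p.2 a := fun j =>
    measurable_toEReal.comp (measurable_ray (hR j))
  have hi : ∀ j ∈ J, Integrable (fun p : ℝ × Ω =>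
      zeroExtend f (toEReal fun a => Real.exp p.1 * R j p.2 a)) ((expDensity γ).prod P) := by
    intro j hj
    refine ⟨(hF.measurable.comp (hm j)).aestronglyMeasurable, ?_⟩
    have hm' : Measurable fun p : ℝ × Ω =>
        ‖zeroExtend f (toEReal fun a => Real.exp p.1 * R j p.2 a)‖ₑ :=
      (hF.measurable.comp (hm j)).enorm
    rw [hasFiniteIntegral_iff_enorm, lintegral_prod_symm _ hm'.aemeasurable]
    refine (lintegral_mono fun ω => lintegral_ray_le hγ hC hε hg0 (R j ω)).trans_lt ?_
    have hi' : Integrable (fun ω => C * ∑ a, (|R j ω a| / ε) ^ γ) P := by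
      refine (integrable_finsetSum _ fun a _ => ?_).const_mul _
      simp_rw [abs_of_nonneg (hR0 _ _ _), Real.div_rpow (hR0 _ _ _) hε.le]
      exact (hRi j hj a).div_const _
    exact (lintegral_ofReal_le_lintegral_enorm _).trans_lt hi'.2
  rw [rayMeasure, integral_finsetSum_measure fun j hj =>
    (integrable_map_measure hF.aestronglyMeasurable (hm j).aemeasurable).2 (hi j hj)]
  refine Finset.sum_congr rfl fun j hj => ?_
  rw [integral_map (hm j).aemeasurable hF.aestronglyMeasurable, integral_prod_symm _ (hi j hj)]
  rfl

end

end

/-! ### Tails of norms and vague convergence -/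

section

variable {Ω : Type*} [MeasurableSpace Ω] {P : Measure Ω} [IsProbabilityMeasure P]
  {ι κ : Type*} [Fintype ι] [Fintype κ]

lemma Seminorm.exists_le_norm (N : Seminorm ℝ (κ → ℝ)) : ∃ D, 0 < D ∧ ∀ v, N v ≤ D * ‖v‖ := by
  classical
  refine ⟨∑ k, N (Pi.single k 1) + 1,
    add_pos_of_nonneg_of_pos (Finset.sum_nonneg fun k _ => apply_nonneg N _) one_pos, fun v => ?_⟩
  calc N v = N (∑ k, v k • Pi.single k (1 : ℝ)) := by rw [← pi_eq_sum_univ' v]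
    _ ≤ ∑ k, N (v k • Pi.single k (1 : ℝ)) :=
        Finset.le_sum_of_subadditive N (map_zero N).le (map_add_le_add N) _ _
    _ = ∑ k, |v k| * N (Pi.single k 1) := by simp_rw [map_smul_eq_mul, Real.norm_eq_abs]
    _ ≤ ∑ k, ‖v‖ * N (Pi.single k 1) := Finset.sum_le_sum fun k _ =>
        mul_le_mul_of_nonneg_right (norm_le_pi_norm v k) (apply_nonneg N _)
    _ ≤ (∑ k, N (Pi.single k 1) + 1) * ‖v‖ := by
        rw [← Finset.mul_sum, mul_comm]
        gcongr
        linarith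

lemma Seminorm.continuous_pi (N : Seminorm ℝ (κ → ℝ)) : Continuous N := by
  obtain ⟨D, hD, h⟩ := Seminorm.exists_le_norm N
  refine LipschitzWith.continuous (K := D.toNNReal) (LipschitzWith.of_dist_le_mul fun v w => ?_)
  rw [Real.dist_eq, dist_eq_norm, Real.coe_toNNReal _ hD.le]
  exact (abs_sub_map_le_sub N v w).trans (h _)

/-- A continuous approximation of the indicator of `{N > 1}`, for a seminorm `N` of the coordinates
selected by `e`. -/
noncomputable def clippedNorm (N : Seminorm ℝ (κ → ℝ)) (e : κ → ι) (s : ℝ) (v : ι → ℝ) : ℝ :=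
  max 0 (min 1 ((N (fun k => v (e k)) - 1) / s))

lemma testFn_clippedNorm (N : Seminorm ℝ (κ → ℝ)) (e : κ → ι) {s : ℝ} (hs : 0 < s) :
    TestFn (clippedNorm N e s) := by
  obtain ⟨D, hD, hND⟩ := Seminorm.exists_le_norm N
  have hNe : ∀ {δ : ℝ} {v : κ → ℝ}, 0 ≤ δ → (∀ k, |v k| ≤ δ) → N v ≤ D * δ := fun hδ hv =>
    (hND _).trans (mul_le_mul_of_nonneg_left ((pi_norm_le_iff_of_nonneg hδ).2 hv) hD.le)
  refine ⟨?_, ⟨1, fun v => ?_⟩, ⟨1 / D, by positivity, fun v hv => ?_⟩, fun G κ hκ => ?_⟩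
  · have : Continuous fun v : ι → ℝ => N (fun k => v (e k)) :=
      (Seminorm.continuous_pi N).comp (by fun_prop)
    exact continuous_const.max (continuous_const.min ((this.sub continuous_const).div_const s))
  · rw [clippedNorm, abs_of_nonneg (le_max_left _ _)]
    exact max_le zero_le_one (min_le_left _ _)
  · have h := hNe (one_div_pos.2 hD).le fun k => hv (e k)
    rw [mul_one_div_cancel hD.ne'] at h
    exact max_eq_left ((min_le_right _ _).trans
      (div_nonpos_of_nonpos_of_nonneg (by linarith) hs.le))
  · refine ⟨κ * s / D, by positivity, fun v hv => ?_⟩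
    calc |clippedNorm N e s v - clippedNorm N e s (G.indicator v)|
        ≤ |(N (fun k => v (e k)) - 1) / s - (N (fun k => G.indicator v (e k)) - 1) / s| := by
          rw [clippedNorm, clippedNorm, max_comm 0, max_comm 0, min_comm 1, min_comm 1]
          exact (abs_max_sub_max_le_abs _ _ _).trans
            ((abs_min_sub_min_le_max _ _ _ _).trans (max_le le_rfl (by simp)))
      _ = |N (fun k => v (e k)) - N (fun k => G.indicator v (e k))| / s := by
          rw [← sub_div, sub_sub_sub_cancel_right, abs_div, abs_of_pos hs]
      _ ≤ D * (κ * s / D) / s := by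
          gcongr
          refine (abs_sub_map_le_sub N _ _).trans (hNe (by positivity) fun k => ?_)
          simp only [Pi.sub_apply]
          by_cases hk : e k ∈ G
          · rw [Set.indicator_of_mem hk, sub_self, abs_zero]; positivity
          · rw [Set.indicator_of_notMem hk, sub_zero]; exact hv _ hk
      _ = κ := by field_simp

/-- For a family with a limit along rays, the tail of a norm of some of the coordinates is
asymptotically proportional to the normalising function. -/
lemma IsLimitFamily.tendsto_norm_tail {L : ι → Ω → ℝ} (hL : ∀ a, Measurable (L a)) {H : ℝ → ℝ}
    {γ : ℝ} (hγ : 0 < γ) {K : Type*} {J : Finset K} {R : K → Ω → ι → ℝ} (e : κ → ι) (k₀ : κ)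
    (h : IsLimitFamily P L H γ J R (e k₀)) (N : Seminorm ℝ (κ → ℝ)) (hN : ∀ v, N v = 0 → v = 0) :
    ∃ l, 0 < l ∧ Tendsto (fun u => P.real {ω | Real.exp u < N fun k => Real.exp (L (e k) ω)} / H u)
      atTop (𝓝 l) := by
  obtain ⟨D, hD, hND⟩ := Seminorm.exists_le_norm N
  have hNc := Seminorm.continuous_pi N
  set n : K → Ω → ℝ := fun j ω => N fun k => R j ω (e k) with hn
  have hnm : ∀ j, Measurable (n j) := fun j => hNc.measurable.comp
    (measurable_pi_lambda _ fun k => measurable_pi_iff.1 (h.meas j) (e k))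
  have hn0 : ∀ j ω, 0 ≤ n j ω := fun j ω => apply_nonneg N _
  have hni : ∀ j ∈ J, Integrable (fun ω => n j ω ^ γ) P := by
    intro j hj
    refine Integrable.mono' (g := fun ω => D ^ γ * ∑ a, R j ω a ^ γ)
      ((integrable_finsetSum _ fun a _ => h.integrable j hj a).const_mul _)
      ((hnm j).pow_const γ).aestronglyMeasurable (ae_of_all _ fun ω => ?_)
    rw [Real.norm_of_nonneg (Real.rpow_nonneg (hn0 j ω) γ)]
    have hne : Nonempty κ := ⟨k₀⟩
    obtain ⟨k, hk⟩ := (Finite.exists_max fun k => R j ω (e k))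
    have h1 : ‖fun k => R j ω (e k)‖ ≤ R j ω (e k) :=
      (pi_norm_le_iff_of_nonneg (h.nonneg _ _ _)).2 fun k' => by
        rw [Real.norm_of_nonneg (h.nonneg _ _ _)]; exact hk k'
    calc n j ω ^ γ ≤ (D * R j ω (e k)) ^ γ :=
          Real.rpow_le_rpow (hn0 j ω) ((hND _).trans (by gcongr)) hγ.le
      _ = D ^ γ * R j ω (e k) ^ γ := Real.mul_rpow hD.le (h.nonneg _ _ _)
      _ ≤ D ^ γ * ∑ a, R j ω a ^ γ := by
          gcongr
          exact Finset.single_le_sum (f := fun a => R j ω a ^ γ)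
            (fun a _ => Real.rpow_nonneg (h.nonneg _ _ _) _) (Finset.mem_univ (e k))
  set l : ℝ := ∑ j ∈ J, ∫ ω, n j ω ^ γ ∂P with hl
  have hl0 : 0 < l := by
    obtain ⟨j, hj, hpos⟩ := h.pos
    refine lt_of_lt_of_le ?_ (Finset.single_le_sum (f := fun j => ∫ ω, n j ω ^ γ ∂P)
      (fun j _ => integral_nonneg fun ω => Real.rpow_nonneg (hn0 j ω) γ) hj)
    have hnpos : ∀ ω, 0 < n j ω := fun ω => (hn0 j ω).lt_of_ne' fun h0 =>
      (hpos ω).ne' (congrFun (hN _ h0) k₀)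
    rw [integral_pos_iff_support_of_nonneg (fun ω => Real.rpow_nonneg (hn0 j ω) γ) (hni j hj)]
    have : (Function.support fun ω => n j ω ^ γ) = Set.univ :=
      Set.eq_univ_of_forall fun ω => (Real.rpow_pos_of_pos (hnpos ω) γ).ne'
    rw [this]; simp
  -- the limits of the clipped norms approximate `l`
  have hray : ∀ s > 0, ∀ j ω, (n j ω / (1 + s)) ^ γ ≤ rayIntegral γ (clippedNorm N e s) (R j ω) ∧
      rayIntegral γ (clippedNorm N e s) (R j ω) ≤ n j ω ^ γ := by
    intro s hs j ω
    have hg := testFn_clippedNorm N e hs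
    obtain ⟨C, hC⟩ := hg.bdd
    obtain ⟨ε, hε, hg0⟩ := hg.vanish
    have hNs : ∀ t : ℝ, N (fun k => Real.exp t * R j ω (e k)) = Real.exp t * n j ω := fun t => by
      have := map_smul_eq_mul N (Real.exp t) (fun k => R j ω (e k))
      rwa [Real.norm_of_nonneg (Real.exp_pos t).le] at this
    have hint : Integrable (fun t => clippedNorm N e s fun a => Real.exp t * R j ω a)
        (expDensity γ) := by
      refine ⟨(hg.cont.comp (by fun_prop)).aestronglyMeasurable, ?_⟩
      rw [hasFiniteIntegral_iff_enorm]
      exact (lintegral_ray_le hγ hC hε hg0 (R j ω)).trans_lt ENNReal.ofReal_lt_top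
    have hset : ∀ b : ℝ, 0 < b → (expDensity γ).real {t | b < Real.exp t * n j ω} =
        (n j ω / b) ^ γ := fun b hb => by
      rw [measureReal_def, expDensity_ray_lt hγ hb (hn0 j ω),
        ENNReal.toReal_ofReal (Real.rpow_nonneg (div_nonneg (hn0 j ω) hb.le) γ)]
    have hm : ∀ b : ℝ, MeasurableSet {t | b < Real.exp t * n j ω} := fun b =>
      measurableSet_lt measurable_const (by fun_prop)
    have hind : ∀ b : ℝ, 0 < b → Integrable ({t | b < Real.exp t * n j ω}.indicator
        (1 : ℝ → ℝ)) (expDensity γ) := fun b hb => by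
      refine (integrable_indicator_iff (hm b)).2 (integrableOn_const (C := (1 : ℝ)) ?_ (by simp))
      rw [expDensity_ray_lt hγ hb (hn0 j ω)]; exact ENNReal.ofReal_ne_top
    constructor
    · rw [← hset (1 + s) (by positivity), ← integral_indicator_one (hm _)]
      refine integral_mono (hind _ (by positivity)) hint fun t => ?_
      by_cases ht : 1 + s < Real.exp t * n j ω
      · rw [Set.indicator_of_mem (by exact ht), Pi.one_apply]
        show 1 ≤ max _ _
        rw [hNs]
        exact le_max_of_le_right (le_min le_rfl ((one_le_div hs).2 (by linarith)))
      · rw [Set.indicator_of_notMem (by exact ht)]; exact le_max_left _ _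
    · have h1 := hset 1 one_pos
      rw [div_one] at h1
      rw [← h1, ← integral_indicator_one (hm _)]
      refine integral_mono hint (hind _ one_pos) fun t => ?_
      by_cases ht : 1 < Real.exp t * n j ω
      · rw [Set.indicator_of_mem (by exact ht), Pi.one_apply]
        exact max_le zero_le_one (min_le_left _ _)
      · rw [Set.indicator_of_notMem (by exact ht)]
        show max _ _ ≤ (0 : ℝ)
        rw [hNs]
        exact max_le le_rfl ((min_le_right _ _).trans
          (div_nonpos_of_nonpos_of_nonneg (by linarith) hs.le))
  set A : ℝ → ℝ := fun s => ∑ j ∈ J, ∫ ω, rayIntegral γ (clippedNorm N e s) (R j ω) ∂P with hA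
  have hAi : ∀ s > 0, ∀ j ∈ J, Integrable (fun ω => rayIntegral γ (clippedNorm N e s) (R j ω)) P :=
    fun s hs j hj => integrable_rayIntegral hγ (testFn_clippedNorm N e hs) (h.meas j) (h.nonneg j)
      (h.integrable j hj)
  have hA1 : ∀ s > 0, l / (1 + s) ^ γ ≤ A s := by
    intro s hs
    rw [hl, Finset.sum_div]
    refine Finset.sum_le_sum fun j hj => ?_
    rw [← integral_div]
    refine integral_mono ((hni j hj).div_const _) (hAi s hs j hj) fun ω => ?_
    have := (hray s hs j ω).1
    rwa [Real.div_rpow (hn0 j ω) (by positivity)] at this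
  have hA2 : ∀ s > 0, A s ≤ l := fun s hs => Finset.sum_le_sum fun j hj =>
    integral_mono (hAi s hs j hj) (hni j hj) fun ω => (hray s hs j ω).2
  have hV : ∀ ω u, N (fun k => Real.exp (L (e k) ω - u)) =
      (N fun k => Real.exp (L (e k) ω)) / Real.exp u := by
    intro ω u
    have := map_smul_eq_mul N (Real.exp (-u)) (fun k => Real.exp (L (e k) ω))
    rw [Real.norm_of_nonneg (Real.exp_pos _).le, Real.exp_neg] at this
    rw [div_eq_inv_mul, ← this]
    congr 1; ext k
    rw [Real.exp_sub, Pi.smul_apply, smul_eq_mul, div_eq_inv_mul]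
  have hVm : Measurable fun ω => N fun k => Real.exp (L (e k) ω) :=
    hNc.measurable.comp (measurable_pi_lambda _ fun k => (hL _).exp)
  have hSm : ∀ u, MeasurableSet {ω | Real.exp u < N fun k => Real.exp (L (e k) ω)} := fun u =>
    measurableSet_lt measurable_const hVm
  have hclip : ∀ s > 0, ∀ u, Integrable (fun ω => clippedNorm N e s fun a => Real.exp (L a ω - u))
      P := fun s hs u => by
    have hg := testFn_clippedNorm N e hs
    obtain ⟨C, hC⟩ := hg.bdd
    exact Integrable.of_bound (hg.cont.measurable.comp
      (measurable_pi_lambda _ fun a => ((hL a).sub_const u).exp)).aestronglyMeasurable C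
      (ae_of_all _ fun ω => hC _)
  have hind : ∀ u, Integrable ({ω | Real.exp u < N fun k => Real.exp (L (e k) ω)}.indicator
      (1 : Ω → ℝ)) P := fun u => (integrable_const (1 : ℝ)).indicator (hSm u)
  -- comparison of the tail with the clipped norms at two levels
  have hlow : ∀ s > 0, ∀ u, (∫ ω, clippedNorm N e s (fun a => Real.exp (L a ω - u)) ∂P) ≤
      P.real {ω | Real.exp u < N fun k => Real.exp (L (e k) ω)} := by
    intro s hs u
    rw [← integral_indicator_one (hSm u)]
    refine integral_mono (hclip s hs u) (hind u) fun ω => ?_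
    by_cases hω : Real.exp u < N fun k => Real.exp (L (e k) ω)
    · rw [Set.indicator_of_mem (by exact hω), Pi.one_apply]
      exact max_le zero_le_one (min_le_left _ _)
    · rw [Set.indicator_of_notMem (by exact hω)]
      show max _ _ ≤ (0 : ℝ)
      rw [hV]
      refine max_le le_rfl ((min_le_right _ _).trans
        (div_nonpos_of_nonpos_of_nonneg (sub_nonpos.2 ?_) hs.le))
      exact (div_le_one (Real.exp_pos u)).2 (not_lt.1 hω)
  have hup : ∀ s > 0, ∀ u, P.real {ω | Real.exp u < N fun k => Real.exp (L (e k) ω)} ≤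
      ∫ ω, clippedNorm N e s (fun a => Real.exp (L a ω - (u + -Real.log (1 + s)))) ∂P := by
    intro s hs u
    rw [← integral_indicator_one (hSm u)]
    refine integral_mono (hind u) (hclip s hs _) fun ω => ?_
    by_cases hω : Real.exp u < N fun k => Real.exp (L (e k) ω)
    · rw [Set.indicator_of_mem (by exact hω), Pi.one_apply]
      show 1 ≤ max _ _
      rw [hV, Real.exp_add, Real.exp_neg, Real.exp_log (by positivity)]
      refine le_max_of_le_right (le_min le_rfl ((one_le_div hs).2 ?_))
      have h1 := (one_lt_div (Real.exp_pos u)).2 hω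
      rw [← div_div, div_inv_eq_mul]
      nlinarith
    · rw [Set.indicator_of_notMem (by exact hω)]; exact le_max_left _ _
  have hH := h.expVarying
  refine ⟨l, hl0, tendsto_order.2 ⟨fun b hb => ?_, fun b hb => ?_⟩⟩
  · have hs : Tendsto (fun s : ℝ => l / (1 + s) ^ γ) (𝓝[>] 0) (𝓝 l) := by
      have : ContinuousAt (fun s : ℝ => l / (1 + s) ^ γ) 0 := by
        refine continuousAt_const.div ?_ (by simp)
        exact (continuousAt_const.add continuousAt_id).rpow_const (Or.inr hγ.le)
      simpa using this.tendsto.mono_left nhdsWithin_le_nhds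
    obtain ⟨s, hsb, hs0⟩ := ((hs.eventually_const_lt hb).and self_mem_nhdsWithin).exists
    have hs0 : 0 < s := hs0
    filter_upwards [(h.lim _ (testFn_clippedNorm N e hs0)).eventually_const_lt
      (hsb.trans_le (hA1 s hs0))] with u hu
    exact hu.trans_le (div_le_div_of_nonneg_right (hlow s hs0 u) (hH.pos u).le)
  · have hs : Tendsto (fun s : ℝ => l * (1 + s) ^ γ) (𝓝[>] 0) (𝓝 l) := by
      have : ContinuousAt (fun s : ℝ => l * (1 + s) ^ γ) 0 :=
        continuousAt_const.mul ((continuousAt_const.add continuousAt_id).rpow_const (Or.inr hγ.le))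
      simpa using this.tendsto.mono_left nhdsWithin_le_nhds
    obtain ⟨s, hsb, hs0⟩ := ((hs.eventually_lt_const hb).and self_mem_nhdsWithin).exists
    have hs0 : 0 < s := hs0
    have hlim := hH.tendsto_div_shift (h.lim _ (testFn_clippedNorm N e hs0)) (-Real.log (1 + s))
    have hexp : Real.exp (-(γ * -Real.log (1 + s))) = (1 + s) ^ γ := by
      rw [Real.rpow_def_of_pos (by positivity)]; ring_nf
    rw [hexp] at hlim
    have hb' : A s * (1 + s) ^ γ < b :=
      (mul_le_mul_of_nonneg_right (hA2 s hs0) (by positivity)).trans_lt hsb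
    filter_upwards [hlim.eventually_lt_const hb'] with u hu
    exact (div_le_div_of_nonneg_right (hup s hs0 u) (hH.pos u).le).trans_lt hu

/-- Multivariate regular variation of a vector whose logarithm has a limit along rays. -/
theorem IsLimitFamily.exists_limit_measure {L : ι → Ω → ℝ} (hL : ∀ a, Measurable (L a))
    {H : ℝ → ℝ} {γ : ℝ} (hγ : 0 < γ) {K : Type*} {J : Finset K} {R : K → Ω → ι → ℝ} (e : κ → ι)
    (k₀ : κ) (h : IsLimitFamily P L H γ J R (e k₀)) (N : Seminorm ℝ (κ → ℝ))
    (hN : ∀ v, N v = 0 → v = 0) {V : Ω → ι → ℝ} (hV : Measurable V)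
    (hVL : ∀ᵐ ω ∂P, ∀ a, V ω a = Real.exp (L a ω)) :
    ∃ μ : Measure (Punctured ι), μ ≠ 0 ∧ IsFiniteMeasureOnCompacts μ ∧ HomogeneousMeasure γ μ ∧
      ∀ f : C_c(Punctured ι, ℝ), Tendsto
        (fun x : ℝ => (∫ y, f y ∂(scaledLaw P V x)) / P.real {ω | x < N fun k => V ω (e k)})
        atTop (𝓝 (∫ y, f y ∂μ)) := by
  obtain ⟨l, hl, htail⟩ := h.tendsto_norm_tail hL hγ e k₀ N hN
  set m := rayMeasure P γ J R with hm
  have hl' : ENNReal.ofReal l⁻¹ ≠ 0 := (ENNReal.ofReal_pos.2 (inv_pos.2 hl)).ne'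
  refine ⟨ENNReal.ofReal l⁻¹ • m.comap Subtype.val, ?_, ?_, ?_, fun f => ?_⟩
  · obtain ⟨j, hj, hpos⟩ := h.pos
    intro h0
    have h1 := congrArg (fun μ => μ {y : Punctured ι | (1 : EReal) < y.1 (e k₀)}) h0
    simp only [Measure.smul_apply, Measure.coe_zero, Pi.zero_apply, smul_eq_mul, mul_eq_zero, hl',
      false_or, comap_coe_apply] at h1
    have h2 : Subtype.val '' {y : Punctured ι | (1 : EReal) < y.1 (e k₀)} =
        {y : ι → EReal | (1 : EReal) < y (e k₀)} := by
      ext y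
      constructor
      · rintro ⟨z, hz, rfl⟩; exact hz
      · intro hy
        refine ⟨⟨y, fun h3 => ?_⟩, hy, rfl⟩
        have hy' : (1 : EReal) < y (e k₀) := hy
        rw [h3] at hy'
        exact absurd hy' (not_lt.2 zero_le_one)
    rw [h2] at h1
    exact (rayMeasure_pos hγ h.meas hj hpos).ne' h1
  · refine ⟨fun C hC => ?_⟩
    obtain ⟨ε, hε, hCε⟩ := exists_forall_notMem_of_isCompact hC
    rw [Measure.smul_apply, comap_coe_apply, smul_eq_mul]
    exact ENNReal.mul_lt_top ENNReal.ofReal_lt_top (rayMeasure_lt_top hγ h.meas h.nonneg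
      h.integrable hε (hC.image continuous_subtype_val).isClosed.measurableSet hCε)
  · intro c hc B hB
    rw [Measure.smul_apply, Measure.smul_apply, comap_coe_apply, comap_coe_apply, smul_eq_mul,
      smul_eq_mul, hm, rayMeasure_dilate h.meas hc hB, mul_left_comm]
  · rw [integral_smul_measure, integral_comap_coe, ENNReal.toReal_ofReal (inv_pos.2 hl).le, hm,
      integral_rayMeasure hγ h.meas h.nonneg h.integrable, smul_eq_mul, ← div_eq_inv_mul]
    have h1 := ((h.lim _ (testFn_zeroExtend f)).div htail hl.ne').comp Real.tendsto_log_atTop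
    refine h1.congr' ?_
    filter_upwards [eventually_gt_atTop 0] with x hx
    simp only [Function.comp, Pi.div_apply]
    rw [div_div_div_cancel_right₀ (h.expVarying.pos _).ne', integral_scaledLaw hV, Real.exp_log hx]
    congr 1
    · refine integral_congr_ae ?_
      filter_upwards [hVL] with ω hω
      simp_rw [hω, Real.exp_sub, Real.exp_log hx, div_eq_inv_mul]
    · refine measureReal_congr_of_ae ?_
      filter_upwards [hVL] with ω hω
      simp_rw [hω]

end

/-! ### Moving averages and volatilities -/

section

variable {Ω : Type*} [MeasurableSpace Ω] {P : Measure Ω}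

lemma ExpTail.expVarying {ν : Measure ℝ} [IsProbabilityMeasure ν] {α : ℝ} (h : ExpTail ν α) :
    ExpVarying (fun u => ν.real (Set.Ioi u)) α := by
  obtain ⟨L, hL, hνL⟩ := h
  have hH : ∀ u, ν.real (Set.Ioi u) = Real.exp (-(α * u)) * L (Real.exp u) := by
    intro u
    have h1 := hνL (Real.exp u) (Real.exp_pos u)
    have h2 : {y | Real.exp u < Real.exp y} = Set.Ioi u := by ext y; simp
    rw [h2, ← Real.exp_mul] at h1
    rw [h1]; ring_nf
  have hanti : Antitone fun u => ν.real (Set.Ioi u) := fun u v huv =>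
    measureReal_mono (Set.Ioi_subset_Ioi huv)
  have hpos : ∀ᶠ u in atTop, 0 < ν.real (Set.Ioi u) := by
    filter_upwards [Real.tendsto_exp_atTop.eventually hL.eventually_pos] with u hu
    rw [hH]; positivity
  refine ⟨fun u => ?_, hanti, fun u => measureReal_le_one, fun y => ?_⟩
  · obtain ⟨v, hv, huv⟩ := (hpos.and (eventually_ge_atTop u)).exists
    exact hv.trans_le (hanti huv)
  · have h1 := ((hL.tendsto_ratio (Real.exp (-y)) (Real.exp_pos _)).comp
      Real.tendsto_exp_atTop).const_mul (Real.exp (α * y))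
    rw [mul_one] at h1
    refine h1.congr fun u => ?_
    simp only [Function.comp, hH]
    rw [← Real.exp_add, mul_div_mul_comm, ← Real.exp_sub]
    ring_nf

lemma ExpVarying.comp_div {H : ℝ → ℝ} {α M : ℝ} (h : ExpVarying H α) (hM : 0 < M) :
    ExpVarying (fun u => H (u / M)) (α / M) where
  pos u := h.pos _
  anti u v huv := h.anti (by gcongr)
  le_one u := h.le_one _
  lim y := by
    have h1 := (h.lim (y / M)).comp (tendsto_id.atTop_div_const hM)
    rw [div_mul_eq_mul_div, ← mul_div_assoc] at *
    refine h1.congr fun u => ?_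
    simp only [Function.comp, id, sub_div]

lemma iidField_const_mul {η : ℤ → ℤ → Ω → ℝ} (hη_meas : ∀ k l, Measurable (η k l))
    (hη_indep : iIndepFun (fun p : ℤ × ℤ => η p.1 p.2) P)
    (hη_ident : ∀ k l, IdentDistrib (η k l) (η 0 0) P P) (M : ℝ) :
    IIDField P (fun (q : ℤ × ℤ) ω => M * η q.1 q.2 ω) ((P.map (η 0 0)).map (M * ·)) where
  meas q := (hη_meas _ _).const_mul M
  indep := hη_indep.comp (fun _ => (M * ·)) fun _ => measurable_const_mul M
  law q := by
    rw [← (hη_ident q.1 q.2).map_eq, Measure.map_map (measurable_const_mul M) (hη_meas _ _)]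
    rfl

lemma real_Ioi_map_const_mul {ν : Measure ℝ} {M : ℝ} (hM : 0 < M) (u : ℝ) :
    (ν.map (M * ·)).real (Set.Ioi u) = ν.real (Set.Ioi (u / M)) := by
  rw [map_measureReal_apply (measurable_const_mul M) measurableSet_Ioi]
  congr 1; ext y
  simp [div_lt_iff₀ hM, mul_comm]

lemma ConvolutionTailLimit.map_const_mul {ν : Measure ℝ} [IsProbabilityMeasure ν] {M : ℝ}
    (hM : 0 < M) (h : ConvolutionTailLimit ν) : ConvolutionTailLimit (ν.map (M * ·)) := by
  obtain ⟨c, hc, h⟩ := h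
  refine ⟨c, hc, (h.comp (tendsto_id.atTop_div_const hM)).congr fun u => ?_⟩
  have hm := measurable_const_mul (M := ℝ) M
  have : IsProbabilityMeasure (ν.map (M * ·)) := Measure.isProbabilityMeasure_map hm.aemeasurable
  have hS : MeasurableSet {p : ℝ × ℝ | u < p.1 + p.2} :=
    measurableSet_lt measurable_const (by fun_prop)
  rw [real_Ioi_map_const_mul hM, Measure.map_prod_map _ _ hm hm,
    map_measureReal_apply (hm.prodMap hm) hS]
  simp only [Function.comp, id]
  congr 2
  ext p
  show u / M < p.1 + p.2 ↔ u < M * p.1 + M * p.2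
  rw [div_lt_iff₀ hM, ← mul_add, mul_comm]

lemma InfiniteExpMoment.map_const_mul {ν : Measure ℝ} {α M : ℝ} (hM : 0 < M)
    (h : InfiniteExpMoment ν α) : InfiniteExpMoment (ν.map (M * ·)) (α / M) := by
  rw [InfiniteExpMoment, lintegral_map (by fun_prop) (measurable_const_mul M)]
  rw [InfiniteExpMoment] at h
  rw [← h]
  refine lintegral_congr fun y => ?_
  rw [← mul_assoc, div_mul_cancel₀ _ hM.ne']

/-- A summable non-negative family with a positive member attains its supremum. -/
lemma exists_isGreatest_of_summable {β : Type*} {g : β → ℝ} (hg : Summable g) {p₀ : β}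
    (hp₀ : 0 < g p₀) : ∃ p, IsGreatest (Set.range g) (g p) := by
  have hfin : {p | g p₀ ≤ g p}.Finite := by
    have h := hg.tendsto_cofinite_zero.eventually_lt_const hp₀
    rw [eventually_cofinite] at h
    simpa only [not_lt] using h
  obtain ⟨p, hp, hmax⟩ := Set.exists_max_image _ g hfin ⟨p₀, le_refl (g p₀)⟩
  refine ⟨p, ⟨p, rfl⟩, ?_⟩
  rintro _ ⟨q, rfl⟩
  by_cases hq : g p₀ ≤ g q
  · exact hmax q hq
  · exact (not_le.1 hq).le.trans hp

/-- Sequences obtained by applying a fixed measurable functional to the time shifts of an iid field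
are strictly stationary. -/
lemma strictlyStationary_of_shift {η : ℤ → ℤ → Ω → ℝ}
    (hη_indep : iIndepFun (fun p : ℤ × ℤ => η p.1 p.2) P)
    (hη_ident : ∀ k l, IdentDistrib (η k l) (η 0 0) P P) {d : ℕ}
    {G : (ℤ × ℤ → ℝ) → Fin d → ℝ} (hG : Measurable G) :
    StrictlyStationary P fun t ω => G fun q => η q.1 (t + q.2) ω := by
  intro s
  have hinj : Function.Injective fun q : ℤ × ℤ => (q.1, q.2 + s) := by
    rintro ⟨a, b⟩ ⟨c, d⟩ h
    simpa using h
  have h1 : IdentDistrib (fun ω (q : ℤ × ℤ) => η q.1 (q.2 + s) ω)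
      (fun ω (q : ℤ × ℤ) => η q.1 q.2 ω) P P :=
    IdentDistrib.pi (fun q => (hη_ident _ _).trans (hη_ident _ _).symm)
      (hη_indep.precomp hinj) hη_indep
  have hΦ : Measurable fun (x : ℤ × ℤ → ℝ) (t : ℤ) => G fun q => x (q.1, t + q.2) :=
    measurable_pi_lambda _ fun t => hG.comp (measurable_pi_lambda _ fun q => measurable_pi_apply _)
  have h2 := h1.comp hΦ
  have h3 : ((fun (x : ℤ × ℤ → ℝ) (t : ℤ) => G fun q => x (q.1, t + q.2)) ∘
      fun ω (q : ℤ × ℤ) => η q.1 (q.2 + s) ω) =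
      fun ω (t : ℤ) => G fun q => η q.1 (t + s + q.2) ω := by
    ext ω t
    simp only [Function.comp, add_right_comm]
  rw [h3] at h2
  exact h2

/-- Regular variation of sequences whose coordinates are exponentials of linear moving averages of
an iid field, the largest coefficient being `M`. -/
theorem regularlyVaryingSeq_of_movingAverage [IsProbabilityMeasure P] {α : ℝ} (hα : 0 < α)
    {η : ℤ → ℤ → Ω → ℝ}
    (hη_meas : ∀ k l, Measurable (η k l))
    (hη_indep : iIndepFun (fun p : ℤ × ℤ => η p.1 p.2) P)
    (hη_ident : ∀ k l, IdentDistrib (η k l) (η 0 0) P P)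
    (hη_tail : ExpTail (P.map (η 0 0)) α)
    (hcase : InfiniteExpMoment (P.map (η 0 0)) α ∨ ConvolutionTailLimit (P.map (η 0 0)))
    {d : ℕ} {W : Fin d → ℤ → ℤ → ℝ} {M : ℝ} (hM : 0 < M) (hW0 : ∀ k x s, 0 ≤ W k x s)
    (hWM : ∀ k x s, W k x s ≤ M) (hWe : ∃ k x s, W k x s = M)
    (hWs : ∀ k, Summable fun q : ℤ × ℤ => W k q.1 q.2)
    (hWη : ∀ k (t : ℤ), ∀ᵐ ω ∂P, Summable fun q : ℤ × ℤ => W k q.1 (t - q.2) * η q.1 q.2 ω)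
    {Y : ℤ → Ω → Fin d → ℝ} (hYm : ∀ t, Measurable (Y t)) (hYs : StrictlyStationary P Y)
    (hY : ∀ t : ℤ, ∀ᵐ ω ∂P, ∀ k,
      Y t ω k = Real.exp (∑' q : ℤ × ℤ, W k q.1 (t - q.2) * η q.1 q.2 ω)) :
    RegularlyVaryingSeq P Y (α / M) := by
  classical
  have hγ : 0 < α / M := div_pos hα hM
  refine ⟨hγ, hYs, fun N hN h => ?_⟩
  set ν₀ := P.map (η 0 0) with hν₀
  have : IsProbabilityMeasure ν₀ := Measure.isProbabilityMeasure_map (hη_meas 0 0).aemeasurable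
  set ν := ν₀.map (M * ·) with hν
  have : IsProbabilityMeasure ν :=
    Measure.isProbabilityMeasure_map (measurable_const_mul M).aemeasurable
  set ξ : ℤ × ℤ → Ω → ℝ := fun q ω => M * η q.1 q.2 ω with hξdef
  have hξ : IIDField P ξ ν := iidField_const_mul hη_meas hη_indep hη_ident M
  have hνv : ExpVarying (fun u => ν.real (Set.Ioi u)) (α / M) := by
    simp_rw [hν, real_Ioi_map_const_mul hM]
    exact hη_tail.expVarying.comp_div hM
  set w : Fin (h + 1) × Fin d → ℤ × ℤ → ℝ := fun a q => W a.2 q.1 (((a.1 : ℕ) : ℤ) - q.2) / M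
    with hwdef
  have hprod : ∀ a q ω, w a q * ξ q ω = W a.2 q.1 (((a.1 : ℕ) : ℤ) - q.2) * η q.1 q.2 ω := by
    intro a q ω
    simp only [hwdef, hξdef]
    field_simp
  have hw : ∀ a, IsWeight P ξ (w a) := by
    intro a
    refine ⟨fun q => div_nonneg (hW0 _ _ _) hM.le, fun q => (div_le_one hM).2 (hWM _ _ _), ?_, ?_⟩
    · exact (((Equiv.refl ℤ).prodCongr (Equiv.subLeft ((a.1 : ℕ) : ℤ))).summable_iff.2
        (hWs a.2)).div_const M
    · simp_rw [hprod]
      exact hWη a.2 _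
  have hfin : ∀ a, {q | w a q = 1}.Finite := by
    intro a
    have h1 := (hw a).summable.tendsto_cofinite_zero.eventually_lt_const one_pos
    rw [eventually_cofinite] at h1
    exact h1.subset fun q hq => not_lt.2 (le_of_eq (Eq.symm hq))
  set F : Fin (h + 1) × Fin d → Finset (ℤ × ℤ) := fun a => (hfin a).toFinset with hFdef
  have hF : ∀ a q, q ∈ F a ↔ w a q = 1 := fun a q => by simp [hFdef]
  -- the number of maximal coefficients does not depend on time
  have hcard : ∀ t k, (F (t, k)).card = (F (0, k)).card := by
    intro t k
    refine Finset.card_equiv ((Equiv.refl ℤ).prodCongr (Equiv.subRight ((t : ℕ) : ℤ))) fun q => ?_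
    rw [hF, hF]
    simp [hwdef]
  obtain ⟨k₁, x, s, hxs⟩ := hWe
  have : Nonempty (Fin d) := ⟨k₁⟩
  obtain ⟨k₀, hk₀⟩ := Finite.exists_max fun k => (F (0, k)).card
  have hF₀ : 1 ≤ (F (0, k₀)).card := by
    refine le_trans (Finset.card_pos.2 ⟨(x, -s), (hF _ _).2 ?_⟩) (hk₀ k₁)
    simp [hwdef, hxs, hM.ne']
  have ha₀ : ∀ a, (F a).card ≤ (F (0, k₀)).card := fun a => (hcard a.1 a.2).trans_le (hk₀ a.2)
  have hVm : Measurable fun ω (a : Fin (h + 1) × Fin d) => Y ((a.1 : ℕ) : ℤ) ω a.2 :=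
    measurable_pi_lambda _ fun a => (measurable_pi_apply a.2).comp (hYm _)
  have hVL : ∀ᵐ ω ∂P, ∀ a : Fin (h + 1) × Fin d,
      Y ((a.1 : ℕ) : ℤ) ω a.2 = Real.exp (linForm ξ (w a) ω) := by
    refine ae_all_iff.2 fun a => ?_
    filter_upwards [hY ((a.1 : ℕ) : ℤ)] with ω hω
    rw [hω, linForm]
    simp_rw [hprod]
  have hLm : ∀ a, Measurable (linForm ξ (w a)) := fun a => measurable_linForm hξ.meas _
  by_cases hinf : InfiniteExpMoment ν (α / M)
  · obtain ⟨H, J, R, hlim⟩ := isLimitFamily_of_infinite_moment hξ hγ hνv hinf hw hF ha₀ hF₀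
    exact hlim.exists_limit_measure hLm hγ (fun k => (0, k)) k₀ N hN hVm hVL
  · have hconv : ConvolutionTailLimit ν :=
      (hcase.resolve_left fun h1 => hinf (h1.map_const_mul hM)).map_const_mul hM
    obtain ⟨c, _, hc⟩ := hconv
    have hint : Integrable (fun x => Real.exp (α / M * x)) ν := by
      refine ⟨by fun_prop, ?_⟩
      rw [hasFiniteIntegral_iff_ofReal (ae_of_all _ fun x => (Real.exp_pos _).le)]
      exact lt_top_iff_ne_top.2 hinf
    obtain ⟨J, R, hlim⟩ := isLimitFamily_of_convolution hξ hγ hνv hint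
      (fun ε hε => bothLarge_self_le hγ hνv hint hc hε) hw hF hF₀
    exact hlim.exists_limit_measure hLm hγ (fun k => (0, k)) k₀ N hN hVm hVL

lemma volatility_eq (ψ : ℤ → ℤ → ℝ) (η : ℤ → ℤ → Ω → ℝ) (i t : ℤ) (ω : Ω) :
    volatility ψ η i t ω =
      Real.exp (∑' q : ℤ × ℤ, ψ (i - q.1) (t - q.2) * η q.1 q.2 ω) := by
  rw [volatility, ← ((Equiv.subLeft i).prodCongr (Equiv.subLeft t)).tsum_eq]
  simp

lemma summable_volatility {ψ : ℤ → ℤ → ℝ} {η : ℤ → ℤ → Ω → ℝ} {i t : ℤ} {ω : Ω}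
    (h : Summable fun p : ℤ × ℤ => ψ p.1 p.2 * η (i - p.1) (t - p.2) ω) :
    Summable fun q : ℤ × ℤ => ψ (i - q.1) (t - q.2) * η q.1 q.2 ω := by
  refine ((Equiv.subLeft i).prodCongr (Equiv.subLeft t)).summable_iff.1 ?_
  simpa [Function.comp_def] using h

lemma measurable_volatility (ψ : ℤ → ℤ → ℝ) {η : ℤ → ℤ → Ω → ℝ}
    (hη_meas : ∀ k l, Measurable (η k l)) (i t : ℤ) : Measurable (volatility ψ η i t) :=
  (Measurable.tsum fun _ => (hη_meas _ _).const_mul _).exp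

lemma summable_comp_sub_left {ψ : ℤ → ℤ → ℝ} (hψ : Summable fun p : ℤ × ℤ => ψ p.1 p.2) (i : ℤ) :
    Summable fun q : ℤ × ℤ => ψ (i - q.1) q.2 :=
  ((Equiv.subLeft i).prodCongr (Equiv.refl ℤ)).summable_iff.2 hψ

/-- The supremum `ψ^{ij}` is attained, and it is the largest coefficient of the product of the
volatilities `σ_{i·}` and `σ_{j·}`, once the coefficients are indexed by the position of the
innovation. -/
lemma isGreatest_psiPair {ψ : ℤ → ℤ → ℝ} (hψ_nonneg : ∀ k l, 0 ≤ ψ k l)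
    (hψ_max : IsGreatest (Set.range fun p : ℤ × ℤ => ψ p.1 p.2) 1)
    (hψ_sum : Summable fun p : ℤ × ℤ => ψ p.1 p.2) (i j : ℤ) :
    IsGreatest (Set.range fun q : ℤ × ℤ => ψ (i - q.1) q.2 + ψ (j - q.1) q.2) (psiPair ψ i j) ∧
      1 ≤ psiPair ψ i j := by
  obtain ⟨p₀, hp₀⟩ := hψ_max.1
  have hp₀ : ψ p₀.1 p₀.2 = 1 := hp₀
  have hone : 1 ≤ ψ (i - (i - p₀.1)) p₀.2 + ψ (j - (i - p₀.1)) p₀.2 := by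
    rw [sub_sub_cancel, hp₀]; linarith [hψ_nonneg (j - (i - p₀.1)) p₀.2]
  obtain ⟨p, hp⟩ := exists_isGreatest_of_summable
    ((summable_comp_sub_left hψ_sum i).add (summable_comp_sub_left hψ_sum j))
    (p₀ := (i - p₀.1, p₀.2)) (one_pos.trans_le hone)
  have heq : psiPair ψ i j = ψ (i - p.1) p.2 + ψ (j - p.1) p.2 := by
    rw [← hp.csSup_eq, psiPair]
    refine (Equiv.iSup_congr ((Equiv.subLeft j).prodCongr (Equiv.refl ℤ)) fun q => ?_).symm
    simp only [Equiv.prodCongr_apply, Prod.map, Equiv.subLeft_apply, Equiv.refl_apply]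
    rw [add_comm]
    congr 2; ring
  rw [heq]
  exact ⟨hp, hone.trans (hp.2 ⟨(i - p₀.1, p₀.2), rfl⟩)⟩

end

end SVField

theorem proposition4p2 {Ω : Type*} [MeasurableSpace Ω] (P : Measure Ω) [IsProbabilityMeasure P]
    (α : ℝ) (hα : 0 < α)
    (ψ : ℤ → ℤ → ℝ) (η : ℤ → ℤ → Ω → ℝ)
    -- the coefficients: non-negative, summable, with maximum one
    (hψ_nonneg : ∀ k l, 0 ≤ ψ k l)
    (hψ_max : IsGreatest (Set.range fun p : ℤ × ℤ => ψ p.1 p.2) 1)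
    (hψ_sum : Summable fun p : ℤ × ℤ => ψ p.1 p.2)
    -- the innovations: an iid field
    (hη_meas : ∀ k l, Measurable (η k l))
    (hη_indep : iIndepFun (fun p : ℤ × ℤ => η p.1 p.2) P)
    (hη_ident : ∀ k l, IdentDistrib (η k l) (η 0 0) P P)
    -- `exp η` is regularly varying with index `α`
    (hη_tail : SVField.ExpTail (P.map (η 0 0)) α)
    -- the series defining `log σ` converge absolutely almost surely
    (hlog : ∀ i t : ℤ, ∀ᵐ ω ∂P, Summable fun p : ℤ × ℤ => ψ p.1 p.2 * η (i - p.1) (t - p.2) ω)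
    (hcase : SVField.InfiniteExpMoment (P.map (η 0 0)) α ∨
      SVField.ConvolutionTailLimit (P.map (η 0 0))) :
    (∀ i : ℤ, SVField.RegularlyVaryingSeq P
      (fun t ω (_ : Fin 1) => SVField.volatility ψ η i t ω) α) ∧
    (∀ i j : ℤ, SVField.RegularlyVaryingSeq P
      (fun t ω (_ : Fin 1) => SVField.volatility ψ η i t ω * SVField.volatility ψ η j t ω)
      (α / SVField.psiPair ψ i j)) ∧
    (∀ d : ℕ, 1 ≤ d → ∀ i j : Fin d → ℤ, SVField.RegularlyVaryingSeq P
      (fun t ω (k : Fin d) =>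
        SVField.volatility ψ η (i k) t ω * SVField.volatility ψ η (j k) t ω)
      (α / SVField.psiMulti ψ i j)) := by
  have hσ := SVField.measurable_volatility ψ hη_meas
  -- the volatility as a functional of the shifted field
  have hΨm : ∀ i : ℤ, Measurable fun x : ℤ × ℤ → ℝ =>
      Real.exp (∑' p : ℤ × ℤ, ψ p.1 p.2 * x (i - p.1, -p.2)) := fun i =>
    (Measurable.tsum fun _ => by fun_prop).exp
  have hmulti : ∀ d : ℕ, 1 ≤ d → ∀ i j : Fin d → ℤ, SVField.RegularlyVaryingSeq P
      (fun t ω (k : Fin d) =>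
        SVField.volatility ψ η (i k) t ω * SVField.volatility ψ η (j k) t ω)
      (α / SVField.psiMulti ψ i j) := by
    intro d hd i j
    have : Nonempty (Fin d) := ⟨⟨0, hd⟩⟩
    have hpair := fun k => SVField.isGreatest_psiPair hψ_nonneg hψ_max hψ_sum (i k) (j k)
    have hbdd : BddAbove (Set.range fun k => SVField.psiPair ψ (i k) (j k)) :=
      (Set.finite_range _).bddAbove
    obtain ⟨k₀, hk₀⟩ := exists_eq_ciSup_of_finite (f := fun k => SVField.psiPair ψ (i k) (j k))
    refine SVField.regularlyVaryingSeq_of_movingAverage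
      (W := fun k x s => ψ (i k - x) s + ψ (j k - x) s) hα hη_meas hη_indep hη_ident hη_tail hcase
      ?_ (fun k x s => add_nonneg (hψ_nonneg _ _) (hψ_nonneg _ _)) (fun k x s => ?_) ?_
      (fun k => (SVField.summable_comp_sub_left hψ_sum _).add
        (SVField.summable_comp_sub_left hψ_sum _)) (fun k t => ?_)
      (fun t => measurable_pi_lambda _ fun k => (hσ _ _).mul (hσ _ _)) ?_ (fun t => ?_)
    · exact one_pos.trans_le ((hpair k₀).2.trans (le_ciSup hbdd k₀))
    · exact ((hpair k).1.2 ⟨(x, s), rfl⟩).trans (le_ciSup hbdd k)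
    · obtain ⟨q, hq⟩ := (hpair k₀).1.1
      exact ⟨k₀, q.1, q.2, hq.trans hk₀⟩
    · filter_upwards [hlog (i k) t, hlog (j k) t] with ω h1 h2
      simp_rw [add_mul]
      exact (SVField.summable_volatility h1).add (SVField.summable_volatility h2)
    · exact SVField.strictlyStationary_of_shift hη_indep hη_ident
        (measurable_pi_lambda _ fun k => (hΨm (i k)).mul (hΨm (j k)))
    · refine ae_all_iff.2 fun k => ?_
      filter_upwards [hlog (i k) t, hlog (j k) t] with ω h1 h2
      rw [SVField.volatility_eq, SVField.volatility_eq, ← Real.exp_add,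
        ← (SVField.summable_volatility h1).tsum_add (SVField.summable_volatility h2)]
      simp_rw [add_mul]
  refine ⟨fun i => ?_, fun i j => ?_, hmulti⟩
  · have hle : ∀ k l, ψ k l ≤ 1 := fun k l => hψ_max.2 ⟨(k, l), rfl⟩
    rw [← div_one α]
    refine SVField.regularlyVaryingSeq_of_movingAverage (W := fun _ x s => ψ (i - x) s) hα hη_meas
      hη_indep hη_ident hη_tail hcase one_pos (fun _ _ _ => hψ_nonneg _ _) (fun _ _ _ => hle _ _) ?_
      (fun _ => SVField.summable_comp_sub_left hψ_sum i) (fun _ t => ?_)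
      (fun t => measurable_pi_lambda _ fun _ => hσ i t) ?_
      (fun t => ae_of_all _ fun ω _ => SVField.volatility_eq ψ η i t ω)
    · obtain ⟨p, hp⟩ := hψ_max.1
      exact ⟨0, i - p.1, p.2, by simpa using hp⟩
    · filter_upwards [hlog i t] with ω h1
      exact SVField.summable_volatility h1
    · exact SVField.strictlyStationary_of_shift hη_indep hη_ident
        (measurable_pi_lambda _ fun _ => hΨm i)
  · have h := hmulti 1 le_rfl (fun _ => i) (fun _ => j)
    rwa [SVField.psiMulti, ciSup_unique] at h
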